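/- Let $(M,I,J,K)$ be a hypercomplex manifold of real dimension $4n$ (that is, $I,J,K$ are integrable complex structures with $IJ=-JI=K$), and let $\Phi_I$ be a nowhere vanishing holomorphic $(2n,0)$-form on $(M,I)$ which is preserved by the Obata connection (the torsion-free connection preserving $I,J,K$), is $\mathbb H$-real, i.e. $J(\Phi_I)=\overline{\Phi_I}$, and is $\mathbb H$-positive, i.e. $\Phi_I(v_1,Jv_1,\dots,v_n,Jv_n)\ge 0$ for all tangent vectors $v_1,\dots,v_n$ at a point; thus $(M,I,J,K,\Phi_I)$ is an $SL(n,\mathbb H)$-manifold. Let $g$ be an HKT metric on $M$: a Riemannian metric for which $I,J,K$ are orthogonal and such that, with $\omega_L=g(L\cdot,\cdot)$, the $(2,0)$-form $\Omega=\omega_J+\sqrt{-1}\,\omega_K$ on $(M,I)$ satisfies $\partial\Omega=0$. For $0<i<n$ put $$V_{n+i,n+i}=c\,\mathrm{Re}\bigl((\Phi_I)^{n,n}_J\wedge\omega_J^i\bigr),$$ where $(\Phi_I)^{n,n}_J$ is the $(n,n)$-part of $\Phi_I$ with respect to the complex structure $J$ and $c\neq0$ is a real normalizing constant (for instance $c=\frac1{2^i\,i!}$).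 Assume that $g$ is not hyperkähler, i.e. that $\omega_I,\omega_J,\omega_K$ are not all closed. Then for every $0<i<n$ there is no torsion-free connection $\nabla$ on $TM$ with $\nabla V_{n+i,n+i}=0$. -/

import Mathlib

open scoped Manifold ContDiff

noncomputable section

namespace HKT

/-! ### Exterior algebra of a real vector space with an endomorphism -/

section Pointwise

variable {W : Type*} [NormedAddCommGroup W] [NormedSpace ℝ W]

/-- The exterior product of complex-valued alternating forms, normalized as a sum over shuffles:
`(a ∧ b)(v, w) = a v * b w - a w * b v` for one-forms. -/
def wedge {p q : ℕ} (a : W [⋀^Fin p]→L[ℝ] ℂ) (b : W [⋀^Fin q]→L[ℝ] ℂ) :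
    W [⋀^Fin (p + q)]→L[ℝ] ℂ :=
  { ((LinearMap.mul' ℝ ℂ).compAlternatingMap
      (a.toAlternatingMap.domCoprod b.toAlternatingMap)).domDomCongr finSumFinEquiv with
    cont := by
      have key : ∀ s : Equiv.Perm.ModSumCongr (Fin p) (Fin q), Continuous fun v : Fin p ⊕ Fin q → W =>
          LinearMap.mul' ℝ ℂ
            (AlternatingMap.domCoprod.summand a.toAlternatingMap b.toAlternatingMap s v) := by
        intro s
        induction s using Quotient.inductionOn' with
        | h s =>
          have : ∀ v : Fin p ⊕ Fin q → W, LinearMap.mul' ℝ ℂ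
              (AlternatingMap.domCoprod.summand a.toAlternatingMap b.toAlternatingMap
                (Quotient.mk'' s) v) =
              Equiv.Perm.sign s • (a (fun i => v (s (Sum.inl i))) *
                b (fun i => v (s (Sum.inr i)))) := by
            intro v
            rcases Int.units_eq_one_or (Equiv.Perm.sign s) with h | h <;>
              simp [AlternatingMap.domCoprod.summand_mk'', h]
          simp only [this]
          have ha : Continuous fun v : Fin p ⊕ Fin q → W => a (fun i => v (s (Sum.inl i))) :=
            a.cont.comp (by fun_prop)
          have hb : Continuous fun v : Fin p ⊕ Fin q → W => b (fun i => v (s (Sum.inr i))) :=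
            b.cont.comp (by fun_prop)
          exact (ha.mul hb).const_smul _
      have hsum : Continuous fun v : Fin (p + q) → W =>
          ∑ s : Equiv.Perm.ModSumCongr (Fin p) (Fin q), LinearMap.mul' ℝ ℂ
            (AlternatingMap.domCoprod.summand a.toAlternatingMap b.toAlternatingMap s
              (fun i => v (finSumFinEquiv i))) :=
        continuous_finsetSum _ fun s _ => (key s).comp (by fun_prop)
      convert! hsum using 2 with v
      simp [AlternatingMap.domCoprod, Function.comp_def] }

/-- The exterior power `w ∧ ⋯ ∧ w` (`i` factors) of a two-form. -/
def wedgePow (w : W [⋀^Fin 2]→L[ℝ] ℂ) : (i : ℕ) → W [⋀^Fin (2 * i)]→L[ℝ] ℂ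
  | 0 => ContinuousAlternatingMap.constOfIsEmpty ℝ W (Fin 0) 1
  | i + 1 => wedge (wedgePow w i) w

/-- The rotation `cos t + sin t L`; if `L² = -1` these form the circle action attached to the
complex structure `L`. -/
def rot (L : W →L[ℝ] W) (t : ℝ) : W →L[ℝ] W :=
  Real.cos t • ContinuousLinearMap.id ℝ W + Real.sin t • L

/-- The `(p, q)`-part of a complex-valued form with respect to a complex structure `L`.
A form of type `(p, q)` is multiplied by `e^{(p - q) √-1 t}` under pull-back by `cos t + sin t L`,
so on forms of degree `p + q` this Fourier coefficient is the projection to the type `(p, q)`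
along the other types. -/
def typePart (L : W →L[ℝ] W) (p q : ℕ) {k : ℕ} (a : W [⋀^Fin k]→L[ℝ] ℂ) :
    W [⋀^Fin k]→L[ℝ] ℂ :=
  ((2 * Real.pi)⁻¹ : ℝ) • ∫ t in (0 : ℝ)..(2 * Real.pi),
    Complex.exp (-(((p : ℂ) - q) * t * Complex.I)) • a.compContinuousLinearMap (rot L t)

/-- The two-form `(v, w) ↦ b (L v, w)` attached to a bilinear form `b` and an endomorphism `L`,
antisymmetrized so that it is a form without hypotheses; see `fundamentalForm_apply`. -/
def fundamentalForm (b : W →L[ℝ] W →L[ℝ] ℝ) (L : W →L[ℝ] W) : W [⋀^Fin 2]→L[ℝ] ℝ where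
  toFun v := (b (L (v 0)) (v 1) - b (L (v 1)) (v 0)) / 2
  map_update_add' v i x y := by
    fin_cases i <;> simp [Function.update] <;> ring
  map_update_smul' v i c x := by
    fin_cases i <;> simp [Function.update] <;> ring
  map_eq_zero_of_eq' v i j h hij := by
    fin_cases i <;> fin_cases j <;> simp_all
  cont := by fun_prop

theorem fundamentalForm_apply (b : W →L[ℝ] W →L[ℝ] ℝ) (L : W →L[ℝ] W)
    (hb : ∀ v w, b v w = b w v) (hL : ∀ v, L (L v) = -v) (hbL : ∀ v w, b (L v) (L w) = b v w)
    (v : Fin 2 → W) : fundamentalForm b L v = b (L (v 0)) (v 1) := by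
  have h : b (L (v 1)) (v 0) = - b (L (v 0)) (v 1) := by
    rw [← hbL (L (v 1)) (v 0), hL, hb]
    simp
  change (b (L (v 0)) (v 1) - b (L (v 1)) (v 0)) / 2 = _
  rw [h]
  ring

/-- A real form, regarded as a complex-valued form. -/
def toComplex {k : ℕ} (a : W [⋀^Fin k]→L[ℝ] ℝ) : W [⋀^Fin k]→L[ℝ] ℂ :=
  Complex.ofRealCLM.compContinuousAlternatingMap a

/-- The real part of a complex-valued form. -/
def rePart {k : ℕ} (a : W [⋀^Fin k]→L[ℝ] ℂ) : W [⋀^Fin k]→L[ℝ] ℝ :=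
  Complex.reCLM.compContinuousAlternatingMap a

end Pointwise

/-! ### Differential forms and connections on a manifold

`M` is a manifold without boundary modelled on `E`. In Mathlib every tangent space of `M` is, by
definition, a copy of `E`; forms and endomorphism fields are written with `E` in its place. -/

section Manifold

variable (E : Type*) [NormedAddCommGroup E] [NormedSpace ℝ E]
  (M : Type*) [TopologicalSpace M] [ChartedSpace E M] [IsManifold 𝓘(ℝ, E) ∞ M]

/-- Differential `k`-forms with values in `F` (no regularity imposed): a form on every `T_x M`. -/
abbrev Form (k : ℕ) (F : Type*) [NormedAddCommGroup F] [NormedSpace ℝ F] : Type _ :=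
  M → E [⋀^Fin k]→L[ℝ] F

/-- Fields of endomorphisms of the tangent spaces (no regularity imposed). -/
abbrev EndField : Type _ := M → E →L[ℝ] E

/-- Vector fields (no regularity imposed). -/
abbrev VField : Type _ := (x : M) → TangentSpace 𝓘(ℝ, E) x

/-- Connections on the tangent bundle (no regularity imposed); `∇_v Y` at `x` is `D Y x v`. -/
abbrev Connection : Type _ :=
  CovariantDerivative 𝓘(ℝ, E) E (TangentSpace 𝓘(ℝ, E) : M → Type _)

/-- Smooth Riemannian metrics. -/
abbrev Metric : Type _ :=
  Bundle.ContMDiffRiemannianMetric 𝓘(ℝ, E) ∞ E (TangentSpace 𝓘(ℝ, E) : M → Type _)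

variable {E M}
variable {F : Type*} [NormedAddCommGroup F] [NormedSpace ℝ F]

/-- The vector field `Y` is differentiable at `x`. -/
def DiffAt (Y : VField E M) (x : M) : Prop :=
  MDifferentiableAt 𝓘(ℝ, E) 𝓘(ℝ, E).tangent
    (fun y => (⟨y, Y y⟩ : TangentBundle 𝓘(ℝ, E) M)) x

/-- The vector field `Y` is smooth. -/
def SmoothField (Y : VField E M) : Prop :=
  ContMDiff 𝓘(ℝ, E) 𝓘(ℝ, E).tangent ∞ (fun y => (⟨y, Y y⟩ : TangentBundle 𝓘(ℝ, E) M))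

/-- The image `L Y` of a vector field under a field of endomorphisms. -/
def EndField.app (L : EndField E M) (Y : VField E M) : VField E M := fun x => L x (Y x)

/-- Smoothness of a field of endomorphisms, as a section of the bundle `Hom(TM, TM)`. -/
def EndField.Smooth (L : EndField E M) : Prop :=
  ContMDiff 𝓘(ℝ, E) (𝓘(ℝ, E).prod 𝓘(ℝ, E →L[ℝ] E)) ∞
    (fun x => Bundle.TotalSpace.mk' (E →L[ℝ] E)
      (E := fun x : M => TangentSpace 𝓘(ℝ, E) x →L[ℝ] TangentSpace 𝓘(ℝ, E) x) x (L x))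

/-- The Lie bracket of vector fields, with value at `x` written in `E`. -/
def bracket (X Y : VField E M) (x : M) : E := VectorField.mlieBracket 𝓘(ℝ, E) X Y x

/-- Vanishing of the Nijenhuis tensor
`[X, Y] + L [L X, Y] + L [X, L Y] - [L X, L Y]`. -/
def EndField.Integrable (L : EndField E M) : Prop :=
  ∀ X Y : VField E M, SmoothField X → SmoothField Y → ∀ x : M,
    bracket X Y x + L x (bracket (L.app X) Y x) + L x (bracket X (L.app Y) x)
      - bracket (L.app X) (L.app Y) x = 0

/-- The expression of a form in the preferred chart at `x₀` (pull-back by the inverse chart). -/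
def Form.inChart {k : ℕ} (a : Form E M k F) (x₀ : M) : E → E [⋀^Fin k]→L[ℝ] F := fun y =>
  (a ((extChartAt 𝓘(ℝ, E) x₀).symm y)).compContinuousLinearMap
    (mfderiv 𝓘(ℝ, E) 𝓘(ℝ, E) (extChartAt 𝓘(ℝ, E) x₀).symm y : E →L[ℝ] E)

/-- A form is smooth if all its chart expressions are. -/
def Form.Smooth {k : ℕ} (a : Form E M k F) : Prop :=
  ∀ x₀ : M, ContDiffOn ℝ ∞ (a.inChart x₀) (extChartAt 𝓘(ℝ, E) x₀).target

/-- The de Rham differential: at `x`, take the exterior derivative of the expression in the chart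
at `x` and pull it back to `T_x M`. -/
def Form.d {k : ℕ} (a : Form E M k F) : Form E M (k + 1) F := fun x =>
  (extDeriv (a.inChart x) (extChartAt 𝓘(ℝ, E) x x)).compContinuousLinearMap
    (mfderiv 𝓘(ℝ, E) 𝓘(ℝ, E) (extChartAt 𝓘(ℝ, E) x) x : E →L[ℝ] E)

/-- The Dolbeault operator `∂` of `(M, L)` on forms of type `(p, q)`: the `(p + 1, q)`-part of the
de Rham differential. -/
def Form.del (L : EndField E M) (p q : ℕ) {k : ℕ} (a : Form E M k ℂ) : Form E M (k + 1) ℂ :=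
  fun x => typePart (L x) (p + 1) q (a.d x)

/-- The Dolbeault operator `∂̄` of `(M, L)` on forms of type `(p, q)`: the `(p, q + 1)`-part of the
de Rham differential. -/
def Form.delbar (L : EndField E M) (p q : ℕ) {k : ℕ} (a : Form E M k ℂ) : Form E M (k + 1) ℂ :=
  fun x => typePart (L x) p (q + 1) (a.d x)

/-- The connection `D` preserves the form `a`, i.e. `∇ a = 0`:
`v (a (Y₁, …, Y_k)) = ∑ j, a (Y₁, …, ∇_v Y_j, …, Y_k)` for all vector fields `Y₁, …, Y_k`. -/
def Connection.PreservesForm (D : Connection E M) {k : ℕ} (a : Form E M k F) : Prop :=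
  ∀ (x : M) (Y : Fin k → VField E M), (∀ j, DiffAt (Y j) x) → ∀ v : TangentSpace 𝓘(ℝ, E) x,
    mfderiv 𝓘(ℝ, E) 𝓘(ℝ, F) (fun y => a y (fun j => Y j y)) x v =
      ∑ j, a x (Function.update (fun l => (Y l x : E)) j (D (Y j) x v))

/-- The connection `D` preserves the field of endomorphisms `L`: `∇ (L Y) = L (∇ Y)`. -/
def Connection.PreservesEnd (D : Connection E M) (L : EndField E M) : Prop :=
  ∀ (x : M) (Y : VField E M), DiffAt Y x → ∀ v : TangentSpace 𝓘(ℝ, E) x,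
    D (L.app Y) x v = L x (D Y x v)

/-- The torsion tensor of `D` vanishes. -/
def Connection.TorsionFree [FiniteDimensional ℝ E]
    (D : Connection E M) : Prop :=
  haveI : CompleteSpace E := FiniteDimensional.complete ℝ E
  CovariantDerivative.torsion D = 0

end Manifold

/-! ### Hypercomplex, HKT and `SL(n, ℍ)` geometry -/

section Hypercomplex

variable (E : Type*) [NormedAddCommGroup E] [NormedSpace ℝ E]
  (M : Type*) [TopologicalSpace M] [ChartedSpace E M] [IsManifold 𝓘(ℝ, E) ∞ M]

/-- A hypercomplex structure: three complex structures (smooth and integrable) with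
`I J = - J I = K`. -/
structure Hypercomplex where
  I : EndField E M
  J : EndField E M
  K : EndField E M
  smooth_I : I.Smooth
  smooth_J : J.Smooth
  smooth_K : K.Smooth
  I_sq : ∀ x v, I x (I x v) = -v
  J_sq : ∀ x v, J x (J x v) = -v
  K_sq : ∀ x v, K x (K x v) = -v
  I_J : ∀ x v, I x (J x v) = K x v
  J_I : ∀ x v, J x (I x v) = -K x v
  integrable_I : I.Integrable
  integrable_J : J.Integrable
  integrable_K : K.Integrable

variable {E M}

/-- The form `ω_L = g (L ·, ·)`. -/
def omega (g : Metric E M) (L : EndField E M) : Form E M 2 ℝ := fun x =>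
  fundamentalForm (W := E) (g.inner x) (L x)

namespace Hypercomplex

variable (H : Hypercomplex E M)

/-- The metric `g` is quaternionic Hermitian: `I`, `J`, `K` (hence all unit quaternions) act by
isometries. -/
structure IsQuaternionicHermitian (g : Metric E M) : Prop where
  inv_I : ∀ (x : M) (v w : TangentSpace 𝓘(ℝ, E) x), g.inner x (H.I x v) (H.I x w) = g.inner x v w
  inv_J : ∀ (x : M) (v w : TangentSpace 𝓘(ℝ, E) x), g.inner x (H.J x v) (H.J x w) = g.inner x v w
  inv_K : ∀ (x : M) (v w : TangentSpace 𝓘(ℝ, E) x), g.inner x (H.K x v) (H.K x w) = g.inner x v w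

/-- The form `Ω = ω_J + √-1 ω_K`, of type `(2, 0)` on `(M, I)`. -/
def Omega (g : Metric E M) : Form E M 2 ℂ := fun x =>
  toComplex (omega g H.J x) + Complex.I • toComplex (omega g H.K x)

/-- `g` is an HKT metric (equivalently, `Ω` is an HKT form): `g` is quaternionic Hermitian and
`∂ Ω = 0` on `(M, I)`. -/
structure IsHKT (g : Metric E M) : Prop where
  hermitian : H.IsQuaternionicHermitian g
  del_Omega : (H.Omega g).del H.I 2 0 = 0

/-- `g` is hyperkähler: it is Kähler with respect to each of `I`, `J`, `K`. -/
structure IsHyperkahler (g : Metric E M) : Prop where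
  hermitian : H.IsQuaternionicHermitian g
  closed_I : (omega g H.I).d = 0
  closed_J : (omega g H.J).d = 0
  closed_K : (omega g H.K).d = 0

/-- `D` is the Obata connection: the (unique) torsion-free connection preserving `I`, `J`, `K`. -/
structure IsObata [FiniteDimensional ℝ E] (D : Connection E M) : Prop where
  torsionFree : D.TorsionFree
  preserves_I : D.PreservesEnd H.I
  preserves_J : D.PreservesEnd H.J
  preserves_K : D.PreservesEnd H.K

/-- `(M, I, J, K, Φ)` is an `SL(n, ℍ)`-manifold: `Φ` is a holomorphic volume form on `(M, I)`
which is preserved by the Obata connection, `ℍ`-real and `ℍ`-positive. -/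
structure IsSLnH [FiniteDimensional ℝ E] (n : ℕ) (Phi : Form E M (2 * n) ℂ) : Prop where
  smooth : Phi.Smooth
  /-- `Φ` is of type `(2n, 0)` on `(M, I)`, that is, `I`-complex linear in each argument. -/
  type_top : ∀ (x : M) (v : Fin (2 * n) → E) (j : Fin (2 * n)),
    Phi x (Function.update v j (H.I x (v j))) = Complex.I * Phi x v
  ne_zero : ∀ x, Phi x ≠ 0
  holomorphic : Phi.delbar H.I (2 * n) 0 = 0
  parallel : ∃ D : Connection E M, H.IsObata D ∧ D.PreservesForm Phi
  /-- `J Φ` is the complex conjugate of `Φ`. -/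
  real : ∀ (x : M) (v : Fin (2 * n) → E),
    Phi x (fun j => H.J x (v j)) = (starRingEnd ℂ) (Phi x v)
  /-- `Φ (v₁, J v₁, …, v_n, J v_n) ≥ 0`; up to the factor `4 ^ n` this is the value of `Φ` on
  `(z₁, J z̄₁, …, z_n, J z̄_n)`, where `z_j` is the `(1, 0)`-vector `v_j - √-1 I v_j`. -/
  positive : ∀ (x : M) (v : Fin n → E),
    0 ≤ (Phi x (fun j : Fin (2 * n) =>
      if j.val % 2 = 0 then v ⟨j.val / 2, by omega⟩ else H.J x (v ⟨j.val / 2, by omega⟩))).re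

/-- The real `(n + i, n + i)`-form `V_{n+i,n+i} = c Re (Φ_J^{n,n} ∧ ω_J^i)` on `(M, J)`, where
`Φ_J^{n,n}` is the `(n, n)`-part of `Φ` with respect to `J` and `c` is a normalizing constant. -/
def calibV (g : Metric E M) {n : ℕ} (Phi : Form E M (2 * n) ℂ) (i : ℕ) (c : ℝ) :
    Form E M (2 * n + 2 * i) ℝ := fun x =>
  c • rePart (wedge (typePart (H.J x) n n (Phi x)) (wedgePow (toComplex (omega g H.J x)) i))

end Hypercomplex

end Hypercomplex

end HKT

end

noncomputable section

namespace HKT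

/-! ### Exterior products and type decomposition: formulas on vectors -/

section ExteriorFormulas

variable {W : Type*} [NormedAddCommGroup W] [NormedSpace ℝ W]
  {W' : Type*} [NormedAddCommGroup W'] [NormedSpace ℝ W']

/-! Suppose a torsion-free connection preserves $V=V_{n+i,n+i}$. In a local quaternionic orthonormal
frame $g,I,J,K$ have constant coefficients. So has $\Phi_I$ up to one real factor, because $\mathbb
H$-real forms of type $(2n,0)$ at a point form a real line. Hence $V$ is constant up to a factor,
and each coefficient endomorphism $C_u$ of the connection multiplies $V$ by a scalar.

The algebraic core is `CalibLike.actForm_eq_zero`: for $0<i<n$ an endomorphism $C$ annihilating $V$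
annihilates $\omega_J$. Only the properties in `CalibLike` are used. The symmetries of $V$ make it
vanish on most lists of frame vectors, so $C\cdot V=0$ evaluated on a few lists gives short linear
relations. Start from the list $e_a,Je_a$ (all $a$), $Ie_d,JIe_d$ ($d<i$). Replacing $Je_b$ by
$Ie_a$, with $b<i\le a$, shows that $C\cdot\omega_J$ vanishes on orthogonal quaternionic lines.
Polarization then makes $(C\cdot\omega_J)(u,Lu)$ the same for all unit frame vectors $u$, for
$L=I,J,K$. The trace of $C$ on the list settles $L=J$; replacing $Je_a$ by $Ie_a$ settles $L=I$; and
$L=K$ follows by turning $(I,J,K)$ into $(K,J,-I)$.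

Correcting $C_u$ by a multiple of the identity, one finds that it acts on $\omega_J$ by a scalar
$\kappa(u)$ (`IsLocalFrame.coef_omega`). Torsion-freeness gives $d\omega_J=-\kappa\wedge\omega_J$,
while the HKT condition says that $d\omega_J$ has no $(3,0)+(0,3)$-part for $I$. Evaluating on
$(u,v,Jv)$ with $v$ quaternionically orthogonal to $u$ gives $\kappa=0$. Now $d\omega_J=0$, and the
type of the Obata derivative of $\omega_J$ forces that derivative to vanish (`eq_zero_of_frameD`).
So the Obata connection preserves $g$, and all three forms are closed, contrary to the assumption.
-/

theorem factorial_mul_wedge {p q : ℕ} (a : W [⋀^Fin p]→L[ℝ] ℂ) (b : W [⋀^Fin q]→L[ℝ] ℂ)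
    (v : Fin (p + q) → W) :
    ((p.factorial * q.factorial : ℕ) : ℂ) * wedge a b v =
      ∑ σ : Equiv.Perm (Fin p ⊕ Fin q), ((Equiv.Perm.sign σ : ℤ) : ℂ) *
        (a (fun i => v (finSumFinEquiv (σ (Sum.inl i)))) *
          b (fun i => v (finSumFinEquiv (σ (Sum.inr i))))) := by
  have h := MultilinearMap.domCoprod_alternization_eq a.toAlternatingMap b.toAlternatingMap
  have h2 := congrArg (fun f => LinearMap.mul' ℝ ℂ (f (fun i => v (finSumFinEquiv i)))) h
  simp only [Fintype.card_fin, MultilinearMap.alternatization_apply, map_sum] at h2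
  have h3 : wedge a b v = LinearMap.mul' ℝ ℂ
      ((a.toAlternatingMap.domCoprod b.toAlternatingMap) (fun i => v (finSumFinEquiv i))) := rfl
  rw [h3, ← nsmul_eq_mul, ← map_nsmul]
  refine (h2.symm.trans ?_)
  refine Finset.sum_congr rfl fun σ _ => ?_
  rcases Int.units_eq_one_or (Equiv.Perm.sign σ) with h | h <;> simp [h]

/-- `P` need not be linear: the permutation formula only evaluates `a` and `b` on sublists of the
given vectors. The factor `k` carries the scaling of $\Phi_I$ under a change of frame. -/
theorem wedge_map {p q : ℕ} {a : W [⋀^Fin p]→L[ℝ] ℂ} {b : W [⋀^Fin q]→L[ℝ] ℂ}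
    {a' : W' [⋀^Fin p]→L[ℝ] ℂ} {b' : W' [⋀^Fin q]→L[ℝ] ℂ} {P : W' → W} {k : ℂ}
    (ha : ∀ v : Fin p → W', a (fun j => P (v j)) = k * a' v)
    (hb : ∀ v : Fin q → W', b (fun j => P (v j)) = b' v) (v : Fin (p + q) → W') :
    wedge a b (fun j => P (v j)) = k * wedge a' b' v := by
  have hpq : ((p.factorial * q.factorial : ℕ) : ℂ) ≠ 0 := by
    exact_mod_cast Nat.mul_ne_zero p.factorial_ne_zero q.factorial_ne_zero
  apply mul_left_cancel₀ hpq
  rw [factorial_mul_wedge, mul_left_comm, factorial_mul_wedge, Finset.mul_sum]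
  refine Finset.sum_congr rfl fun σ _ => ?_
  rw [ha (fun i => v (finSumFinEquiv (σ (Sum.inl i)))),
    hb (fun i => v (finSumFinEquiv (σ (Sum.inr i))))]
  ring

theorem wedgePow_map {w : W [⋀^Fin 2]→L[ℝ] ℂ} {w' : W' [⋀^Fin 2]→L[ℝ] ℂ} {P : W' → W}
    (h : ∀ v : Fin 2 → W', w (fun j => P (v j)) = w' v) :
    ∀ (i : ℕ) (v : Fin (2 * i) → W'), wedgePow w i (fun j => P (v j)) = wedgePow w' i v
  | 0, _ => rfl
  | i + 1, v => by
    have := wedge_map (k := 1) (fun v => by rw [one_mul]; exact wedgePow_map h i v) h v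
    rwa [one_mul] at this

theorem rot_apply (L : W →L[ℝ] W) (t : ℝ) (v : W) :
    rot L t v = Real.cos t • v + Real.sin t • L v := by
  simp [rot]

theorem continuous_rot (L : W →L[ℝ] W) : Continuous (rot L) := by
  unfold rot; fun_prop

theorem typePart_apply (L : W →L[ℝ] W) (p q : ℕ) {k : ℕ} (a : W [⋀^Fin k]→L[ℝ] ℂ)
    (v : Fin k → W) :
    typePart L p q a v = ((2 * Real.pi)⁻¹ : ℝ) • ∫ t in (0 : ℝ)..(2 * Real.pi),
      Complex.exp (-(((p : ℂ) - q) * t * Complex.I)) * a (fun j => rot L t (v j)) := by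
  have hc : Continuous fun t : ℝ => Complex.exp (-(((p : ℂ) - q) * t * Complex.I)) •
      a.compContinuousLinearMap (rot L t) := by
    have h0 : Continuous fun t : ℝ => Complex.exp (-(((p : ℂ) - q) * t * Complex.I)) := by
      fun_prop
    refine h0.smul ?_
    have h1 := (ContinuousAlternatingMap.continuous_compContinuousLinearMapCLM
      (𝕜 := ℝ) (E := W) (F := W) (G := ℂ) (ι := Fin k)).comp (continuous_rot L)
    exact h1.clm_apply continuous_const
  have := (ContinuousAlternatingMap.apply ℝ W ℂ v).intervalIntegral_comp_comm
    (hc.intervalIntegrable (μ := MeasureTheory.volume) 0 (2 * Real.pi))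
  unfold typePart
  rw [ContinuousAlternatingMap.smul_apply]
  congr 1
  exact this.symm

/-- `P` intertwines the two circle actions, hence all their Fourier coefficients. -/
theorem typePart_map {L : W →L[ℝ] W} {L' : W' →L[ℝ] W'} (p q : ℕ) {k : ℕ}
    {a : W [⋀^Fin k]→L[ℝ] ℂ} {a' : W' [⋀^Fin k]→L[ℝ] ℂ} {P : W' →ₗ[ℝ] W} {c : ℂ}
    (hP : ∀ v, L (P v) = P (L' v)) (ha : ∀ v : Fin k → W', a (fun j => P (v j)) = c * a' v)
    (v : Fin k → W') : typePart L p q a (fun j => P (v j)) = c * typePart L' p q a' v := by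
  rw [typePart_apply, typePart_apply, mul_smul_comm, ← intervalIntegral.integral_const_mul]
  congr 1
  refine intervalIntegral.integral_congr fun t _ => ?_
  have : (fun j => rot L t (P (v j))) = fun j => P (rot L' t (v j)) := by
    funext j; simp [rot_apply, hP]
  simp only [this]
  rw [ha (fun j => rot L' t (v j))]
  ring

theorem rot_rot {L : W →L[ℝ] W} (hL : ∀ v, L (L v) = -v) (s t : ℝ) (v : W) :
    rot L s (rot L t v) = rot L (s + t) v := by
  simp only [rot_apply, map_add, map_smul, hL, Real.cos_add, Real.sin_add]
  module

theorem rot_add_two_pi (L : W →L[ℝ] W) (t : ℝ) : rot L (t + 2 * Real.pi) = rot L t := by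
  simp [rot]

/-- For type $(p,p)$ the Fourier weight is trivial, so the projection is a mean over the circle, and
a mean over a full period does not see a shift of the angle. -/
theorem typePart_rot {L : W →L[ℝ] W} (hL : ∀ v, L (L v) = -v) (p : ℕ) {k : ℕ}
    (a : W [⋀^Fin k]→L[ℝ] ℂ) (s : ℝ) (v : Fin k → W) :
    typePart L p p a (fun j => rot L s (v j)) = typePart L p p a v := by
  rw [typePart_apply, typePart_apply]
  congr 1
  have hper : Function.Periodic (fun t : ℝ => a (fun j => rot L t (v j))) (2 * Real.pi) := by
    intro t; simp only [rot_add_two_pi]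
  have h := hper.intervalIntegral_add_eq s 0
  simp only [zero_add] at h
  simp only [sub_self, zero_mul, neg_zero, Complex.exp_zero, one_mul, rot_rot hL]
  rw [← h, intervalIntegral.integral_comp_add_right (fun t => a (fun j => rot L t (v j)))]
  simp [add_comm]

theorem typePart_eq_of_rot {L : W →L[ℝ] W} (p : ℕ) {k : ℕ} {a : W [⋀^Fin k]→L[ℝ] ℂ}
    {v : Fin k → W} (h : ∀ t, a (fun j => rot L t (v j)) = a v) : typePart L p p a v = a v := by
  rw [typePart_apply]
  simp only [h, sub_self, zero_mul, neg_zero, Complex.exp_zero, one_mul,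
    intervalIntegral.integral_const, sub_zero, smul_smul]
  rw [inv_mul_cancel₀ (by positivity), one_smul]

theorem typePart_eq_zero_of_rot {L : W →L[ℝ] W} (p q : ℕ) {k : ℕ} {a : W [⋀^Fin k]→L[ℝ] ℂ}
    {v : Fin k → W} (h : ∀ t, a (fun j => rot L t (v j)) = 0) : typePart L p q a v = 0 := by
  rw [typePart_apply]
  simp [h]

/-- The value at a point of the form `V_{n+i,n+i}`. -/
def calib (L : W →L[ℝ] W) (b : W →L[ℝ] W →L[ℝ] ℝ) {n : ℕ} (Phi : W [⋀^Fin (2 * n)]→L[ℝ] ℂ)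
    (i : ℕ) (c : ℝ) : W [⋀^Fin (2 * n + 2 * i)]→L[ℝ] ℝ :=
  c • rePart (wedge (typePart L n n Phi) (wedgePow (toComplex (fundamentalForm b L)) i))

theorem calib_apply (L : W →L[ℝ] W) (b : W →L[ℝ] W →L[ℝ] ℝ) {n : ℕ}
    (Phi : W [⋀^Fin (2 * n)]→L[ℝ] ℂ) (i : ℕ) (c : ℝ) (v : Fin (2 * n + 2 * i) → W) :
    calib L b Phi i c v = c *
      (wedge (typePart L n n Phi) (wedgePow (toComplex (fundamentalForm b L)) i) v).re := rfl

theorem calib_map {L : W →L[ℝ] W} {L' : W' →L[ℝ] W'} {b : W →L[ℝ] W →L[ℝ] ℝ}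
    {b' : W' →L[ℝ] W' →L[ℝ] ℝ} {n : ℕ} {Phi : W [⋀^Fin (2 * n)]→L[ℝ] ℂ}
    {Phi' : W' [⋀^Fin (2 * n)]→L[ℝ] ℂ} (i : ℕ) (c : ℝ) {P : W' →ₗ[ℝ] W} {d : ℝ}
    (hP : ∀ v, L (P v) = P (L' v)) (hb : ∀ v w, b (P v) (P w) = b' v w)
    (ha : ∀ v : Fin (2 * n) → W', Phi (fun j => P (v j)) = d * Phi' v)
    (v : Fin (2 * n + 2 * i) → W') :
    calib L b Phi i c (fun j => P (v j)) = d * calib L' b' Phi' i c v := by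
  have h2 : ∀ v : Fin 2 → W', toComplex (fundamentalForm b L) (fun j => P (v j)) =
      toComplex (fundamentalForm b' L') v := by
    intro v
    change (((b (L (P (v 0))) (P (v 1)) - b (L (P (v 1))) (P (v 0))) / 2 : ℝ) : ℂ) =
      (((b' (L' (v 0)) (v 1) - b' (L' (v 1)) (v 0)) / 2 : ℝ) : ℂ)
    simp only [hP, hb]
  rw [calib_apply, calib_apply, wedge_map (typePart_map n n hP ha) (wedgePow_map h2 i),
    Complex.re_ofReal_mul]
  ring

/-- Both factors are invariant: the $(n,n)$-part by averaging, and the fundamental form because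
$\cos^2+\sin^2=1$. -/
theorem calib_rot {L : W →L[ℝ] W} {b : W →L[ℝ] W →L[ℝ] ℝ} (hL : ∀ v, L (L v) = -v)
    (hb : ∀ v w, b (L v) (L w) = b v w) {n : ℕ} (Phi : W [⋀^Fin (2 * n)]→L[ℝ] ℂ) (i : ℕ)
    (c : ℝ) (s : ℝ) (v : Fin (2 * n + 2 * i) → W) :
    calib L b Phi i c (fun j => rot L s (v j)) = calib L b Phi i c v := by
  have hb' : ∀ v w, b (L v) w = - b v (L w) := fun v w => by
    rw [← hb v (L w), hL]; simp
  have h2 : ∀ v : Fin 2 → W, toComplex (fundamentalForm b L) (fun j => rot L s (v j)) =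
      toComplex (fundamentalForm b L) v := by
    intro v
    change (((b (L (rot L s (v 0))) (rot L s (v 1)) - b (L (rot L s (v 1))) (rot L s (v 0))) / 2
      : ℝ) : ℂ) = (((b (L (v 0)) (v 1) - b (L (v 1)) (v 0)) / 2 : ℝ) : ℂ)
    congr 2
    have h := Real.sin_sq_add_cos_sq s
    simp only [rot_apply, map_add, map_smul, hL, hb', add_apply,
      smul_apply, smul_eq_mul, map_neg, neg_apply]
    linear_combination (-(b (v 0) (L (v 1))) + b (v 1) (L (v 0))) * h
  have h1 : ∀ v : Fin (2 * n) → W, typePart L n n Phi (fun j => rot L s (v j)) =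
      1 * typePart L n n Phi v := fun v => by rw [one_mul, typePart_rot hL]
  rw [calib_apply, calib_apply, wedge_map h1 (wedgePow_map h2 i), one_mul]

/-- Every term of the exterior product contains the $(n,n)$-part of `Phi` on vectors of `U`. Since
`U` is stable under `L`, the rotated vectors stay in `U`, where `Phi` vanishes. -/
theorem calib_eq_zero {L : W →L[ℝ] W} (b : W →L[ℝ] W →L[ℝ] ℝ) {n : ℕ}
    {Phi : W [⋀^Fin (2 * n)]→L[ℝ] ℂ} (i : ℕ) (c : ℝ) {U : Submodule ℝ W}
    (hU : ∀ v ∈ U, L v ∈ U) (h : ∀ v : Fin (2 * n) → W, (∀ j, v j ∈ U) → Phi v = 0)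
    {v : Fin (2 * n + 2 * i) → W} (hv : ∀ j, v j ∈ U) : calib L b Phi i c v = 0 := by
  have key : ∀ v : Fin (2 * n) → W, (∀ j, v j ∈ U) → typePart L n n Phi v = 0 := fun v hv =>
    typePart_eq_zero_of_rot n n fun t => h _ fun j => by
      rw [rot_apply]
      exact U.add_mem (U.smul_mem _ (hv j)) (U.smul_mem _ (hU _ (hv j)))
  have hpq : (((2 * n).factorial * (2 * i).factorial : ℕ) : ℂ) ≠ 0 := by
    exact_mod_cast Nat.mul_ne_zero (2 * n).factorial_ne_zero (2 * i).factorial_ne_zero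
  have : wedge (typePart L n n Phi) (wedgePow (toComplex (fundamentalForm b L)) i) v = 0 := by
    apply mul_left_cancel₀ hpq
    rw [factorial_mul_wedge, mul_zero]
    refine Finset.sum_eq_zero fun σ _ => ?_
    rw [key _ fun j => hv _]
    ring
  rw [calib_apply, this]
  simp

end ExteriorFormulas

/-! ### Alternating maps evaluated on pairs of vectors -/

section Pairs

variable {W F ι : Type*} [AddCommGroup W] [Module ℝ W] [AddCommGroup F] [Module ℝ F]
  [DecidableEq ι]

theorem map_update_swap (f : W [⋀^ι]→ₗ[ℝ] F) (v : ι → W) {p q : ι} (hpq : p ≠ q) (x y : W) :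
    f (Function.update (Function.update v p x) q y) =
      -f (Function.update (Function.update v p y) q x) := by
  rw [← f.map_swap _ hpq]
  congr 1
  funext j
  by_cases hq : j = q
  · subst hq; simp [hpq]
  · by_cases hp : j = p
    · subst hp; simp [hpq]
    · simp [Equiv.swap_apply_of_ne_of_ne hp hq, hp, hq]

theorem map_update_self_eq_zero (f : W [⋀^ι]→ₗ[ℝ] F) (v : ι → W) {p q : ι} (hpq : p ≠ q) (x : W) :
    f (Function.update (Function.update v p x) q x) = 0 :=
  f.map_eq_zero_of_eq _ (by simp [hpq]) hpq

/-- The factor is the determinant of the substitution in the plane of `x` and `y`. -/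
theorem map_update_pair (f : W [⋀^ι]→ₗ[ℝ] F) (v : ι → W) {p q : ι} (hpq : p ≠ q) (x y : W)
    (a b c d : ℝ) :
    f (Function.update (Function.update v p (a • x + b • y)) q (c • x + d • y)) =
      (a * d - b * c) • f (Function.update (Function.update v p x) q y) := by
  have h1 : ∀ z, f (Function.update (Function.update v p (a • x + b • y)) q z) =
      a • f (Function.update (Function.update v p x) q z) +
        b • f (Function.update (Function.update v p y) q z) := by
    intro z
    simp only [Function.update_comm hpq, f.map_update_add, f.map_update_smul]
  rw [h1, f.map_update_add, f.map_update_add, f.map_update_smul, f.map_update_smul,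
    f.map_update_smul, f.map_update_smul, map_update_self_eq_zero f v hpq,
    map_update_self_eq_zero f v hpq, map_update_swap f v hpq y x]
  module

variable {X : Type*} [Fintype X] [DecidableEq X]

/-- Rotating each of the pairs `(v (x, 0), v (x, 1))` does not change an alternating map. -/
theorem map_rot_pairs (f : W [⋀^X × Fin 2]→ₗ[ℝ] F) (v w : X × Fin 2 → W) (c s : X → ℝ)
    (hcs : ∀ x, c x ^ 2 + s x ^ 2 = 1) (h0 : ∀ x, w (x, 0) = c x • v (x, 0) + s x • v (x, 1))
    (h1 : ∀ x, w (x, 1) = -s x • v (x, 0) + c x • v (x, 1)) : f w = f v := by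
  have key : ∀ A : Finset X, f (fun j => if j.1 ∈ A then w j else v j) = f v := by
    intro A
    induction A using Finset.induction_on with
    | empty => simp
    | insert x A hx ih =>
      set u : X × Fin 2 → W := fun j => if j.1 ∈ A then w j else v j with hu
      have hne : ((x, 0) : X × Fin 2) ≠ (x, 1) := by simp
      have h := map_update_pair f u hne (v (x, 0)) (v (x, 1)) (c x) (s x) (-s x) (c x)
      have e1 : (fun j : X × Fin 2 => if j.1 ∈ insert x A then w j else v j) =
          Function.update (Function.update u (x, 0) (c x • v (x, 0) + s x • v (x, 1))) (x, 1)
            (-s x • v (x, 0) + c x • v (x, 1)) := by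
        rw [← h0, ← h1]
        funext ⟨y, r⟩
        by_cases hy : y = x
        · subst hy
          fin_cases r <;> simp
        · simp [hu, hy]
      have e2 : Function.update (Function.update u (x, 0) (v (x, 0))) (x, 1) (v (x, 1)) = u := by
        funext ⟨y, r⟩
        by_cases hy : y = x
        · subst hy
          fin_cases r <;> simp [hu, hx]
        · simp [hy]
      rw [e1, h, e2, ih]
      have : c x * c x - s x * -s x = 1 := by rw [← hcs x]; ring
      rw [this, one_smul]
  simpa using key Finset.univ

end Pairs

/-! ### Quaternionic Hermitian vector spaces -/

section Quaternionic

variable {W : Type*} [NormedAddCommGroup W] [NormedSpace ℝ W]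

/-- A quaternionic Hermitian structure on a real vector space. -/
structure QHerm (I J K : W →L[ℝ] W) (g : W →L[ℝ] W →L[ℝ] ℝ) : Prop where
  I_sq : ∀ v, I (I v) = -v
  J_sq : ∀ v, J (J v) = -v
  K_sq : ∀ v, K (K v) = -v
  I_J : ∀ v, I (J v) = K v
  J_I : ∀ v, J (I v) = -K v
  symm : ∀ v w, g v w = g w v
  inv_I : ∀ v w, g (I v) (I w) = g v w
  inv_J : ∀ v w, g (J v) (J w) = g v w
  inv_K : ∀ v w, g (K v) (K w) = g v w
  pos : ∀ v, v ≠ 0 → 0 < g v v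

namespace QHerm

variable {I J K : W →L[ℝ] W} {g : W →L[ℝ] W →L[ℝ] ℝ} (h : QHerm I J K g)
include h

theorem I_K (v : W) : I (K v) = -J v := by rw [← h.I_J, h.I_sq]
theorem K_J (v : W) : K (J v) = -I v := by rw [← h.I_J, h.J_sq, map_neg]
theorem K_I (v : W) : K (I v) = J v := by rw [← h.I_J, h.J_I, map_neg, h.I_K, neg_neg]
theorem J_K (v : W) : J (K v) = I v := by rw [← h.I_J, h.J_I, h.K_J, neg_neg]

theorem g_I (v w : W) : g (I v) w = -g v (I w) := by rw [← h.inv_I v, h.I_sq]; simp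
theorem g_J (v w : W) : g (J v) w = -g v (J w) := by rw [← h.inv_J v, h.J_sq]; simp
theorem g_K (v w : W) : g (K v) w = -g v (K w) := by rw [← h.inv_K v, h.K_sq]; simp

theorem g_self_I (v : W) : g v (I v) = 0 := by
  have := h.g_I v v; rw [h.symm] at this; linarith
theorem g_self_J (v : W) : g v (J v) = 0 := by
  have := h.g_J v v; rw [h.symm] at this; linarith
theorem g_self_K (v : W) : g v (K v) = 0 := by
  have := h.g_K v v; rw [h.symm] at this; linarith

end QHerm

/-- The vectors `e_a`, `I e_a`, `J e_a`, `J I e_a`: the index `(a, t, r)` stands for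
`J ^ r (I ^ t e_a)`. -/
def hbasis (I J : W →L[ℝ] W) {n : ℕ} (e : Fin n → W) (α : Fin n × Fin 2 × Fin 2) : W :=
  if α.2.2 = 0 then (if α.2.1 = 0 then e α.1 else I (e α.1))
  else J (if α.2.1 = 0 then e α.1 else I (e α.1))

section hbasis
variable (I J : W →L[ℝ] W) {n : ℕ} (e : Fin n → W) (a : Fin n)
@[simp] theorem hbasis_00 : hbasis I J e (a, 0, 0) = e a := by simp [hbasis]
@[simp] theorem hbasis_01 : hbasis I J e (a, 0, 1) = J (e a) := by simp [hbasis]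
@[simp] theorem hbasis_10 : hbasis I J e (a, 1, 0) = I (e a) := by simp [hbasis]
@[simp] theorem hbasis_11 : hbasis I J e (a, 1, 1) = J (I (e a)) := by simp [hbasis]
end hbasis

/-- `e` is orthonormal together with its images under `I`, `J`, `K`. -/
structure IsHFrame (I J K : W →L[ℝ] W) (g : W →L[ℝ] W →L[ℝ] ℝ) {n : ℕ} (e : Fin n → W) :
    Prop where
  one : ∀ a b, g (e a) (e b) = if a = b then 1 else 0
  I : ∀ a b, g (e a) (I (e b)) = 0
  J : ∀ a b, g (e a) (J (e b)) = 0
  K : ∀ a b, g (e a) (K (e b)) = 0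

section Frame

variable {I J K : W →L[ℝ] W} {g : W →L[ℝ] W →L[ℝ] ℝ} {n : ℕ} {e : Fin n → W}

theorem IsHFrame.orthonormal (he : IsHFrame I J K g e) (h : QHerm I J K g)
    (α β : Fin n × Fin 2 × Fin 2) :
    g (hbasis I J e α) (hbasis I J e β) = if α = β then 1 else 0 := by
  obtain ⟨a, t, r⟩ := α
  obtain ⟨b, t', r'⟩ := β
  fin_cases t <;> fin_cases r <;> fin_cases t' <;> fin_cases r' <;>
    simp [h.g_I, h.g_J, h.g_K, h.I_sq, h.J_sq, h.K_sq, h.I_J, h.J_I, h.I_K, h.J_K, h.K_I, h.K_J,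
        he.one, he.I, he.J, he.K]

theorem hbasis_J (a : Fin n) (t : Fin 2) :
    J (hbasis I J e (a, t, 0)) = hbasis I J e (a, t, 1) := by
  fin_cases t <;> simp

theorem IsHFrame.comp_injective (he : IsHFrame I J K g e) {m : ℕ} {s : Fin m → Fin n}
    (hs : Function.Injective s) : IsHFrame I J K g (e ∘ s) where
  one a b := by simp [he.one, hs.eq_iff]
  I a b := he.I _ _
  J a b := he.J _ _
  K a b := he.K _ _

theorem IsHFrame.linearIndependent (he : IsHFrame I J K g e) (h : QHerm I J K g) :
    LinearIndependent ℝ (hbasis I J e) := by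
  rw [Fintype.linearIndependent_iff]
  intro c hc α
  have := congrArg (fun v => g v (hbasis I J e α)) hc
  simpa [he.orthonormal h] using this

variable [FiniteDimensional ℝ W]

/-- The real basis attached to a quaternionic orthonormal frame. -/
def IsHFrame.basis (he : IsHFrame I J K g e) (h : QHerm I J K g)
    (hn : Module.finrank ℝ W = 4 * n) : Module.Basis (Fin n × Fin 2 × Fin 2) ℝ W :=
  Module.Basis.mk (he.linearIndependent h) (by
    rw [(he.linearIndependent h).span_eq_top_of_card_eq_finrank' (by
      simp [hn]; ring)])

variable (he : IsHFrame I J K g e) (h : QHerm I J K g) (hn : Module.finrank ℝ W = 4 * n)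
include he h hn

@[simp] theorem IsHFrame.basis_apply (α : Fin n × Fin 2 × Fin 2) :
    he.basis h hn α = hbasis I J e α := by
  simp [IsHFrame.basis]

theorem IsHFrame.sum_repr (v : W) : ∑ α, g v (hbasis I J e α) • hbasis I J e α = v := by
  have key : ∀ α, g v (hbasis I J e α) = (he.basis h hn).repr v α := by
    intro α
    conv_lhs => rw [← (he.basis h hn).sum_repr v]
    simp [he.orthonormal h]
  conv_rhs => rw [← (he.basis h hn).sum_repr v]
  simp [key]

theorem IsHFrame.ext_linear {V : Type*} [AddCommGroup V] [Module ℝ V] {P Q : W →ₗ[ℝ] V}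
    (hPQ : ∀ α, P (hbasis I J e α) = Q (hbasis I J e α)) (v : W) : P v = Q v := by
  have : P = Q := (he.basis h hn).ext fun α => by simpa using hPQ α
  rw [this]

/-- The quaternion-linear map with prescribed values on a quaternionic frame. -/
def IsHFrame.lift (u : Fin n → W) : W →ₗ[ℝ] W := (he.basis h hn).constr ℝ (hbasis I J u)

@[simp] theorem IsHFrame.lift_hbasis (u : Fin n → W) (α : Fin n × Fin 2 × Fin 2) :
    he.lift h hn u (hbasis I J e α) = hbasis I J u α := by
  have := (he.basis h hn).constr_basis ℝ (hbasis I J u) α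
  rwa [he.basis_apply h hn] at this

theorem IsHFrame.lift_frame (u : Fin n → W) (a : Fin n) : he.lift h hn u (e a) = u a := by
  have := he.lift_hbasis h hn u (a, 0, 0)
  simpa using this

theorem IsHFrame.lift_J (u : Fin n → W) (v : W) :
    he.lift h hn u (J v) = J (he.lift h hn u v) := by
  refine he.ext_linear h hn (P := he.lift h hn u ∘ₗ J.toLinearMap)
    (Q := J.toLinearMap ∘ₗ he.lift h hn u) (fun α => ?_) v
  obtain ⟨a, t, r⟩ := α
  fin_cases r
  · have := he.lift_hbasis h hn u (a, t, 1)
    rw [← hbasis_J, ← hbasis_J] at this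
    simpa using this
  · have h0 := he.lift_hbasis h hn u (a, t, 0)
    have h1 := he.lift_hbasis h hn u (a, t, 1)
    rw [← hbasis_J, ← hbasis_J] at h1
    simp [← hbasis_J, h.J_sq, h0, h1]

theorem IsHFrame.lift_I (u : Fin n → W) (v : W) :
    he.lift h hn u (I v) = I (he.lift h hn u v) := by
  refine he.ext_linear h hn (P := he.lift h hn u ∘ₗ I.toLinearMap)
    (Q := I.toLinearMap ∘ₗ he.lift h hn u) (fun α => ?_) v
  obtain ⟨a, t, r⟩ := α
  have h00 := he.lift_hbasis h hn u (a, 0, 0)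
  have h01 := he.lift_hbasis h hn u (a, 0, 1)
  have h10 := he.lift_hbasis h hn u (a, 1, 0)
  have h11 := he.lift_hbasis h hn u (a, 1, 1)
  fin_cases t <;> fin_cases r <;> simp_all [h.I_sq, h.I_J, h.J_I, h.I_K]

/-- A quaternion-linear map is known from its values on a frame; powers of `lift` are computed this
way. -/
theorem IsHFrame.lift_lift (u : Fin n → W) {w : Fin n → W} (P : W →ₗ[ℝ] W)
    (hI : ∀ v, P (I v) = I (P v)) (hJ : ∀ v, P (J v) = J (P v)) (hP : ∀ a, P (u a) = w a) (v : W) :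
    P (he.lift h hn u v) = he.lift h hn w v := by
  refine he.ext_linear h hn (P := P ∘ₗ he.lift h hn u) (Q := he.lift h hn w) (fun α => ?_) v
  obtain ⟨a, t, r⟩ := α
  rw [LinearMap.comp_apply, he.lift_hbasis, he.lift_hbasis]
  fin_cases t <;> fin_cases r <;> simp [hI, hJ, hP]

theorem IsHFrame.lift_g {u : Fin n → W} (hu : IsHFrame I J K g u) (v w : W) :
    g (he.lift h hn u v) (he.lift h hn u w) = g v w := by
  conv_rhs => rw [← he.sum_repr h hn v, ← he.sum_repr h hn w]
  conv_lhs => rw [← he.sum_repr h hn v, ← he.sum_repr h hn w]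
  simp [hu.orthonormal h, he.orthonormal h]

end Frame

/-! ### Constructing and extending quaternionic frames -/

section Existence

variable {I J K : W →L[ℝ] W} {g : W →L[ℝ] W →L[ℝ] ℝ} {n k : ℕ}

theorem IsHFrame.snoc {e : Fin k → W} (he : IsHFrame I J K g e) (h : QHerm I J K g) {v : W}
    (hv : g v v = 1) (hve : ∀ α, g v (hbasis I J e α) = 0) :
    IsHFrame I J K g (Fin.snoc e v : Fin (k + 1) → W) := by
  have h0 : ∀ a, g v (e a) = 0 := fun a => by simpa using hve (a, 0, 0)
  have h1 : ∀ a, g v (I (e a)) = 0 := fun a => by simpa using hve (a, 1, 0)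
  have h2 : ∀ a, g v (J (e a)) = 0 := fun a => by simpa using hve (a, 0, 1)
  have h3 : ∀ a, g v (K (e a)) = 0 := fun a => by simpa [h.J_I] using hve (a, 1, 1)
  have h0' : ∀ a, g (e a) v = 0 := fun a => by rw [h.symm, h0]
  have h1' : ∀ a, g (e a) (I v) = 0 := fun a => by rw [h.symm, h.g_I, h1, neg_zero]
  have h2' : ∀ a, g (e a) (J v) = 0 := fun a => by rw [h.symm, h.g_J, h2, neg_zero]
  have h3' : ∀ a, g (e a) (K v) = 0 := fun a => by rw [h.symm, h.g_K, h3, neg_zero]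
  have hne : ∀ a : Fin k, ¬ Fin.last k = a.castSucc := fun a => (Fin.castSucc_lt_last a).ne'
  constructor <;> intro a b <;> refine Fin.lastCases ?_ (fun a => ?_) a <;>
    refine Fin.lastCases ?_ (fun b => ?_) b <;>
    simp [*, h.g_self_I, h.g_self_J, h.g_self_K, he.one, he.I, he.J, he.K, Fin.castSucc_ne_last]

theorem QHerm.normalize (h : QHerm I J K g) {v : W} (hv : v ≠ 0) :
    g ((Real.sqrt (g v v))⁻¹ • v) ((Real.sqrt (g v v))⁻¹ • v) = 1 := by
  have := h.pos v hv
  have h2 := Real.mul_self_sqrt this.le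
  have h3 := Real.sqrt_pos.2 this
  simp only [map_smul, smul_apply, smul_eq_mul]
  field_simp
  rw [sq, h2]

variable [FiniteDimensional ℝ W]

/-- The `4 * k` linear conditions cannot cut a space of larger dimension down to zero. -/
theorem IsHFrame.exists_orthogonal (g : W →L[ℝ] W →L[ℝ] ℝ) (e : Fin k → W)
    (hk : 4 * k < Module.finrank ℝ W) : ∃ v ≠ 0, ∀ α, g v (hbasis I J e α) = 0 := by
  let T : W →ₗ[ℝ] (Fin k × Fin 2 × Fin 2 → ℝ) :=
    LinearMap.pi fun α => (g.flip (hbasis I J e α)).toLinearMap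
  have hT : T.ker ≠ ⊥ := LinearMap.ker_ne_bot_of_finrank_lt (by simp; omega)
  obtain ⟨v, hv, hv0⟩ := (Submodule.ne_bot_iff _).1 hT
  exact ⟨v, hv0, fun α => congrFun (LinearMap.mem_ker.1 hv) α⟩

/-- A quaternionic orthonormal system extends to a quaternionic frame. -/
theorem IsHFrame.exists_extend (h : QHerm I J K g) (hn : Module.finrank ℝ W = 4 * n)
    {e : Fin k → W} (he : IsHFrame I J K g e) (hk : k ≤ n) :
    ∃ u : Fin n → W, IsHFrame I J K g u ∧ ∀ a, u (Fin.castLE hk a) = e a := by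
  obtain ⟨m, rfl⟩ := Nat.exists_eq_add_of_le hk
  have aux : ∀ m', m' ≤ m → ∃ u : Fin (k + m') → W, IsHFrame I J K g u ∧
      ∀ a, u (Fin.castAdd m' a) = e a := by
    intro m' hm'
    induction m' with
    | zero => exact ⟨e, he, fun a => rfl⟩
    | succ m' ih' =>
      obtain ⟨u, hu, hue⟩ := ih' (by omega)
      obtain ⟨v, hv0, hv⟩ := IsHFrame.exists_orthogonal (I := I) (J := J) g u (by omega)
      refine ⟨(Fin.snoc u ((Real.sqrt (g v v))⁻¹ • v) : Fin (k + m' + 1) → W),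
        hu.snoc h (h.normalize hv0) (fun α => by simp [hv]), fun a => ?_⟩
      rw [← hue a]
      have := Fin.snoc_castSucc (α := fun _ => W) ((Real.sqrt (g v v))⁻¹ • v) u (Fin.castAdd m' a)
      exact this
  exact aux m le_rfl

/-- The test lists treat indices below `i` and from `i` on differently, so the two vectors must be
placed at prescribed indices. -/
theorem IsHFrame.exists_pair (h : QHerm I J K g) (hn : Module.finrank ℝ W = 4 * n)
    {u w : W} (hu : g u u = 1) (hw : g w w = 1) (h0 : g u w = 0) (h1 : g u (I w) = 0)
    (h2 : g u (J w) = 0) (h3 : g u (K w) = 0) {a b : Fin n} (hab : a ≠ b) :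
    ∃ e : Fin n → W, IsHFrame I J K g e ∧ e a = u ∧ e b = w := by
  have hn2 : 2 ≤ n := by
    have := a.2; have := b.2
    by_contra hlt
    apply hab; ext; omega
  have hw' : IsHFrame I J K g (fun _ : Fin 1 => w) :=
    ⟨fun a b => by simp [hw, Subsingleton.elim a b], fun _ _ => h.g_self_I w,
      fun _ _ => h.g_self_J w, fun _ _ => h.g_self_K w⟩
  have hs := hw'.snoc (v := u) h hu (by
    rintro ⟨_, t, r⟩
    fin_cases t <;> fin_cases r <;> simp [h0, h1, h2, h3, h.J_I])
  obtain ⟨e, he, hee⟩ := hs.exists_extend h hn hn2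
  set p : Fin n := Fin.castLE hn2 1
  set q : Fin n := Fin.castLE hn2 0
  have hpq : p ≠ q := by simp [p, q, Fin.ext_iff]
  have hp : e p = u := (hee 1).trans (Fin.snoc_last (α := fun _ => W) _ _)
  have hq : e q = w := (hee 0).trans (Fin.snoc_castSucc (α := fun _ => W) _ _ 0)
  -- The extension leaves the two vectors at the fixed indices `p` and `q`; a permutation of the
  -- frame moves them to `a` and `b`.
  obtain ⟨σ, h1, h2⟩ : ∃ σ : Equiv.Perm (Fin n), σ a = p ∧ σ b = q := by
    refine ⟨Equiv.swap (Equiv.swap a p b) q * Equiv.swap a p, ?_, ?_⟩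
    · rw [Equiv.Perm.mul_apply, Equiv.swap_apply_left, Equiv.swap_apply_of_ne_of_ne ?_ hpq]
      intro hc
      have : Equiv.swap a p a = Equiv.swap a p b := by rw [Equiv.swap_apply_left]; exact hc
      exact hab ((Equiv.swap a p).injective this)
    · rw [Equiv.Perm.mul_apply, Equiv.swap_apply_left]
  exact ⟨e ∘ σ, he.comp_injective σ.injective, by simp [h1, hp], by simp [h2, hq]⟩

end Existence

end Quaternionic

/-! ### Complex volume forms -/

/-- The pairs `(0, 1), (2, 3), …` in `Fin (2 * n)`. -/
def pairEquiv (n : ℕ) : Fin n × Fin 2 ≃ Fin (2 * n) :=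
  finProdFinEquiv.trans (finCongr (Nat.mul_comm n 2))

theorem pairEquiv_symm_fst {n : ℕ} (j : Fin (2 * n)) :
    (((pairEquiv n).symm j).1 : ℕ) = j.val / 2 := rfl

theorem pairEquiv_symm_snd {n : ℕ} (j : Fin (2 * n)) :
    (((pairEquiv n).symm j).2 : ℕ) = j.val % 2 := rfl

section TopForm

variable {W : Type*} [NormedAddCommGroup W] [NormedSpace ℝ W]

/-- The family `u_a, J u_a`. -/
def pairList (J : W →L[ℝ] W) {X : Type*} (u : X → W) (x : X × Fin 2) : W :=
  if x.2 = 0 then u x.1 else J (u x.1)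

@[simp] theorem pairList_zero (J : W →L[ℝ] W) {X : Type*} (u : X → W) (x : X) :
    pairList J u (x, 0) = u x := rfl

@[simp] theorem pairList_one (J : W →L[ℝ] W) {X : Type*} (u : X → W) (x : X) :
    pairList J u (x, 1) = J (u x) := rfl

/-- Complex multilinearity with respect to `I`. -/
def IsLinearFor (I : W →L[ℝ] W) {ι : Type*} [DecidableEq ι] (f : W [⋀^ι]→ₗ[ℝ] ℂ) : Prop :=
  ∀ (v : ι → W) (j : ι), f (Function.update v j (I (v j))) = Complex.I * f v

/-- The arguments are changed one at a time; each change multiplies the value by the complex number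
$a+\sqrt{-1}\,b$. -/
theorem IsLinearFor.eq_zero {I : W →L[ℝ] W} {ι : Type*} [DecidableEq ι] [Fintype ι]
    {f : W [⋀^ι]→ₗ[ℝ] ℂ} (hf : IsLinearFor I f) {v w : ι → W} (hw : f w = 0)
    (hv : ∀ j, ∃ a b : ℝ, v j = a • w j + b • I (w j)) : f v = 0 := by
  have key : ∀ A : Finset ι, f (fun j => if j ∈ A then v j else w j) = 0 := by
    intro A
    induction A using Finset.induction_on with
    | empty => simpa using hw
    | insert x A hx ih =>
      set u : ι → W := fun j => if j ∈ A then v j else w j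
      obtain ⟨a, b, hab⟩ := hv x
      have e1 : (fun j => if j ∈ insert x A then v j else w j) =
          Function.update u x (a • w x + b • I (w x)) := by
        rw [← hab]
        funext j
        by_cases hj : j = x
        · subst hj; simp
        · simp [u, hj]
      have hux : u x = w x := by simp [u, hx]
      rw [e1, f.map_update_add, f.map_update_smul, f.map_update_smul, ← hux, hf u x,
        Function.update_eq_self, ih]
      simp
  simpa using key Finset.univ

variable {I J K : W →L[ℝ] W} {g : W →L[ℝ] W →L[ℝ] ℝ} {n : ℕ} {e : Fin n → W}

/-- The vectors $e_a,Je_a$ form a complex basis of $(W,I)$, and a complex alternating form of top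
degree is determined by its value on a basis. -/
theorem IsLinearFor.eq_zero_of_frame [FiniteDimensional ℝ W] (h : QHerm I J K g)
    (hn : Module.finrank ℝ W = 4 * n) (he : IsHFrame I J K g e)
    {f : W [⋀^Fin n × Fin 2]→ₗ[ℝ] ℂ} (hf : IsLinearFor I f) (h0 : f (pairList J e) = 0) :
    f = 0 := by
  refine Module.Basis.ext_alternating (he.basis h hn) fun s _ => ?_
  simp only [IsHFrame.basis_apply, AlternatingMap.zero_apply]
  refine hf.eq_zero (w := fun j => pairList J e ((s j).1, (s j).2.2)) ?_ fun j => ?_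
  -- `s'` forgets the power of `I` in each index. If it is injective it permutes the complex basis;
  -- otherwise a basis vector is repeated.
  · set s' : Fin n × Fin 2 → Fin n × Fin 2 := fun j => ((s j).1, (s j).2.2)
    by_cases hs : Function.Injective s'
    · let σ : Equiv.Perm (Fin n × Fin 2) :=
        Equiv.ofBijective s' (Finite.injective_iff_bijective.1 hs)
      have := f.map_perm (pairList J e) σ
      rw [h0, smul_zero] at this
      exact this
    · rw [Function.not_injective_iff] at hs
      obtain ⟨a, b, hab, hne⟩ := hs
      exact f.map_eq_zero_of_eq _ (congrArg (pairList J e) hab) hne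
  · obtain ⟨a, t, r⟩ := s j
    fin_cases t <;> fin_cases r
    · exact ⟨1, 0, by simp⟩
    · exact ⟨1, 0, by simp⟩
    · exact ⟨0, 1, by simp⟩
    · exact ⟨0, -1, by simp [h.I_J, h.J_I]⟩

/-- Holomorphic volume forms at a point that are real and positive in the quaternionic sense. -/
structure IsPosTop (I J : W →L[ℝ] W) {n : ℕ} (Phi : W [⋀^Fin (2 * n)]→L[ℝ] ℂ) : Prop where
  type_top : ∀ (v : Fin (2 * n) → W) (j : Fin (2 * n)),
    Phi (Function.update v j (I (v j))) = Complex.I * Phi v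
  ne_zero : Phi ≠ 0
  real : ∀ v : Fin (2 * n) → W, Phi (fun j => J (v j)) = (starRingEnd ℂ) (Phi v)
  positive : ∀ v : Fin n → W, 0 ≤ (Phi (fun j => pairList J v ((pairEquiv n).symm j))).re

/-- A form of degree `2 n`, with its arguments indexed by pairs. -/
def pairForm {n : ℕ} (Phi : W [⋀^Fin (2 * n)]→L[ℝ] ℂ) : W [⋀^Fin n × Fin 2]→ₗ[ℝ] ℂ :=
  Phi.toAlternatingMap.domDomCongr (pairEquiv n).symm

theorem pairForm_apply {n : ℕ} (Phi : W [⋀^Fin (2 * n)]→L[ℝ] ℂ) (v : Fin n × Fin 2 → W) :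
    pairForm Phi v = Phi fun j => v ((pairEquiv n).symm j) := rfl

theorem apply_eq_pairForm {n : ℕ} (Phi : W [⋀^Fin (2 * n)]→L[ℝ] ℂ) (v : Fin (2 * n) → W) :
    Phi v = pairForm Phi fun j => v (pairEquiv n j) := by
  simp [pairForm_apply]

variable {Phi : W [⋀^Fin (2 * n)]→L[ℝ] ℂ}

theorem IsPosTop.isLinearFor (hP : IsPosTop I J Phi) : IsLinearFor I (pairForm Phi) := by
  intro v j
  rw [pairForm_apply, pairForm_apply, ← hP.type_top _ (pairEquiv n j)]
  congr 1
  funext l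
  by_cases hl : l = pairEquiv n j
  · subst hl; simp
  · have : (pairEquiv n).symm l ≠ j := fun hc => hl (by simp [← hc])
    simp [hl, this]

/-- Applying `J` to all vectors conjugates the value by reality; it also turns every pair by a right
angle, which leaves the value unchanged. -/
theorem IsPosTop.pair_im (hP : IsPosTop I J Phi) (hJ : ∀ v, J (J v) = -v) (u : Fin n → W) :
    (pairForm Phi (pairList J u)).im = 0 := by
  have h1 := hP.real (fun j => pairList J u ((pairEquiv n).symm j))
  have h2 : pairForm Phi (fun j => J (pairList J u j)) = pairForm Phi (pairList J u) :=
    map_rot_pairs (pairForm Phi) (pairList J u) _ (fun _ => 0) (fun _ => 1) (by simp)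
      (by simp) (by simp [hJ])
  have h3 : (starRingEnd ℂ) (pairForm Phi (pairList J u)) = pairForm Phi (pairList J u) :=
    h1.symm.trans h2
  exact Complex.conj_eq_iff_im.1 h3

theorem IsPosTop.pair_eq (hP : IsPosTop I J Phi) (hJ : ∀ v, J (J v) = -v) (u : Fin n → W) :
    pairForm Phi (pairList J u) = ((pairForm Phi (pairList J u)).re : ℂ) :=
  Complex.ext (by simp) (by simp [hP.pair_im hJ])

theorem IsPosTop.pair_nonneg (hP : IsPosTop I J Phi) (u : Fin n → W) :
    0 ≤ (pairForm Phi (pairList J u)).re := hP.positive u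

variable [FiniteDimensional ℝ W]

/-- If the value on this complex basis were zero, the form would vanish identically. -/
theorem IsPosTop.frame_pos (hP : IsPosTop I J Phi) (h : QHerm I J K g)
    (hn : Module.finrank ℝ W = 4 * n) (he : IsHFrame I J K g e) :
    0 < (pairForm Phi (pairList J e)).re := by
  refine lt_of_le_of_ne (hP.pair_nonneg e) fun h0 => hP.ne_zero ?_
  have := hP.isLinearFor.eq_zero_of_frame h hn he (by rw [hP.pair_eq h.J_sq, ← h0]; simp)
  ext v
  rw [apply_eq_pairForm, this]
  simp

/-- A volume form pulls back to a multiple of a volume form under a quaternion-linear map. -/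
theorem IsPosTop.map {I₂ J₂ : W →L[ℝ] W} {Phi₂ : W [⋀^Fin (2 * n)]→L[ℝ] ℂ}
    (hP : IsPosTop I J Phi) (h : QHerm I J K g) (hn : Module.finrank ℝ W = 4 * n)
    (he : IsHFrame I J K g e) (hP₂ : IsPosTop I₂ J₂ Phi₂) (hJ₂ : ∀ v, J₂ (J₂ v) = -v)
    {P : W →ₗ[ℝ] W} (hPI : ∀ v, P (I v) = I₂ (P v)) (hPJ : ∀ v, P (J v) = J₂ (P v))
    (v : Fin (2 * n) → W) :
    Phi₂ (fun j => P (v j)) = (((pairForm Phi₂ (pairList J₂ (P ∘ e))).re /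
      (pairForm Phi (pairList J e)).re : ℝ) : ℂ) * Phi v := by
  set d : ℝ := (pairForm Phi₂ (pairList J₂ (P ∘ e))).re / (pairForm Phi (pairList J e)).re
  -- The difference of the two sides is again complex linear for `I`, so it is enough that it
  -- vanishes on the frame.
  set f : W [⋀^Fin n × Fin 2]→ₗ[ℝ] ℂ := (pairForm Phi₂).compLinearMap P - d • pairForm Phi with hf
  have hf1 : IsLinearFor I f := by
    intro v j
    have e1 : (fun l => P (Function.update v j (I (v j)) l)) =
        Function.update (fun l => P (v l)) j (I₂ (P (v j))) := by
      funext l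
      by_cases hl : l = j
      · subst hl; simp [hPI]
      · simp [hl]
    have e2 := hP₂.isLinearFor (fun l => P (v l)) j
    have e3 := hP.isLinearFor v j
    simp only [hf, AlternatingMap.sub_apply, AlternatingMap.compLinearMap_apply,
      AlternatingMap.smul_apply, e1, e2, e3, Complex.real_smul]
    ring
  have hf2 : f (pairList J e) = 0 := by
    have hne := (hP.frame_pos h hn he).ne'
    have e1 : (fun l => P (pairList J e l)) = pairList J₂ (P ∘ e) := by
      funext ⟨a, r⟩
      fin_cases r <;> simp [hPJ]
    simp only [hf, AlternatingMap.sub_apply, AlternatingMap.compLinearMap_apply,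
      AlternatingMap.smul_apply, e1, Complex.real_smul]
    rw [hP₂.pair_eq hJ₂, hP.pair_eq h.J_sq, ← Complex.ofReal_mul, div_mul_cancel₀ _ hne, sub_self]
  have := hf1.eq_zero_of_frame h hn he hf2
  have h4 := congrArg (fun f => f fun j => v (pairEquiv n j)) this
  simp only [hf, AlternatingMap.sub_apply, AlternatingMap.compLinearMap_apply,
    AlternatingMap.smul_apply, AlternatingMap.zero_apply, Complex.real_smul, sub_eq_zero] at h4
  rw [apply_eq_pairForm, apply_eq_pairForm Phi]
  exact h4

/-- Positivity makes the scaling factor $d$ of `P` nonnegative, so $d^k=1$ forces $d=1$. Symmetries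
of finite order suffice later, and no quaternionic determinant is needed. -/
theorem IsPosTop.map_of_pow_eq_one (hP : IsPosTop I J Phi) (h : QHerm I J K g)
    (hn : Module.finrank ℝ W = 4 * n) (he : IsHFrame I J K g e) {P : W →ₗ[ℝ] W}
    (hPI : ∀ v, P (I v) = I (P v)) (hPJ : ∀ v, P (J v) = J (P v)) {k : ℕ} (hk : k ≠ 0)
    (hPk : P ^ k = 1) (v : Fin (2 * n) → W) : Phi (fun j => P (v j)) = Phi v := by
  have hm := hP.map h hn he hP h.J_sq hPI hPJ
  set d : ℝ := (pairForm Phi (pairList J (P ∘ e))).re / (pairForm Phi (pairList J e)).re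
  have hd : 0 ≤ d := div_nonneg (hP.pair_nonneg _) (hP.pair_nonneg _)
  have hpow : ∀ (m : ℕ) v, Phi (fun j => (P ^ m) (v j)) = ((d ^ m : ℝ) : ℂ) * Phi v := by
    intro m
    induction m with
    | zero => intro v; simp
    | succ m ih =>
      intro v
      have : (fun j => (P ^ (m + 1)) (v j)) = fun j => P ((P ^ m) (v j)) := by
        funext j; rw [pow_succ']; rfl
      rw [this, hm (fun j => (P ^ m) (v j)), ih]
      push_cast; ring
  have h1 := hpow k (fun j => pairList J e ((pairEquiv n).symm j))
  rw [hPk] at h1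
  have hne : pairForm Phi (pairList J e) ≠ 0 := fun hc => by
    have := hP.frame_pos h hn he
    rw [hc] at this; simp at this
  have h2 : ((d ^ k : ℝ) : ℂ) = 1 := by
    apply mul_right_cancel₀ hne
    rw [one_mul]
    exact h1.symm
  have h3 : d ^ k = 1 := by exact_mod_cast h2
  have h4 : d = 1 := (pow_eq_one_iff_of_nonneg hd hk).1 h3
  rw [hm, h4]; simp

end TopForm

/-! ### Positivity of exterior products on lists of pairs -/

/-- The arguments of an exterior product of forms of degrees `2 k` and `2 l`, indexed by pairs. -/
def listEquiv (k l : ℕ) : (Fin k ⊕ Fin l) × Fin 2 ≃ Fin (2 * k + 2 * l) :=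
  (Equiv.sumProdDistrib _ _ _).trans
    (((pairEquiv k).sumCongr (pairEquiv l)).trans finSumFinEquiv)

section Positivity

variable {W : Type*} [NormedAddCommGroup W] [NormedSpace ℝ W]

/-- An exterior product, with its arguments indexed by pairs. -/
def listForm {k l : ℕ} {F : Type*} [NormedAddCommGroup F] [NormedSpace ℝ F]
    (f : W [⋀^Fin (2 * k + 2 * l)]→L[ℝ] F) : W [⋀^(Fin k ⊕ Fin l) × Fin 2]→ₗ[ℝ] F :=
  f.toAlternatingMap.domDomCongr (listEquiv k l).symm

theorem listForm_apply {k l : ℕ} {F : Type*} [NormedAddCommGroup F] [NormedSpace ℝ F]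
    (f : W [⋀^Fin (2 * k + 2 * l)]→L[ℝ] F) (v : (Fin k ⊕ Fin l) × Fin 2 → W) :
    listForm f v = f fun j => v ((listEquiv k l).symm j) := rfl

theorem factorial_mul_listForm_wedge {k l : ℕ} (a : W [⋀^Fin (2 * k)]→L[ℝ] ℂ)
    (b : W [⋀^Fin (2 * l)]→L[ℝ] ℂ) (v : (Fin k ⊕ Fin l) × Fin 2 → W) :
    (((2 * k).factorial * (2 * l).factorial : ℕ) : ℂ) * listForm (wedge a b) v =
      ∑ σ : Equiv.Perm ((Fin k ⊕ Fin l) × Fin 2), ((Equiv.Perm.sign σ : ℤ) : ℂ) *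
        (pairForm a (fun x => v (σ (Sum.inl x.1, x.2))) *
          pairForm b (fun x => v (σ (Sum.inr x.1, x.2)))) := by
  rw [listForm_apply, factorial_mul_wedge]
  let τ : Fin (2 * k) ⊕ Fin (2 * l) ≃ (Fin k ⊕ Fin l) × Fin 2 :=
    ((pairEquiv k).sumCongr (pairEquiv l)).symm.trans (Equiv.sumProdDistrib _ _ _).symm
  have hτ : ∀ x, (listEquiv k l).symm (finSumFinEquiv x) = τ x := by
    intro x
    simp [listEquiv, τ]
  rw [← Equiv.sum_comp (Equiv.permCongr τ)]
  refine Finset.sum_congr rfl fun σ _ => ?_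
  have hl : ∀ j, τ.symm (Sum.inl ((pairEquiv k).symm j).1, ((pairEquiv k).symm j).2) =
      Sum.inl j := fun j => by simp [τ]
  have hr : ∀ j, τ.symm (Sum.inr ((pairEquiv l).symm j).1, ((pairEquiv l).symm j).2) =
      Sum.inr j := fun j => by simp [τ]
  rw [Equiv.Perm.sign_permCongr, pairForm_apply, pairForm_apply]
  simp only [hτ, Equiv.permCongr_apply, hl, hr]

variable {Y : Type*}

/-- A form that vanishes on lists of vectors taken from `w` which are not unions of pairs, and is
positive on lists of pairs. -/
structure PairPos (w : Y × Fin 2 → W) {l : ℕ} (b : W [⋀^Fin l × Fin 2]→ₗ[ℝ] ℂ) : Prop where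
  vanish : ∀ f : Fin l × Fin 2 → Y × Fin 2, Function.Injective f →
    (∃ y r, (y, r) ∈ Set.range f ∧ (y, 1 - r) ∉ Set.range f) → b (w ∘ f) = 0
  pos : ∀ h : Fin l → Y, Function.Injective h →
    ∃ r : ℝ, 0 < r ∧ b (fun x => w (h x.1, x.2)) = r

theorem PairPos.comp {Z : Type*} {w : Y × Fin 2 → W} {l : ℕ} {b : W [⋀^Fin l × Fin 2]→ₗ[ℝ] ℂ}
    (hb : PairPos w b) {h : Z → Y} (hh : Function.Injective h) :
    PairPos (fun z : Z × Fin 2 => w (h z.1, z.2)) b where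
  vanish f hf := by
    rintro ⟨y, r, ⟨x, hx⟩, hy⟩
    have hinj : Function.Injective fun z : Z × Fin 2 => (h z.1, z.2) := by
      rintro ⟨z, s⟩ ⟨z', s'⟩ hz
      simp only [Prod.mk.injEq] at hz
      rw [hh hz.1, hz.2]
    refine hb.vanish (fun x => (h (f x).1, (f x).2)) (fun x x' hx => hf (hinj hx))
      ⟨h y, r, ⟨x, by simp [hx]⟩, ?_⟩
    rintro ⟨x', hx'⟩
    exact hy ⟨x', hinj hx'⟩
  pos h' hh' := hb.pos (h ∘ h') (hh.comp hh')

theorem PairPos.nonneg {w : Y × Fin 2 → W} {l : ℕ} {b : W [⋀^Fin l × Fin 2]→ₗ[ℝ] ℂ}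
    (hb : PairPos w b) (h : Fin l → Y) : ∃ r : ℝ, 0 ≤ r ∧ b (fun x => w (h x.1, x.2)) = r := by
  by_cases hh : Function.Injective h
  · obtain ⟨r, hr, hbr⟩ := hb.pos h hh
    exact ⟨r, hr.le, hbr⟩
  · rw [Function.not_injective_iff] at hh
    obtain ⟨x, y, hxy, hne⟩ := hh
    refine ⟨0, le_rfl, ?_⟩
    rw [b.map_eq_zero_of_eq _ (i := (x, 0)) (j := (y, 0)) (by simp [hxy]) (by simp [hne])]
    simp

/-- A permutation preserving a union of pairs acts, up to permutations of the two blocks, as a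
permutation of pairs. -/
theorem exists_pair_perm {k l : ℕ} (σ : Equiv.Perm ((Fin k ⊕ Fin l) × Fin 2))
    (hσ : ∀ x r, (∃ y : Fin l × Fin 2, σ (Sum.inr y.1, y.2) = (x, r)) →
      ∃ y : Fin l × Fin 2, σ (Sum.inr y.1, y.2) = (x, 1 - r)) :
    ∃ (ρ : Equiv.Perm (Fin k ⊕ Fin l)) (τ₁ : Equiv.Perm (Fin k × Fin 2))
      (τ₂ : Equiv.Perm (Fin l × Fin 2)),
      Equiv.Perm.sign σ = Equiv.Perm.sign τ₁ * Equiv.Perm.sign τ₂ ∧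
      (∀ x : Fin k × Fin 2, σ (Sum.inl x.1, x.2) = (ρ (Sum.inl (τ₁ x).1), (τ₁ x).2)) ∧
      (∀ x : Fin l × Fin 2, σ (Sum.inr x.1, x.2) = (ρ (Sum.inr (τ₂ x).1), (τ₂ x).2)) := by
  classical
  let p : Fin k ⊕ Fin l → Prop := fun x => ∃ b : Fin l, x = Sum.inr b
  let q : Fin k ⊕ Fin l → Prop := fun x => ∃ y : Fin l × Fin 2, σ (Sum.inr y.1, y.2) = (x, 0)
  -- By `hσ` the image of the second block is a union of pairs, so membership may be tested at the
  -- entry `0` of each pair.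
  have hq : ∀ x r, (∃ y : Fin l × Fin 2, σ (Sum.inr y.1, y.2) = (x, r)) ↔ q x := by
    intro x r
    fin_cases r
    · exact Iff.rfl
    · exact ⟨fun hx => hσ x 1 hx, fun hx => hσ x 0 hx⟩
  have e1 : {x // p x} ≃ Fin l :=
    (Equiv.ofBijective (fun b : Fin l => (⟨Sum.inr b, b, rfl⟩ : {x // p x}))
      ⟨fun b b' hb => Sum.inr_injective (congrArg Subtype.val hb),
        fun ⟨x, b, hb⟩ => ⟨b, Subtype.ext hb.symm⟩⟩).symm
  have e2 : Fin l × Fin 2 ≃ {x // q x} × Fin 2 :=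
    Equiv.ofBijective (fun y => (⟨(σ (Sum.inr y.1, y.2)).1,
      (hq _ (σ (Sum.inr y.1, y.2)).2).1 ⟨y, rfl⟩⟩, (σ (Sum.inr y.1, y.2)).2)) (by
      constructor
      · intro y y' hy
        simp only [Prod.mk.injEq, Subtype.mk.injEq] at hy
        have := σ.injective (Prod.ext hy.1 hy.2)
        simp only [Prod.mk.injEq, Sum.inr.injEq] at this
        exact Prod.ext this.1 this.2
      · rintro ⟨⟨x, hx⟩, r⟩
        obtain ⟨y, hy⟩ := (hq x r).2 hx
        exact ⟨y, by simp [hy]⟩)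
  have hcard : Fintype.card {x // p x} = Fintype.card {x // q x} := by
    have h1 := Fintype.card_congr e1
    have h2 := Fintype.card_congr e2
    simp only [Fintype.card_prod, Fintype.card_fin] at h1 h2
    omega
  let E : {x // p x} ≃ {x // q x} := Fintype.equivOfCardEq hcard
  let ρ : Equiv.Perm (Fin k ⊕ Fin l) := E.extendSubtype
  let ρ' : Equiv.Perm ((Fin k ⊕ Fin l) × Fin 2) := ρ.prodCongr (Equiv.refl _)
  let D := Equiv.sumProdDistrib (Fin k) (Fin l) (Fin 2)
  -- Once `ρ` has moved the pairs to the right blocks, `ρ'⁻¹ * σ` preserves both blocks.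
  let τ : Equiv.Perm (Fin k × Fin 2 ⊕ Fin l × Fin 2) := D.permCongr (ρ'⁻¹ * σ)
  have hpq : ∀ x, p x ↔ q (ρ x) := fun x =>
    ⟨fun hx => E.extendSubtype_mem x hx, fun hx => by
      by_contra hc
      exact E.extendSubtype_not_mem x hc hx⟩
  -- `ρ'` acts by `ρ` on both layers, so its sign is a square.
  have hρ : Equiv.Perm.sign ρ' = 1 := by
    have : ρ' = Equiv.prodCongrLeft (fun _ : Fin 2 => ρ) := by ext ⟨x, r⟩ <;> rfl
    rw [this, Equiv.Perm.sign_prodCongrLeft]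
    simp [Int.units_sq]
  have hτr : ∀ y : Fin l × Fin 2, ∃ z, τ (Sum.inr y) = Sum.inr z := by
    intro y
    have h1 : q (σ (Sum.inr y.1, y.2)).1 := (hq _ _).1 ⟨y, rfl⟩
    have h2 : ρ (ρ' ⁻¹ (σ (Sum.inr y.1, y.2))).1 = (σ (Sum.inr y.1, y.2)).1 := by
      exact congrArg Prod.fst (ρ'.apply_symm_apply (σ (Sum.inr y.1, y.2)))
    rw [← h2, ← hpq] at h1
    obtain ⟨b, hb⟩ := h1
    refine ⟨(b, (ρ' ⁻¹ (σ (Sum.inr y.1, y.2))).2), ?_⟩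
    have h3 : ρ' ⁻¹ (σ (Sum.inr y.1, y.2)) = (Sum.inr b, (ρ' ⁻¹ (σ (Sum.inr y.1, y.2))).2) :=
      Prod.ext hb rfl
    change D (ρ'⁻¹ (σ (D.symm (Sum.inr y)))) = _
    have h4 : D.symm (Sum.inr y) = (Sum.inr y.1, y.2) := rfl
    rw [h4, h3]
    rfl
  have hmem : τ ∈ (Equiv.Perm.sumCongrHom (Fin k × Fin 2) (Fin l × Fin 2)).range := by
    apply Equiv.Perm.mem_sumCongrHom_range_of_perm_mapsTo_inl
    rintro _ ⟨x, rfl⟩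
    rcases hx : τ (Sum.inl x) with z | z
    · exact ⟨z, rfl⟩
    · exfalso
      choose F hF using hτr
      have hFinj : Function.Injective F := fun y y' hy =>
        Sum.inr_injective (τ.injective (by rw [hF, hF, hy]))
      obtain ⟨y, hy⟩ := (Finite.injective_iff_surjective.1 hFinj) z
      have := hF y
      rw [hy, ← hx] at this
      exact absurd (τ.injective this) (by simp)
  obtain ⟨⟨τ₁, τ₂⟩, hτ⟩ := hmem
  have hσeq : σ = ρ' * D.symm.permCongr τ := by
    ext1 x
    simp [τ]
  have hval : ∀ x, σ (D.symm x) = ρ' (D.symm (Equiv.Perm.sumCongrHom _ _ (τ₁, τ₂) x)) := by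
    intro x
    rw [hτ]
    simp [τ]
  refine ⟨ρ, τ₁, τ₂, ?_, fun x => hval (Sum.inl x), fun x => hval (Sum.inr x)⟩
  rw [hσeq, map_mul, hρ, Equiv.Perm.sign_permCongr, ← hτ, one_mul]
  simp

/-- If the vectors given to `b` break a pair, `b` vanishes. Otherwise `exists_pair_perm` applies,
and the signs of the permutations inside the two blocks are absorbed by `a` and `b`. -/
theorem wedge_term_nonneg {k l : ℕ} {a : W [⋀^Fin k × Fin 2]→ₗ[ℝ] ℂ}
    {b : W [⋀^Fin l × Fin 2]→ₗ[ℝ] ℂ} {v : (Fin k ⊕ Fin l) × Fin 2 → W}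
    (ha : ∀ h : Fin k → Fin k ⊕ Fin l, ∃ r : ℝ, 0 ≤ r ∧ a (fun x => v (h x.1, x.2)) = r)
    (hb : PairPos v b) (σ : Equiv.Perm ((Fin k ⊕ Fin l) × Fin 2)) :
    ∃ r : ℝ, 0 ≤ r ∧ ((Equiv.Perm.sign σ : ℤ) : ℂ) *
        (a (fun x => v (σ (Sum.inl x.1, x.2))) * b (fun x => v (σ (Sum.inr x.1, x.2)))) = r := by
  have hinj : Function.Injective fun x : Fin l × Fin 2 => σ (Sum.inr x.1, x.2) := by
    intro x x' hx
    have := σ.injective hx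
    simp only [Prod.mk.injEq, Sum.inr.injEq] at this
    exact Prod.ext this.1 this.2
  by_cases hσ : ∀ x r, (∃ y : Fin l × Fin 2, σ (Sum.inr y.1, y.2) = (x, r)) →
      ∃ y : Fin l × Fin 2, σ (Sum.inr y.1, y.2) = (x, 1 - r)
  · obtain ⟨ρ, τ₁, τ₂, hs, h1, h2⟩ := exists_pair_perm σ hσ
    obtain ⟨r, hr, har⟩ := ha (fun x => ρ (Sum.inl x))
    obtain ⟨s, hs', hbs⟩ := hb.pos (fun x => ρ (Sum.inr x))
      (ρ.injective.comp Sum.inr_injective)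
    refine ⟨r * s, mul_nonneg hr hs'.le, ?_⟩
    simp only [h1, h2]
    have e1 := a.map_perm (fun x : Fin k × Fin 2 => v (ρ (Sum.inl x.1), x.2)) τ₁
    have e2 := b.map_perm (fun x : Fin l × Fin 2 => v (ρ (Sum.inr x.1), x.2)) τ₂
    simp only [Function.comp_def] at e1 e2
    rw [e1, e2, hs, har, hbs]
    rcases Int.units_eq_one_or (Equiv.Perm.sign τ₁) with h | h <;>
      rcases Int.units_eq_one_or (Equiv.Perm.sign τ₂) with h' | h' <;> simp [h, h']
  · push Not at hσ
    obtain ⟨x, r, hx, hx'⟩ := hσ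
    refine ⟨0, le_rfl, ?_⟩
    have := hb.vanish _ hinj ⟨x, r, hx, fun ⟨y, hy⟩ => hx' y hy⟩
    simp only [Function.comp_def] at this
    rw [this]; simp

/-- All terms of the permutation sum are nonnegative, and the identity permutation contributes a
positive one. -/
theorem listForm_wedge_pos {k l : ℕ} {a : W [⋀^Fin (2 * k)]→L[ℝ] ℂ}
    {b : W [⋀^Fin (2 * l)]→L[ℝ] ℂ} {v : (Fin k ⊕ Fin l) × Fin 2 → W}
    (ha : ∀ h : Fin k → Fin k ⊕ Fin l,
      ∃ r : ℝ, 0 ≤ r ∧ pairForm a (fun x => v (h x.1, x.2)) = r)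
    (hb : PairPos v (pairForm b))
    (ha' : ∃ r : ℝ, 0 < r ∧ pairForm a (fun x => v (Sum.inl x.1, x.2)) = r) :
    ∃ r : ℝ, 0 < r ∧ listForm (wedge a b) v = r := by
  have hsum := factorial_mul_listForm_wedge a b v
  choose R hR hRe using wedge_term_nonneg ha hb
  rw [Finset.sum_congr rfl fun σ _ => hRe σ, ← Complex.ofReal_sum] at hsum
  have hpos : 0 < ∑ σ, R σ := by
    refine Finset.sum_pos' (fun σ _ => hR σ) ⟨1, Finset.mem_univ _, ?_⟩
    obtain ⟨r, hr, h1⟩ := ha'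
    obtain ⟨s, hs, h2⟩ := hb.pos Sum.inr Sum.inr_injective
    have := hRe 1
    simp only [Equiv.Perm.coe_one, id, map_one, Units.val_one, Int.cast_one, one_mul, h1, h2,
      ← Complex.ofReal_mul] at this
    rw [← Complex.ofReal_injective this]
    positivity
  have hf : 0 < (((2 * k).factorial * (2 * l).factorial : ℕ) : ℝ) := by positivity
  refine ⟨(∑ σ, R σ) / (((2 * k).factorial * (2 * l).factorial : ℕ) : ℝ), by positivity, ?_⟩
  rw [Complex.ofReal_div, ← hsum, Complex.ofReal_natCast, mul_div_cancel_left₀]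
  exact_mod_cast hf.ne'

/-- The last pair split off. -/
theorem pairEquiv_succ_eq {l : ℕ} (x : Fin (l + 1) × Fin 2) :
    (pairEquiv (l + 1) x : Fin (2 * l + 2 * 1)) =
      listEquiv l 1 (finSumFinEquiv.symm x.1, x.2) := by
  obtain ⟨x, r⟩ := x
  obtain ⟨y, rfl⟩ := finSumFinEquiv.surjective x
  ext
  rcases y with y | y
  · simp [listEquiv, pairEquiv]
  · obtain rfl : y = 0 := Subsingleton.elim _ _
    simp [listEquiv, pairEquiv, finProdFinEquiv]
    omega

theorem pairForm_eq_listForm {l : ℕ} (f : W [⋀^Fin (2 * l + 2 * 1)]→L[ℝ] ℂ)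
    (v : Fin (l + 1) × Fin 2 → W) :
    pairForm (n := l + 1) f v = listForm f (fun x => v (finSumFinEquiv x.1, x.2)) := by
  rw [pairForm_apply, listForm_apply]
  congr 1
  funext j
  obtain ⟨x, rfl⟩ := (pairEquiv (l + 1)).surjective j
  have := pairEquiv_succ_eq x
  rw [Equiv.symm_apply_apply]
  change _ = v (finSumFinEquiv ((listEquiv l 1).symm (pairEquiv (l + 1) x)).1, _)
  rw [this, Equiv.symm_apply_apply]
  simp

/-- Induction on the number of factors: a vector unmatched in the whole list is unmatched in the
block that receives it, so one factor vanishes; positivity passes through `listForm_wedge_pos`. -/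
theorem PairPos.wedgePow {w : W [⋀^Fin 2]→L[ℝ] ℂ} {v : Y × Fin 2 → W}
    (hw : PairPos v (pairForm (n := 1) w)) : ∀ l, PairPos v (pairForm (wedgePow w l))
  | 0 => by
    constructor
    · rintro f - ⟨y, r, ⟨x, hx⟩, -⟩
      exact x.1.elim0
    · exact fun h _ => ⟨1, one_pos, by simp [pairForm_apply, HKT.wedgePow]⟩
  | l + 1 => by
    have ih := PairPos.wedgePow hw l
    constructor
    · rintro f hf ⟨y, r, hy, hy'⟩
      have hpq : (((2 * l).factorial * (2 * 1).factorial : ℕ) : ℂ) ≠ 0 := by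
        exact_mod_cast Nat.mul_ne_zero (2 * l).factorial_ne_zero (2 * 1).factorial_ne_zero
      change pairForm (n := l + 1) (wedge (HKT.wedgePow w l) w) _ = 0
      rw [pairForm_eq_listForm]
      apply mul_left_cancel₀ hpq
      rw [factorial_mul_listForm_wedge, mul_zero]
      refine Finset.sum_eq_zero fun σ _ => ?_
      obtain ⟨x, hx⟩ := hy
      have hinj : Function.Injective
          fun z : (Fin l ⊕ Fin 1) × Fin 2 => f (finSumFinEquiv (σ z).1, (σ z).2) := by
        intro z z' hz
        have := hf hz
        simp only [Prod.mk.injEq, EmbeddingLike.apply_eq_iff_eq] at this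
        exact σ.injective (Prod.ext this.1 this.2)
      obtain ⟨⟨z, s⟩, hz⟩ := σ.surjective (finSumFinEquiv.symm x.1, x.2)
      have hx' : f (finSumFinEquiv (σ (z, s)).1, (σ (z, s)).2) = (y, r) := by
        rw [hz]; simpa using hx
      rcases z with z | z
      · have := ih.vanish
          (fun x => f (finSumFinEquiv (σ (Sum.inl x.1, x.2)).1, (σ (Sum.inl x.1, x.2)).2))
          (fun z z' hzz => by
            have := hinj hzz
            simp only [Prod.mk.injEq, Sum.inl.injEq] at this
            exact Prod.ext this.1 this.2)
          ⟨y, r, ⟨(z, s), hx'⟩, fun ⟨t, ht⟩ => hy' ⟨_, ht⟩⟩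
        simp only [Function.comp_def] at this ⊢
        rw [this]; simp
      · have := hw.vanish
          (fun x => f (finSumFinEquiv (σ (Sum.inr x.1, x.2)).1, (σ (Sum.inr x.1, x.2)).2))
          (fun z z' hzz => by
            have := hinj hzz
            simp only [Prod.mk.injEq, Sum.inr.injEq] at this
            exact Prod.ext this.1 this.2)
          ⟨y, r, ⟨(z, s), hx'⟩, fun ⟨t, ht⟩ => hy' ⟨_, ht⟩⟩
        simp only [Function.comp_def] at this ⊢
        rw [this]; simp
    · intro h hh
      change ∃ r : ℝ, 0 < r ∧ pairForm (n := l + 1) (wedge (HKT.wedgePow w l) w) _ = r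
      rw [pairForm_eq_listForm]
      have hcomp := hh.comp (finSumFinEquiv (m := l) (n := 1)).injective
      have hw' := hw.comp hcomp
      have ih' := ih.comp hcomp
      exact listForm_wedge_pos ih'.nonneg hw' (ih'.pos Sum.inl Sum.inl_injective)

/-! ### Positivity of the calibration form -/

section Calibration

variable {I J K : W →L[ℝ] W} {g : W →L[ℝ] W →L[ℝ] ℝ} {n i : ℕ}
  {Phi : W [⋀^Fin (2 * n)]→L[ℝ] ℂ}

/-- On orthonormal pairs the form pairs `u y` only with `J (u y)`, where its value is `1`. -/
theorem pairPos_fundamentalForm [DecidableEq Y] (h : QHerm I J K g) {u : Y → W}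
    (hu : ∀ p q, g (pairList J u p) (pairList J u q) = if p = q then 1 else 0) :
    PairPos (pairList J u) (pairForm (n := 1) (toComplex (fundamentalForm g J))) := by
  have hf : ∀ v : Fin 1 × Fin 2 → W,
      pairForm (n := 1) (toComplex (fundamentalForm g J)) v = (g (J (v (0, 0))) (v (0, 1)) : ℝ) := by
    intro v
    have e := fundamentalForm_apply g J h.symm h.J_sq h.inv_J
      (fun j => v ((pairEquiv 1).symm j))
    exact congrArg Complex.ofReal e
  constructor
  · rintro f hinj ⟨y, r, ⟨⟨a, s⟩, hx⟩, hy⟩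
    obtain rfl : a = 0 := Subsingleton.elim _ _
    have hne : (f (0, 0)).1 ≠ (f (0, 1)).1 := by
      intro hc
      have h2 : (f (0, 0)).2 ≠ (f (0, 1)).2 := fun h2 => by
        have := hinj (Prod.ext hc h2); simp at this
      apply hy
      refine ⟨(0, 1 - s), ?_⟩
      have h3 : (f (0, s)).1 = y ∧ (f (0, s)).2 = r := by rw [hx]; simp
      refine Prod.ext ?_ ?_
      · rw [← h3.1]; fin_cases s <;> simp [hc]
      · rw [← h3.2]
        revert h2
        generalize hp : (f (0, 0)).2 = p
        generalize hq : (f (0, 1)).2 = q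
        fin_cases s <;> simp [hp, hq] <;> omega
    rw [hf]
    have hJ : g (J ((pairList J u ∘ f) (0, 0))) ((pairList J u ∘ f) (0, 1)) = 0 := by
      simp only [Function.comp_apply]
      generalize f (0, 0) = p at *
      generalize f (0, 1) = q at *
      obtain ⟨p, r⟩ := p
      fin_cases r
      · have := hu (p, 1) q
        rw [if_neg (fun hc' => hne (by rw [← hc']))] at this
        simpa using this
      · have := hu (p, 0) q
        rw [if_neg (fun hc' => hne (by rw [← hc']))] at this
        simpa [h.J_sq] using this
    rw [hJ]; simp
  · intro f _
    refine ⟨1, one_pos, ?_⟩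
    rw [hf]
    have := hu (f 0, 1) (f 0, 1)
    simpa using this

/-- The rotations act on each plane spanned by $u_a,Ju_a$ with determinant one, so `Phi` is constant
along the orbit and equals its mean, the $(n,n)$-part. -/
theorem IsPosTop.typePart_pair (hP : IsPosTop I J Phi) (hJ : ∀ v, J (J v) = -v) (u : Fin n → W) :
    pairForm (typePart J n n Phi) (pairList J u) = (pairForm Phi (pairList J u)).re := by
  rw [← hP.pair_eq hJ, pairForm_apply, pairForm_apply]
  refine typePart_eq_of_rot n fun t => ?_
  exact map_rot_pairs (pairForm Phi) (pairList J u) (fun x => rot J t (pairList J u x))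
    (fun _ => Real.cos t) (fun _ => Real.sin t) (fun _ => by simp)
    (fun x => by simp [rot_apply]) (fun x => by simp [rot_apply, hJ]; abel)

/-- The form `V_{n+i,n+i}` does not vanish on the lists of pairs spanning complex coisotropic
subspaces. -/
theorem calib_pair_ne_zero [FiniteDimensional ℝ W] (hP : IsPosTop I J Phi) (h : QHerm I J K g)
    (hn : Module.finrank ℝ W = 4 * n) {e : Fin n → W} (he : IsHFrame I J K g e)
    {c : ℝ} (hc : c ≠ 0) {u : Fin n ⊕ Fin i → W} (hue : ∀ a, u (Sum.inl a) = e a)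
    (hu : ∀ p q, g (pairList J u p) (pairList J u q) = if p = q then 1 else 0) :
    listForm (calib J g Phi i c) (pairList J u) ≠ 0 := by
  have hpair : ∀ h : Fin n → Fin n ⊕ Fin i,
      (fun x : Fin n × Fin 2 => pairList J u (h x.1, x.2)) = pairList J (u ∘ h) := fun h => rfl
  obtain ⟨r, hr, hre⟩ := listForm_wedge_pos (a := typePart J n n Phi)
    (b := wedgePow (toComplex (fundamentalForm g J)) i) (v := pairList J u)
    (fun f => ⟨_, hP.pair_nonneg (u ∘ f), by rw [hpair, hP.typePart_pair h.J_sq]⟩)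
    ((pairPos_fundamentalForm h hu).wedgePow i)
    ⟨_, hP.frame_pos h hn he, by
      rw [hpair, show u ∘ Sum.inl = e from funext hue, hP.typePart_pair h.J_sq]⟩
  have : listForm (calib J g Phi i c) (pairList J u) = c * r := by
    rw [listForm_apply, calib_apply]
    rw [listForm_apply] at hre
    rw [hre, Complex.ofReal_re]
  rw [this]
  exact mul_ne_zero hc hr.ne'

end Calibration

end Positivity

/-! ### The infinitesimal stabilizer of the form `V_{n+i,n+i}` -/

/-- The effect of one replacement on a product of signs, stated without division. -/
theorem prod_update_mul {ι B : Type*} [Fintype ι] [DecidableEq ι] (χ : B → ℝ) (f : ι → B) (j : ι)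
    (β : B) : (∏ l, χ (Function.update f j β l)) * χ (f j) = (∏ l, χ (f l)) * χ β := by
  rw [← Finset.mul_prod_erase Finset.univ (fun l => χ (f l)) (Finset.mem_univ j),
    ← Finset.mul_prod_erase Finset.univ (fun l => χ (Function.update f j β l)) (Finset.mem_univ j),
    Function.update_self, Finset.prod_congr rfl fun l hl => by
      rw [Function.update_of_ne (Finset.ne_of_mem_erase hl)]]
  ring

section Stabilizer

variable {W : Type*} [NormedAddCommGroup W] [NormedSpace ℝ W]

/-- An alternating map does not change under a permutation of pairs of arguments. -/
theorem map_perm_pairs {F : Type*} [AddCommGroup F] [Module ℝ F] {X : Type*} [Fintype X]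
    [DecidableEq X] (f : W [⋀^X × Fin 2]→ₗ[ℝ] F) (v : X × Fin 2 → W) (ρ : Equiv.Perm X) :
    f (fun x => v (ρ x.1, x.2)) = f v := by
  have h := f.map_perm v (Equiv.prodCongrLeft fun _ : Fin 2 => ρ)
  rw [Equiv.Perm.sign_prodCongrLeft] at h
  simpa [Int.units_sq, Function.comp_def, Equiv.prodCongrLeft] using h

/-- The indices in a quaternionic frame of a list of pairs spanning a coisotropic subspace. -/
def baseList {n i : ℕ} (hi : i ≤ n) : (Fin n ⊕ Fin i) × Fin 2 → Fin n × Fin 2 × Fin 2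
  | (Sum.inl a, r) => (a, 0, r)
  | (Sum.inr d, r) => (Fin.castLE hi d, 1, r)

@[simp] theorem baseList_inl {n i : ℕ} (hi : i ≤ n) (a : Fin n) (r : Fin 2) :
    baseList hi (Sum.inl a, r) = (a, 0, r) := rfl

@[simp] theorem baseList_inr {n i : ℕ} (hi : i ≤ n) (d : Fin i) (r : Fin 2) :
    baseList hi (Sum.inr d, r) = (Fin.castLE hi d, 1, r) := rfl

theorem baseList_pair {n i : ℕ} (hi : i ≤ n) (x : Fin n ⊕ Fin i) (r s : Fin 2) :
    (baseList hi (x, s)) = ((baseList hi (x, r)).1, (baseList hi (x, r)).2.1, s) := by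
  rcases x with x | x <;> rfl

/-- The properties of `V_{n+i,n+i}` which determine its infinitesimal stabilizer. -/
structure CalibLike (I J K : W →L[ℝ] W) (g : W →L[ℝ] W →L[ℝ] ℝ) {n i : ℕ} (hi : i ≤ n)
    (V : W [⋀^(Fin n ⊕ Fin i) × Fin 2]→ₗ[ℝ] ℝ) : Prop where
  ne_zero : ∀ e : Fin n → W, IsHFrame I J K g e → V (hbasis I J e ∘ baseList hi) ≠ 0
  inv : ∀ P : W →ₗ[ℝ] W, (∀ v, P (I v) = I (P v)) → (∀ v, P (J v) = J (P v)) →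
    (∀ v w, g (P v) (P w) = g v w) → P ^ 8 = 1 → ∀ v, V (fun j => P (v j)) = V v
  rotate : ∀ s v, V (fun j => rot J s (v j)) = V v
  line : ∀ e : Fin n → W, IsHFrame I J K g e → ∀ b v,
    (∀ j t r, g (v j) (hbasis I J e (b, t, r)) = 0) → V v = 0

/-- Nonvanishing is the positivity of exterior products on pairs; invariance combines naturality
with the absence of scaling for maps of finite order; rotation invariance is the type $(n+i,n+i)$;
and a form of degree $2n$ and type $(2n,0)$ vanishes on a space of quaternionic dimension $n-1$. -/
theorem calibLike_calib [FiniteDimensional ℝ W] {I J K : W →L[ℝ] W} {g : W →L[ℝ] W →L[ℝ] ℝ}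
    {n i : ℕ} (hi : i ≤ n) {Phi : W [⋀^Fin (2 * n)]→L[ℝ] ℂ} (hP : IsPosTop I J Phi)
    (h : QHerm I J K g) (hn : Module.finrank ℝ W = 4 * n) {c : ℝ} (hc : c ≠ 0)
    {e₀ : Fin n → W} (he₀ : IsHFrame I J K g e₀) :
    CalibLike I J K g hi (listForm (calib J g Phi i c)) where
  ne_zero e he := by
    have : hbasis I J e ∘ baseList hi =
        pairList J (Sum.elim e (fun d => I (e (Fin.castLE hi d)))) := by
      funext ⟨x, r⟩
      rcases x with x | x <;> fin_cases r <;> simp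
    rw [this]
    refine calib_pair_ne_zero hP h hn he hc (fun _ => rfl) ?_
    rw [← this]
    intro p q
    rw [Function.comp_apply, Function.comp_apply, he.orthonormal h]
    congr 1
    have hinj : Function.Injective (baseList hi) := by
      rintro ⟨x, r⟩ ⟨y, s⟩ hxy
      rcases x with x | x <;> rcases y with y | y <;> simp_all
    rw [hinj.eq_iff]
  inv P hI hJ hg hP8 v := by
    have := calib_map (L := J) (L' := J) (b := g) (b' := g) (Phi := Phi) (Phi' := Phi) i c (P := P)
      (d := 1) (fun v => (hJ v).symm) hg
      (fun v => by rw [hP.map_of_pow_eq_one h hn he₀ hI hJ (k := 8) (by norm_num) hP8]; simp)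
      (fun j => v ((listEquiv n i).symm j))
    rwa [one_mul] at this
  rotate s v := calib_rot h.J_sq h.inv_J Phi i c s (fun j => v ((listEquiv n i).symm j))
  line e he b v hv := by
    let U : Submodule ℝ W := ⨅ t : Fin 2 × Fin 2, (g.flip (hbasis I J e (b, t))).ker
    have hU : ∀ v, v ∈ U ↔ ∀ t r, g v (hbasis I J e (b, t, r)) = 0 := by
      intro v
      simp [U, Submodule.mem_iInf]
    refine calib_eq_zero g i c (U := U) (fun v hv => ?_) (fun w hw => ?_)
      (fun j => (hU _).2 (hv ((listEquiv n i).symm j)))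
    · rw [hU] at hv ⊢
      intro t r
      rw [h.g_J, neg_eq_zero]
      have h0 := hv t 0
      have h1 := hv t 1
      fin_cases r
      · change g v (J (hbasis I J e (b, t, 0))) = 0
        rwa [hbasis_J]
      · change g v (J (hbasis I J e (b, t, 1))) = 0
        rw [← hbasis_J, h.J_sq, map_neg, h0, neg_zero]
    · -- the projection that kills a quaternionic line
      let u : Fin n → W := fun a => if a = b then 0 else e a
      have hPw : ∀ v ∈ U, he.lift h hn u v = v := by
        intro v hv
        rw [hU] at hv
        conv_rhs => rw [← he.sum_repr h hn v]
        conv_lhs => rw [← he.sum_repr h hn v]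
        rw [map_sum]
        refine Finset.sum_congr rfl fun α _ => ?_
        rw [map_smul, he.lift_hbasis]
        obtain ⟨a, t, r⟩ := α
        by_cases hab : a = b
        · subst hab; simp [hv]
        · fin_cases t <;> fin_cases r <;> simp [u, hab]
      have hm := hP.map h hn he hP h.J_sq (he.lift_I h hn u) (he.lift_J h hn u) w
      -- The projected frame contains the zero vector, so the factor by which the projection scales
      -- `Phi` is zero.
      have hz : pairForm Phi (pairList J (he.lift h hn u ∘ e)) = 0 := by
        refine (pairForm Phi).map_coord_zero (b, 0) ?_
        simp [he.lift_frame, u]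
      rw [hz] at hm
      simpa [hPw _ (hw _)] using hm

variable {I J K : W →L[ℝ] W} {g : W →L[ℝ] W →L[ℝ] ℝ} {n i : ℕ} {hi : i ≤ n}
  {V : W [⋀^(Fin n ⊕ Fin i) × Fin 2]→ₗ[ℝ] ℝ} {e : Fin n → W} [FiniteDimensional ℝ W]

theorem IsHFrame.lift_self (he : IsHFrame I J K g e) (h : QHerm I J K g)
    (hn : Module.finrank ℝ W = 4 * n) (v : W) : he.lift h hn e v = v :=
  he.ext_linear h hn (P := he.lift h hn e) (Q := LinearMap.id) (fun α => by simp) v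

/-- Invariance under the change to a frame `u` related to `e` by a map of order dividing `8`. -/
theorem CalibLike.inv_lift (hV : CalibLike I J K g hi V) (h : QHerm I J K g)
    (hn : Module.finrank ℝ W = 4 * n) (he : IsHFrame I J K g e) {u : Fin n → W}
    (hu : IsHFrame I J K g u) (w x : Fin n → W) (h1 : ∀ a, he.lift h hn u (u a) = w a)
    (h2 : ∀ a, he.lift h hn w (w a) = x a) (h3 : ∀ a, he.lift h hn x (x a) = e a)
    (v : (Fin n ⊕ Fin i) × Fin 2 → W) : V (fun j => he.lift h hn u (v j)) = V v := by
  refine hV.inv _ (he.lift_I h hn u) (he.lift_J h hn u) (he.lift_g h hn hu) ?_ v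
  ext1 v
  have e2 : ∀ v, he.lift h hn u (he.lift h hn u v) = he.lift h hn w v :=
    he.lift_lift h hn u _ (he.lift_I h hn u) (he.lift_J h hn u) h1
  have e4 : ∀ v, he.lift h hn w (he.lift h hn w v) = he.lift h hn x v :=
    he.lift_lift h hn w _ (he.lift_I h hn w) (he.lift_J h hn w) h2
  have e8 : ∀ v, he.lift h hn x (he.lift h hn x v) = he.lift h hn e v :=
    he.lift_lift h hn x _ (he.lift_I h hn x) (he.lift_J h hn x) h3
  change he.lift h hn u (he.lift h hn u (he.lift h hn u (he.lift h hn u (he.lift h hn u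
    (he.lift h hn u (he.lift h hn u (he.lift h hn u v))))))) = v
  rw [e2, e2, e2, e2, e4, e4, e8, he.lift_self]

theorem CalibLike.inv_frame (hV : CalibLike I J K g hi V) (h : QHerm I J K g)
    (hn : Module.finrank ℝ W = 4 * n) (he : IsHFrame I J K g e) {u : Fin n → W}
    (hu : IsHFrame I J K g u) (w x : Fin n → W) (h1 : ∀ a, he.lift h hn u (u a) = w a)
    (h2 : ∀ a, he.lift h hn w (w a) = x a) (h3 : ∀ a, he.lift h hn x (x a) = e a)
    (f : (Fin n ⊕ Fin i) × Fin 2 → Fin n × Fin 2 × Fin 2) :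
    V (hbasis I J u ∘ f) = V (hbasis I J e ∘ f) := by
  rw [← hV.inv_lift h hn he hu w x h1 h2 h3 (hbasis I J e ∘ f)]
  simp [Function.comp_def]

/-- A function on indices with values `±1`, constant on complex lines, whose product over the
indices of a list is `1` unless `V` vanishes on that list. -/
structure IsSign (I J : W →L[ℝ] W) (V : W [⋀^(Fin n ⊕ Fin i) × Fin 2]→ₗ[ℝ] ℝ) (e : Fin n → W)
    (χ : Fin n × Fin 2 × Fin 2 → ℝ) : Prop where
  sq : ∀ α, χ α * χ α = 1
  pair : ∀ a t r s, χ (a, t, r) = χ (a, t, s)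
  prod : ∀ f, V (hbasis I J e ∘ f) ≠ 0 → ∏ j, χ (f j) = 1

-- A symmetry that is diagonal on the frame multiplies the value on a list by the product of its
-- eigenvalues, which must be `1` where the value is nonzero.
omit [FiniteDimensional ℝ W] in
theorem prod_eq_one_of_map {χ : Fin n × Fin 2 × Fin 2 → ℝ} (P : W →ₗ[ℝ] W)
    (hVP : ∀ v, V (fun j => P (v j)) = V v)
    (hP : ∀ α, P (hbasis I J e α) = χ α • hbasis I J e α)
    (f : (Fin n ⊕ Fin i) × Fin 2 → Fin n × Fin 2 × Fin 2) (hf : V (hbasis I J e ∘ f) ≠ 0) :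
    ∏ j, χ (f j) = 1 := by
  have h1 := hVP (hbasis I J e ∘ f)
  simp only [Function.comp_apply, hP] at h1
  have h2 := V.toMultilinearMap.map_smul_univ (fun j => χ (f j)) (hbasis I J e ∘ f)
  have h3 : (∏ j, χ (f j)) * V (hbasis I J e ∘ f) = V (hbasis I J e ∘ f) := by
    rw [← smul_eq_mul]
    exact h2.symm.trans h1
  exact mul_right_cancel₀ hf (by rw [h3, one_mul])

/-- The sign attached to a quaternionic line. -/
def lineSign (a : Fin n) (α : Fin n × Fin 2 × Fin 2) : ℝ := if α.1 = a then -1 else 1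

/-- The sign attached to the type of an index. -/
def typeSign (α : Fin n × Fin 2 × Fin 2) : ℝ := if α.2.1 = 0 then 1 else -1

omit [FiniteDimensional ℝ W] in
theorem IsSign.prod_base {χ : Fin n × Fin 2 × Fin 2 → ℝ} (hχ : IsSign I J V e χ) :
    ∏ j, χ (baseList hi j) = 1 := by
  rw [Fintype.prod_prod_type]
  refine Finset.prod_eq_one fun x _ => ?_
  rw [Fin.prod_univ_two, baseList_pair hi x 0 1, hχ.pair _ _ 1 (baseList hi (x, 0)).2.2]
  exact hχ.sq _

omit [FiniteDimensional ℝ W] in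
/-- Permuting the lines of a frame and multiplying its vectors by unit quaternions gives a
frame. -/
theorem IsHFrame.of_lines (he : IsHFrame I J K g e) (h : QHerm I J K g) {σ : Fin n → Fin n}
    (hσ : Function.Injective σ) {u : Fin n → W} (p q r s : Fin n → ℝ)
    (hu : ∀ a, u a = p a • e (σ a) + q a • I (e (σ a)) + r a • J (e (σ a)) + s a • K (e (σ a)))
    (hp : ∀ a, p a * p a + q a * q a + r a * r a + s a * s a = 1) :
    IsHFrame I J K g u := by
  have hone : ∀ a, g (u a) (u a) = 1 := by
    intro a
    rw [hu, ← hp a]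
    simp [h.g_I, h.g_J, h.g_K, h.I_sq, h.J_sq, h.K_sq, h.I_J, h.J_I, h.I_K, h.J_K, h.K_I, h.K_J,
      he.one, he.I, he.J, he.K]
  have hne : ∀ {a b}, a ≠ b → σ a ≠ σ b := fun hab hc => hab (hσ hc)
  constructor
  · intro a b
    by_cases hab : a = b
    · subst hab; simp [hone]
    · rw [hu, hu]
      simp [h.g_I, h.g_J, h.g_K, h.I_sq, h.J_sq, h.K_sq, h.I_J, h.J_I, h.I_K, h.J_K, h.K_I, h.K_J,
        he.one, he.I, he.J, he.K, hab, hne hab]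
  all_goals
    intro a b
    by_cases hab : a = b
    · subst hab; simp [h.g_self_I, h.g_self_J, h.g_self_K]
    · rw [hu, hu]
      simp [h.g_I, h.g_J, h.g_K, h.I_sq, h.J_sq, h.K_sq, h.I_J, h.J_I, h.I_K, h.J_K, h.K_I, h.K_J,
        he.one, he.I, he.J, he.K, hne hab]

theorem CalibLike.eq_zero_of_orthogonal (hV : CalibLike I J K g hi V) (h : QHerm I J K g)
    (hn : Module.finrank ℝ W = 4 * n) (hn0 : 0 < n) {u : W} (hu : u ≠ 0)
    {v : (Fin n ⊕ Fin i) × Fin 2 → W} (h0 : ∀ j, g (v j) u = 0) (h1 : ∀ j, g (v j) (I u) = 0)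
    (h2 : ∀ j, g (v j) (J u) = 0) (h3 : ∀ j, g (v j) (K u) = 0) : V v = 0 := by
  have hw : IsHFrame I J K g (fun _ : Fin 1 => (Real.sqrt (g u u))⁻¹ • u) :=
    ⟨fun a b => by rw [h.normalize hu]; simp [Subsingleton.elim a b], fun _ _ => h.g_self_I _,
      fun _ _ => h.g_self_J _, fun _ _ => h.g_self_K _⟩
  obtain ⟨e, he, hee⟩ := hw.exists_extend h hn (Nat.succ_le_of_lt hn0)
  refine hV.line e he (Fin.castLE (Nat.succ_le_of_lt hn0) 0) v fun j t r => ?_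
  fin_cases t <;> fin_cases r <;> simp [hee, h0, h1, h2, h3, h.J_I]

/-- The symmetry is $-1$ on one quaternionic line and $1$ on the others, a map of order dividing
two. -/
theorem CalibLike.isSign_line (hV : CalibLike I J K g hi V) (h : QHerm I J K g)
    (hn : Module.finrank ℝ W = 4 * n) (he : IsHFrame I J K g e) (a : Fin n) :
    IsSign I J V e (lineSign a) where
  sq α := by unfold lineSign; split_ifs <;> norm_num
  pair _ _ _ _ := rfl
  prod f hf := by
    let u : Fin n → W := fun b => (if b = a then (-1 : ℝ) else 1) • e b
    have hu : IsHFrame I J K g u := he.of_lines h (σ := id) Function.injective_id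
      (fun b => if b = a then (-1 : ℝ) else 1) (fun _ => 0) (fun _ => 0) (fun _ => 0)
      (fun b => by simp [u]) (fun b => by split_ifs <;> simp)
    have hself : ∀ b, he.lift h hn e (e b) = e b := fun b => he.lift_self h hn _
    have h1 : ∀ b, he.lift h hn u (u b) = e b := by
      intro b
      simp only [u, map_smul, he.lift_frame]
      split_ifs <;> simp
    refine prod_eq_one_of_map (he.lift h hn u) (hV.inv_lift h hn he hu e e h1 hself hself)
      (fun α => ?_) f hf
    rw [he.lift_hbasis]
    obtain ⟨b, t, r⟩ := α
    by_cases hb : b = a <;> fin_cases t <;> fin_cases r <;> simp [u, lineSign, hb]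

/-- The map which is the identity on `e_a`, `J e_a` and multiplication by `J` on `I e_a`,
`J I e_a`. -/
theorem CalibLike.exists_twist (hV : CalibLike I J K g hi V) (h : QHerm I J K g)
    (hn : Module.finrank ℝ W = 4 * n) (he : IsHFrame I J K g e) :
    ∃ Q : W →ₗ[ℝ] W, (∀ v, V (fun j => Q (v j)) = V v) ∧
      (∀ a r, Q (hbasis I J e (a, 0, r)) = hbasis I J e (a, 0, r)) ∧
      (∀ a, Q (hbasis I J e (a, 1, 0)) = hbasis I J e (a, 1, 1)) ∧
      (∀ a, Q (hbasis I J e (a, 1, 1)) = -hbasis I J e (a, 1, 0)) := by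
  -- With $c=\cos(\pi/4)$ one has $(c+cJ)(c-cJ)=1$ and $(c+cJ)^2=J$. The quaternion-linear map
  -- $e_a\mapsto(c-cJ)e_a$ acts on $Ie_a$ as $c+cJ$, because $IJ=-JI$. Rotating everything by
  -- $\pi/4$ then gives the required map.
  set c : ℝ := Real.sqrt 2 / 2 with hc
  have hcc : c * c = 1 / 2 := by
    rw [hc, div_mul_div_comm, Real.mul_self_sqrt (by norm_num)]; norm_num
  let u : Fin n → W := fun a => c • e a + (-c) • J (e a)
  have hu : IsHFrame I J K g u := he.of_lines h (σ := id) Function.injective_id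
      (fun _ => c) (fun _ => 0) (fun _ => -c) (fun _ => 0)
      (fun b => by simp [u]) (fun b => by linarith)
  -- The square of the map sends $e_b$ to $-Je_b$ and its fourth power is $-1$, so its eighth power
  -- is the identity; this is why `CalibLike.inv` asks for order dividing `8`.
  have h1 : ∀ b, he.lift h hn u (u b) = -J (e b) := by
    intro b
    simp only [u, map_add, map_smul, he.lift_frame, he.lift_J, h.J_sq]
    match_scalars <;> linarith
  have h2 : ∀ b, he.lift h hn (fun b => -J (e b)) (-J (e b)) = -e b := by
    intro b
    simp only [map_neg, he.lift_frame, he.lift_J, h.J_sq]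
    simp
  have h3 : ∀ b, he.lift h hn (fun b => -e b) (-e b) = e b := by
    intro b
    simp only [map_neg, he.lift_frame, neg_neg]
  have hinv := hV.inv_lift h hn he hu _ _ h1 h2 h3
  have hrot : ∀ v, rot J (Real.pi / 4) v = c • v + c • J v := by
    intro v; rw [rot_apply, Real.cos_pi_div_four, Real.sin_pi_div_four]
  refine ⟨(rot J (Real.pi / 4)).toLinearMap ∘ₗ he.lift h hn u, fun v => ?_, fun a r => ?_,
    fun a => ?_, fun a => ?_⟩
  · rw [← hinv v]
    exact hV.rotate (Real.pi / 4) (fun j => he.lift h hn u (v j))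
  all_goals
    rw [LinearMap.comp_apply, he.lift_hbasis]
    change rot J (Real.pi / 4) _ = _
    rw [hrot]
  · fin_cases r
    · simp only [u, hbasis_00, Fin.zero_eta, map_add, map_smul, h.J_sq]
      match_scalars <;> linarith
    · simp only [u, hbasis_01, Fin.mk_one, map_add, map_smul, map_neg, h.J_sq]
      match_scalars <;> linarith
  · simp only [u, hbasis_10, hbasis_11, map_add, map_smul, h.I_J, h.J_K, h.J_I]
    match_scalars <;> linarith
  · simp only [u, hbasis_10, hbasis_11, map_add, map_smul, h.I_J, h.J_K, h.J_I, map_neg]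
    match_scalars <;> linarith

/-- The square of the twist is $1$ on $e_a,Je_a$ and $-1$ on $Ie_a,JIe_a$. -/
theorem CalibLike.isSign_type (hV : CalibLike I J K g hi V) (h : QHerm I J K g)
    (hn : Module.finrank ℝ W = 4 * n) (he : IsHFrame I J K g e) :
    IsSign I J V e typeSign where
  sq α := by unfold typeSign; split_ifs <;> norm_num
  pair _ _ _ _ := rfl
  prod f hf := by
    obtain ⟨Q, hQ, h0, h1, h2⟩ := hV.exists_twist h hn he
    refine prod_eq_one_of_map (Q ∘ₗ Q) (fun v => ?_) (fun α => ?_) f hf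
    · exact (hQ fun j => Q (v j)).trans (hQ v)
    · obtain ⟨b, t, r⟩ := α
      fin_cases t
      · simp only [Fin.zero_eta, LinearMap.comp_apply, h0]; simp [typeSign]
      · have e1 := h1 b
        have e2 := h2 b
        fin_cases r
        · simp only [Fin.mk_one, Fin.zero_eta, LinearMap.comp_apply, e1, e2]; simp [typeSign]
        · simp only [Fin.mk_one, LinearMap.comp_apply, e1, e2, map_neg]; simp [typeSign]

end Stabilizer

/-! ### Alternating maps with some arguments fixed -/

section ExtendMap

variable {W F ι κ : Type*}

theorem extend_update [DecidableEq ι] [DecidableEq κ] {p : κ → ι} (hp : Function.Injective p) (x : κ → W) (v : ι → W) (k : κ)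
    (w : W) : Function.extend p (Function.update x k w) v =
      Function.update (Function.extend p x v) (p k) w := by
  funext j
  by_cases hj : ∃ l, p l = j
  · obtain ⟨l, rfl⟩ := hj
    rw [hp.extend_apply]
    by_cases hl : l = k
    · subst hl; simp
    · rw [Function.update_of_ne hl, Function.update_of_ne (hp.ne hl), hp.extend_apply]
  · rw [Function.extend_apply' _ _ _ hj, Function.update_of_ne (fun hc => hj ⟨k, hc.symm⟩),
      Function.extend_apply' _ _ _ hj]

theorem extend_congr {p : κ → ι} (hp : Function.Injective p) (x : κ → W) {v v' : ι → W}
    (h : ∀ j, (∀ k, p k ≠ j) → v j = v' j) : Function.extend p x v = Function.extend p x v' := by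
  funext j
  by_cases hj : ∃ l, p l = j
  · obtain ⟨l, rfl⟩ := hj
    rw [hp.extend_apply, hp.extend_apply]
  · rw [Function.extend_apply' _ _ _ hj, Function.extend_apply' _ _ _ hj,
      h j fun k hk => hj ⟨k, hk⟩]

theorem extend_comp_self {p : κ → ι} (hp : Function.Injective p) (f : ι → W) :
    Function.extend p (f ∘ p) f = f := by
  funext j
  by_cases hj : ∃ k, p k = j
  · obtain ⟨k, rfl⟩ := hj; rw [hp.extend_apply]; rfl
  · rw [Function.extend_apply' _ _ _ hj]

theorem comp_extend {W' : Type*} (Q : W → W') {p : κ → ι} (x : κ → W) (v : ι → W) :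
    Q ∘ Function.extend p x v = Function.extend p (Q ∘ x) (Q ∘ v) := by
  funext j
  classical
  unfold Function.extend
  simp only [Function.comp_apply]
  split_ifs <;> rfl

variable [AddCommGroup W] [Module ℝ W] [AddCommGroup F] [Module ℝ F]

/-- The alternating map in the arguments `p k`, with the remaining arguments fixed. -/
def extendMap (f : W [⋀^ι]→ₗ[ℝ] F) {p : κ → ι} (hp : Function.Injective p) (v : ι → W) :
    W [⋀^κ]→ₗ[ℝ] F where
  toFun x := f (Function.extend p x v)
  map_update_add' x k y z := by
    rename_i inst
    classical
    rw [Subsingleton.elim inst]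
    rw [extend_update hp, extend_update hp, extend_update hp, f.map_update_add]
  map_update_smul' x k c y := by
    rename_i inst
    classical
    rw [Subsingleton.elim inst]
    rw [extend_update hp, extend_update hp, f.map_update_smul]
  map_eq_zero_of_eq' x k l hkl hne :=
    f.map_eq_zero_of_eq _ (by rw [hp.extend_apply, hp.extend_apply, hkl]) (hp.ne hne)

variable (f : W [⋀^Fin 4]→ₗ[ℝ] F) (x x' y z t : W)

theorem quad_add0 : f ![x + x', y, z, t] = f ![x, y, z, t] + f ![x', y, z, t] :=
  f.map_vecCons_add ![y, z, t] x x'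

theorem quad_neg0 : f ![-x, y, z, t] = -f ![x, y, z, t] := by
  have := f.map_vecCons_smul ![y, z, t] (-1) x
  simpa using this

theorem quad_swap01 : f ![x, y, z, t] = -f ![y, x, z, t] := by
  rw [← f.map_swap _ (show (0 : Fin 4) ≠ 1 by decide)]
  congr 1; funext j; fin_cases j <;> rfl

theorem quad_swap12 : f ![x, y, z, t] = -f ![x, z, y, t] := by
  rw [← f.map_swap _ (show (1 : Fin 4) ≠ 2 by decide)]
  congr 1; funext j; fin_cases j <;> rfl

theorem quad_swap23 : f ![x, y, z, t] = -f ![x, y, t, z] := by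
  rw [← f.map_swap _ (show (2 : Fin 4) ≠ 3 by decide)]
  congr 1; funext j; fin_cases j <;> rfl

theorem quad_swap02 : f ![x, y, z, t] = -f ![z, y, x, t] := by
  rw [← f.map_swap _ (show (0 : Fin 4) ≠ 2 by decide)]
  congr 1; funext j; fin_cases j <;> rfl

theorem quad_swap13 : f ![x, y, z, t] = -f ![x, t, z, y] := by
  rw [← f.map_swap _ (show (1 : Fin 4) ≠ 3 by decide)]
  congr 1; funext j; fin_cases j <;> rfl

theorem quad_swap_pairs : f ![x, y, z, t] = f ![z, t, x, y] := by
  rw [quad_swap02, quad_swap13, neg_neg]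

theorem quad_add1 : f ![x, y + x', z, t] = f ![x, y, z, t] + f ![x, x', z, t] := by
  rw [quad_swap01, quad_add0, neg_add, ← quad_swap01, ← quad_swap01]

theorem quad_add2 : f ![x, y, z + x', t] = f ![x, y, z, t] + f ![x, y, x', t] := by
  rw [quad_swap12, quad_add1, neg_add, ← quad_swap12, ← quad_swap12]

theorem quad_add3 : f ![x, y, z, t + x'] = f ![x, y, z, t] + f ![x, y, z, x'] := by
  rw [quad_swap23, quad_add2, neg_add, ← quad_swap23, ← quad_swap23]

theorem quad_neg1 : f ![x, -y, z, t] = -f ![x, y, z, t] := by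
  rw [quad_swap01, quad_neg0, ← quad_swap01]

theorem quad_neg2 : f ![x, y, -z, t] = -f ![x, y, z, t] := by
  rw [quad_swap12, quad_neg1, ← quad_swap12]

theorem quad_neg3 : f ![x, y, z, -t] = -f ![x, y, z, t] := by
  rw [quad_swap23, quad_neg2, ← quad_swap23]

end ExtendMap

/-! ### The form as a function of four arguments in two lines -/

section Quad

variable {W : Type*} [NormedAddCommGroup W] [NormedSpace ℝ W]
variable {I J K : W →L[ℝ] W} {g : W →L[ℝ] W →L[ℝ] ℝ} {n i : ℕ} {hi : i ≤ n}
  {V : W [⋀^(Fin n ⊕ Fin i) × Fin 2]→ₗ[ℝ] ℝ} {e : Fin n → W} [FiniteDimensional ℝ W]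

/-- The positions in a list of the pairs belonging to two indices `a` and `b`. -/
def quadPos (i : ℕ) (a b : Fin n) : Fin 4 → (Fin n ⊕ Fin i) × Fin 2 :=
  ![(Sum.inl a, 0), (Sum.inl a, 1), (Sum.inl b, 0), (Sum.inl b, 1)]

theorem quadPos_injective (i : ℕ) {a b : Fin n} (hab : a ≠ b) :
    Function.Injective (quadPos i a b) := by
  intro k l hkl
  have hba := hab.symm
  fin_cases k <;> fin_cases l <;> simp_all [quadPos]

theorem forall_quadPos {i : ℕ} {a b : Fin n} {j : (Fin n ⊕ Fin i) × Fin 2}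
    (hj : ∀ k, quadPos i a b k ≠ j) : j.1 ≠ Sum.inl a ∧ j.1 ≠ Sum.inl b := by
  obtain ⟨x, r⟩ := j
  constructor <;> rintro rfl <;> fin_cases r
  · exact hj 0 rfl
  · exact hj 1 rfl
  · exact hj 2 rfl
  · exact hj 3 rfl

/-- `V` as a function of the vectors in the pairs of the indices `a` and `b`. -/
def quad (hi : i ≤ n) (V : W [⋀^(Fin n ⊕ Fin i) × Fin 2]→ₗ[ℝ] ℝ) (I J : W →L[ℝ] W)
    (e : Fin n → W) {a b : Fin n} (hab : a ≠ b) : W [⋀^Fin 4]→ₗ[ℝ] ℝ :=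
  extendMap V (quadPos_injective i hab) (hbasis I J e ∘ baseList hi)

theorem baseList_fst_ne {a : Fin n} (ha : i ≤ a) {j : (Fin n ⊕ Fin i) × Fin 2}
    (hj : j.1 ≠ Sum.inl a) : (baseList hi j).1 ≠ a := by
  obtain ⟨x | d, r⟩ := j
  · rintro rfl; exact hj rfl
  · rintro rfl
    simp only [baseList_inr, Fin.val_castLE] at ha
    omega

variable {a b : Fin n}

theorem quad_eq (hab : a ≠ b) (f : Fin 4 → Fin n × Fin 2 × Fin 2) :
    quad hi V I J e hab (fun k => hbasis I J e (f k)) =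
      V (hbasis I J e ∘ Function.extend (quadPos i a b) f (baseList hi)) := by
  change V _ = _
  congr 1
  funext j
  classical
  unfold Function.extend
  simp only [Function.comp_apply]
  split_ifs <;> rfl

/-- For `a` and `b` not below `i`, these two lines meet the list only in the four free positions.
The fixed arguments are then the same for both frames. -/
theorem quad_frame {u : Fin n → W} (hu : ∀ c, c ≠ a → c ≠ b → u c = e c) (ha : i ≤ a) (hb : i ≤ b)
    (hab : a ≠ b) (hVu : ∀ f, V (hbasis I J u ∘ f) = V (hbasis I J e ∘ f))
    (f : Fin 4 → Fin n × Fin 2 × Fin 2) :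
    quad hi V I J e hab (fun k => hbasis I J u (f k)) =
      quad hi V I J e hab (fun k => hbasis I J e (f k)) := by
  rw [quad_eq, ← hVu]
  have : quad hi V I J u hab (fun k => hbasis I J u (f k)) =
      quad hi V I J e hab (fun k => hbasis I J u (f k)) := by
    change V _ = V _
    congr 1
    refine extend_congr (quadPos_injective i hab) _ fun j hj => ?_
    obtain ⟨h1, h2⟩ := forall_quadPos hj
    have h3 := hu _ (baseList_fst_ne (hi := hi) ha h1) (baseList_fst_ne (hi := hi) hb h2)
    simp [hbasis, h3]
  rw [← this, quad_eq]

end Quad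

/-! ### Symmetries and relations for the four-argument form -/

section QuadRelation

/-- Adding the two expansions removes the terms of odd degree in the primed vectors. -/
theorem quad_add_sub {W : Type*} [AddCommGroup W] [Module ℝ W] (f : W [⋀^Fin 4]→ₗ[ℝ] ℝ)
    (x y z t x' y' z' t' : W) :
    f ![x + x', y + y', z + z', t + t'] + f ![x + -x', y + -y', z + -z', t + -t'] =
      2 * (f ![x, y, z, t] + f ![x', y', z', t'] + f ![x, y, z', t'] + f ![x', y', z, t] +
        f ![x, y', z, t'] + f ![x', y, z', t] + f ![x, y', z', t] + f ![x', y, z, t']) := by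
  simp only [quad_add0, quad_add1, quad_add2, quad_add3, quad_neg0, quad_neg1, quad_neg2, quad_neg3]
  ring

variable {W : Type*} [NormedAddCommGroup W] [NormedSpace ℝ W]
variable {I J K : W →L[ℝ] W} {g : W →L[ℝ] W →L[ℝ] ℝ} {n i : ℕ} {hi : i ≤ n}
  {V : W [⋀^(Fin n ⊕ Fin i) × Fin 2]→ₗ[ℝ] ℝ} {e : Fin n → W} [FiniteDimensional ℝ W]
  {a b : Fin n}

theorem quad_change {u : Fin n → W} (hu : ∀ c, c ≠ a → c ≠ b → u c = e c) (ha : i ≤ a) (hb : i ≤ b)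
    (hab : a ≠ b) (hVu : ∀ f, V (hbasis I J u ∘ f) = V (hbasis I J e ∘ f))
    (p q r s : Fin n × Fin 2 × Fin 2) :
    quad hi V I J e hab ![hbasis I J u p, hbasis I J u q, hbasis I J u r, hbasis I J u s] =
      quad hi V I J e hab ![hbasis I J e p, hbasis I J e q, hbasis I J e r, hbasis I J e s] := by
  have := quad_frame (hi := hi) hu ha hb hab hVu ![p, q, r, s]
  have hl : ∀ v : Fin n → W, (fun k => hbasis I J v ((![p, q, r, s] : Fin 4 → _) k)) =
      ![hbasis I J v p, hbasis I J v q, hbasis I J v r, hbasis I J v s] := by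
    intro v; funext k; fin_cases k <;> rfl
  rwa [hl, hl] at this

theorem CalibLike.map_update_I (hV : CalibLike I J K g hi V) (h : QHerm I J K g)
    (hn : Module.finrank ℝ W = 4 * n) (he : IsHFrame I J K g e) (b : Fin n)
    (f : (Fin n ⊕ Fin i) × Fin 2 → Fin n × Fin 2 × Fin 2) :
    V (hbasis I J (Function.update e b (I (e b))) ∘ f) = V (hbasis I J e ∘ f) := by
  have hu : IsHFrame I J K g (Function.update e b (I (e b))) :=
    he.of_lines h (σ := id) Function.injective_id (fun c => if c = b then 0 else 1)
      (fun c => if c = b then 1 else 0) (fun _ => 0) (fun _ => 0)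
      (fun c => by by_cases hc : c = b <;> simp [hc]) (fun c => by split_ifs <;> simp)
  refine hV.inv_frame h hn he hu (Function.update e b (-e b)) e (fun c => ?_) (fun c => ?_)
    (fun c => he.lift_self h hn _) f
  all_goals by_cases hc : c = b
  · subst hc; simp [he.lift_I, he.lift_frame, h.I_sq]
  · simp [hc, he.lift_frame]
  · subst hc; simp [he.lift_frame]
  · simp [hc, he.lift_frame]

theorem CalibLike.map_update_J (hV : CalibLike I J K g hi V) (h : QHerm I J K g)
    (hn : Module.finrank ℝ W = 4 * n) (he : IsHFrame I J K g e) (b : Fin n)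
    (f : (Fin n ⊕ Fin i) × Fin 2 → Fin n × Fin 2 × Fin 2) :
    V (hbasis I J (Function.update e b (J (e b))) ∘ f) = V (hbasis I J e ∘ f) := by
  have hu : IsHFrame I J K g (Function.update e b (J (e b))) :=
    he.of_lines h (σ := id) Function.injective_id (fun c => if c = b then 0 else 1) (fun _ => 0)
      (fun c => if c = b then 1 else 0) (fun _ => 0)
      (fun c => by by_cases hc : c = b <;> simp [hc]) (fun c => by split_ifs <;> simp)
  refine hV.inv_frame h hn he hu (Function.update e b (-e b)) e (fun c => ?_) (fun c => ?_)
    (fun c => he.lift_self h hn _) f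
  all_goals by_cases hc : c = b
  · subst hc; simp [he.lift_J, he.lift_frame, h.J_sq]
  · simp [hc, he.lift_frame]
  · subst hc; simp [he.lift_frame]
  · simp [hc, he.lift_frame]

theorem CalibLike.map_swap (hV : CalibLike I J K g hi V) (h : QHerm I J K g)
    (hn : Module.finrank ℝ W = 4 * n) (he : IsHFrame I J K g e) (a b : Fin n)
    (f : (Fin n ⊕ Fin i) × Fin 2 → Fin n × Fin 2 × Fin 2) :
    V (hbasis I J (e ∘ Equiv.swap a b) ∘ f) = V (hbasis I J e ∘ f) := by
  have hu : IsHFrame I J K g (e ∘ Equiv.swap a b) :=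
    he.of_lines h (σ := Equiv.swap a b) (Equiv.injective _) (fun c => 1) (fun _ => 0)
      (fun _ => 0) (fun _ => 0) (fun c => by simp) (fun c => by simp)
  exact hV.inv_frame h hn he hu e e (fun c => by simp [he.lift_frame])
    (fun c => he.lift_self h hn _) (fun c => he.lift_self h hn _) f

/-- The fixed arguments lie on lines other than `a` and `b`, so the whole list is orthogonal to the
quaternionic line of `s • e a + t • e b`, and the form vanishes on it. -/
theorem CalibLike.quad_eq_zero (hV : CalibLike I J K g hi V) (h : QHerm I J K g)
    (hn : Module.finrank ℝ W = 4 * n) (he : IsHFrame I J K g e) (ha : i ≤ a) (hb : i ≤ b)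
    (hab : a ≠ b) {s t : ℝ} (hst : s ≠ 0 ∨ t ≠ 0) {x : Fin 4 → W}
    (h0 : ∀ k, g (x k) (s • e a + t • e b) = 0) (h1 : ∀ k, g (x k) (I (s • e a + t • e b)) = 0)
    (h2 : ∀ k, g (x k) (J (s • e a + t • e b)) = 0)
    (h3 : ∀ k, g (x k) (K (s • e a + t • e b)) = 0) :
    quad hi V I J e hab x = 0 := by
  have hu : s • e a + t • e b ≠ 0 := by
    intro hz
    have h1 := congrArg (g (e a)) hz
    have h2 := congrArg (g (e b)) hz
    simp [he.one, hab, hab.symm] at h1 h2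
    tauto
  have hout : ∀ j, (∀ k, quadPos i a b k ≠ j) → (baseList hi j).1 ≠ a ∧ (baseList hi j).1 ≠ b :=
    fun j hj => ⟨baseList_fst_ne ha (forall_quadPos hj).1, baseList_fst_ne hb (forall_quadPos hj).2⟩
  have hzero : ∀ α : Fin n × Fin 2 × Fin 2, α.1 ≠ a → α.1 ≠ b → ∀ p r,
      g (hbasis I J e α) (s • hbasis I J e (a, p, r) + t • hbasis I J e (b, p, r)) = 0 := by
    intro α h1 h2 p r
    rw [map_add, map_smul, map_smul, he.orthonormal h, he.orthonormal h, if_neg, if_neg]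
    · simp
    · rintro rfl; exact h2 rfl
    · rintro rfl; exact h1 rfl
  change V _ = 0
  refine hV.eq_zero_of_orthogonal h hn (lt_of_le_of_lt (Nat.zero_le _) a.2) hu ?_ ?_ ?_ ?_ <;>
    intro j <;> by_cases hj : ∃ k, quadPos i a b k = j
  all_goals first
    | (obtain ⟨k, rfl⟩ := hj
       rw [(quadPos_injective i hab).extend_apply]
       first | exact h0 k | exact h1 k | exact h2 k | exact h3 k)
    | (rw [Function.extend_apply' _ _ _ hj]
       obtain ⟨h1, h2⟩ := hout j (fun k hk => hj ⟨k, hk⟩)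
       have e00 := hzero _ h1 h2 0 0
       have e01 := hzero _ h1 h2 0 1
       have e10 := hzero _ h1 h2 1 0
       have e11 := hzero _ h1 h2 1 1
       simp only [hbasis_00, hbasis_01, hbasis_10, hbasis_11, h.J_I] at e00 e01 e10 e11
       simp only [Function.comp_apply, map_add, map_smul] at *
       first
        | exact e00
        | exact e01
        | exact e10
        | (simp only [map_neg, smul_eq_mul] at e11 ⊢; linarith))

/-- The twist also moves the fixed arguments, but only by quarter turns of the pairs $Ie_d,JIe_d$,
which an alternating map does not notice. -/
theorem quad_comp_twist (hab : a ≠ b) {Q : W →ₗ[ℝ] W} (hQ : ∀ v, V (fun j => Q (v j)) = V v)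
    (h0 : ∀ a r, Q (hbasis I J e (a, 0, r)) = hbasis I J e (a, 0, r))
    (h1 : ∀ a, Q (hbasis I J e (a, 1, 0)) = hbasis I J e (a, 1, 1))
    (h2 : ∀ a, Q (hbasis I J e (a, 1, 1)) = -hbasis I J e (a, 1, 0)) (x : Fin 4 → W) :
    quad hi V I J e hab (Q ∘ x) = quad hi V I J e hab x := by
  change V _ = V _
  rw [← hQ (Function.extend (quadPos i a b) x _)]
  change _ = V (Q ∘ Function.extend (quadPos i a b) x _)
  rw [comp_extend]
  symm
  have hr : ∀ (d : Fin i) (r : Fin 2) (y : Fin 4 → W) v,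
      Function.extend (quadPos i a b) y v (Sum.inr d, r) = v (Sum.inr d, r) := by
    intro d r y v
    refine Function.extend_apply' _ _ _ ?_
    rintro ⟨k, hk⟩
    fin_cases k <;> simp [quadPos] at hk
  have hl : ∀ (c : Fin n) (r : Fin 2),
      Function.extend (quadPos i a b) (Q ∘ x) (Q ∘ hbasis I J e ∘ baseList hi) (Sum.inl c, r) =
      Function.extend (quadPos i a b) (Q ∘ x) (hbasis I J e ∘ baseList hi) (Sum.inl c, r) := by
    intro c r
    by_cases hj : ∃ k, quadPos i a b k = (Sum.inl c, r)
    · obtain ⟨k, hk⟩ := hj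
      rw [← hk, (quadPos_injective i hab).extend_apply, (quadPos_injective i hab).extend_apply]
    · rw [Function.extend_apply' _ _ _ hj, Function.extend_apply' _ _ _ hj]
      simp [h0]
  refine map_rot_pairs V _ _ (Sum.elim (fun _ => 1) fun _ => 0) (Sum.elim (fun _ => 0) fun _ => 1)
    ?_ ?_ ?_
  · rintro (c | d) <;> simp
  · rintro (c | d)
    · rw [hl]; simp
    · rw [hr, hr, hr]; simpa using h1 _
  · rintro (c | d)
    · rw [hl]; simp
    · rw [hr, hr, hr]; simpa using h2 _

section Values

variable (hV : CalibLike I J K g hi V) (h : QHerm I J K g)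
    (hn : Module.finrank ℝ W = 4 * n) (he : IsHFrame I J K g e) (ha : i ≤ a) (hb : i ≤ b)
    (hab : a ≠ b)
include hV h hn he ha hb

theorem CalibLike.quad_twist_eq : quad hi V I J e hab ![e a, I (e a), e b, I (e b)] =
    quad hi V I J e hab ![e a, J (I (e a)), e b, J (I (e b))] := by
  obtain ⟨Q, hQ, h0, h1, h2⟩ := hV.exists_twist h hn he
  rw [← quad_comp_twist hab hQ h0 h1 h2]
  congr 1
  funext k
  have e1 := h0 a 0
  have e2 := h0 b 0
  have e3 := h1 a
  have e4 := h1 b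
  simp only [hbasis_00, hbasis_10, hbasis_11] at e1 e2 e3 e4
  fin_cases k <;> simp [e1, e2, e3, e4]

/-- The twist exchanges the roles of `a` and `b` up to a minus sign, while swapping the two lines is
a symmetry; the value equals its own negative. -/
theorem CalibLike.quad_mixed_eq_zero :
    quad hi V I J e hab ![e a, I (e a), e b, J (I (e b))] = 0 := by
  obtain ⟨Q, hQ, h0, h1, h2⟩ := hV.exists_twist h hn he
  have e1 := h0 a 0
  have e2 := h0 b 0
  have e3 := h1 a
  have e4 := h2 b
  simp only [hbasis_00, hbasis_10, hbasis_11] at e1 e2 e3 e4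
  have k1 := quad_comp_twist (hi := hi) hab hQ h0 h1 h2 ![e a, I (e a), e b, J (I (e b))]
  have k2 : Q ∘ ![e a, I (e a), e b, J (I (e b))] = ![e a, J (I (e a)), e b, -I (e b)] := by
    funext k
    fin_cases k <;> simp [e1, e2, e3, e4]
  rw [k2, quad_neg3] at k1
  have k3 := quad_change (hi := hi) (a := a) (b := b) (u := e ∘ Equiv.swap a b)
    (fun c hca hcb => by simp [Equiv.swap_apply_of_ne_of_ne hca hcb]) ha hb hab
    (hV.map_swap h hn he a b) (a, 0, 0) (a, 1, 0) (b, 0, 0) (b, 1, 1)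
  simp only [hbasis_00, hbasis_10, hbasis_11, Function.comp_apply, Equiv.swap_apply_left,
    Equiv.swap_apply_right] at k3
  rw [quad_swap_pairs] at k3
  linarith

/-- The form vanishes on the quaternionic lines through $e_a\pm e_b$. Adding the two expansions
leaves the even terms: two pure ones, which vanish, two equal to the first value here, and four
which the symmetries identify with the second. -/
theorem CalibLike.quad_relation :
    quad hi V I J e hab ![e a, J (e a), e b, J (e b)] +
      2 * quad hi V I J e hab ![e a, I (e a), e b, I (e b)] = 0 := by
  set E := quad hi V I J e hab with hE
  have hba := hab.symm
  -- These four vectors are orthogonal to the quaternionic line of $e_a-e_b$; those of `z2` are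
  -- orthogonal to that of $e_a+e_b$.
  have z1 : E ![e a + e b, J (e a) + J (e b), I (e a) + I (e b), J (I (e a)) + J (I (e b))] = 0 := by
    refine hV.quad_eq_zero h hn he ha hb hab (s := 1) (t := -1) (by norm_num) ?_ ?_ ?_ ?_ <;>
      intro k <;> fin_cases k <;>
      simp [h.g_I, h.g_J, h.g_K, h.I_sq, h.J_sq, h.K_sq, h.I_J, h.J_I, h.I_K, h.J_K, h.K_I, h.K_J,
        he.one, he.I, he.J, he.K, hab, hba]
  have z2 : E ![e a + -e b, J (e a) + -J (e b), I (e a) + -I (e b),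
      J (I (e a)) + -J (I (e b))] = 0 := by
    refine hV.quad_eq_zero h hn he ha hb hab (s := 1) (t := 1) (by norm_num) ?_ ?_ ?_ ?_ <;>
      intro k <;> fin_cases k <;>
      simp [h.g_I, h.g_J, h.g_K, h.I_sq, h.J_sq, h.K_sq, h.I_J, h.J_I, h.I_K, h.J_K, h.K_I, h.K_J,
        he.one, he.I, he.J, he.K, hab, hba]
  have z3 : E ![e a, J (e a), I (e a), J (I (e a))] = 0 := by
    refine hV.quad_eq_zero h hn he ha hb hab (s := 0) (t := 1) (by norm_num) ?_ ?_ ?_ ?_ <;>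
      intro k <;> fin_cases k <;>
      simp [h.g_I, h.g_J, h.g_K, h.I_sq, h.J_sq, h.K_sq, h.I_J, h.J_I, h.I_K, h.J_K, h.K_I, h.K_J,
        he.one, he.I, he.J, he.K, hab, hba]
  have z4 : E ![e b, J (e b), I (e b), J (I (e b))] = 0 := by
    refine hV.quad_eq_zero h hn he ha hb hab (s := 1) (t := 0) (by norm_num) ?_ ?_ ?_ ?_ <;>
      intro k <;> fin_cases k <;>
      simp [h.g_I, h.g_J, h.g_K, h.I_sq, h.J_sq, h.K_sq, h.I_J, h.J_I, h.I_K, h.J_K, h.K_I, h.K_J,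
        he.one, he.I, he.J, he.K, hba]
  have hs := quad_add_sub E (e a) (J (e a)) (I (e a)) (J (I (e a))) (e b) (J (e b)) (I (e b))
    (J (I (e b)))
  rw [z1, z2, z3, z4] at hs
  have cI : ∀ c : Fin n, i ≤ (c : ℕ) → (c = a ∨ c = b) → ∀ p q r s, _ := fun c _ hc =>
    quad_change (hi := hi) (a := a) (b := b) (u := Function.update e c (I (e c)))
    (fun d hda hdb => by rcases hc with rfl | rfl <;> simp [hda, hdb]) ha hb hab
    (hV.map_update_I h hn he c)
  have cJ : ∀ c : Fin n, i ≤ (c : ℕ) → (c = a ∨ c = b) → ∀ p q r s, _ := fun c _ hc =>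
    quad_change (hi := hi) (a := a) (b := b) (u := Function.update e c (J (e c)))
    (fun d hda hdb => by rcases hc with rfl | rfl <;> simp [hda, hdb]) ha hb hab
    (hV.map_update_J h hn he c)
  have y1 : E ![e a, J (e a), I (e b), J (I (e b))] = E ![e a, J (e a), e b, J (e b)] := by
    have := cI b hb (Or.inr rfl) (a, 0, 0) (a, 0, 1) (b, 0, 0) (b, 0, 1)
    simpa [hab] using this
  have y2 : E ![e b, J (e b), I (e a), J (I (e a))] = E ![e a, J (e a), e b, J (e b)] := by
    rw [quad_swap_pairs]
    have := cI a ha (Or.inl rfl) (a, 0, 0) (a, 0, 1) (b, 0, 0) (b, 0, 1)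
    simpa [hba] using this
  have y3 : E ![e a, J (e b), I (e a), J (I (e b))] = E ![e a, I (e a), e b, I (e b)] := by
    have := cJ b hb (Or.inr rfl) (a, 0, 0) (a, 1, 0) (b, 0, 0) (b, 1, 0)
    simp only [hbasis_00, hbasis_10, ne_eq, hab, not_false_eq_true, Function.update_of_ne,
      Function.update_self, h.I_J] at this
    rw [← this, h.J_I, quad_neg3, quad_swap12, neg_neg]
  have y4 : E ![e b, J (e a), I (e b), J (I (e a))] = E ![e a, I (e a), e b, I (e b)] := by
    have := cJ a ha (Or.inl rfl) (a, 0, 0) (a, 1, 0) (b, 0, 0) (b, 1, 0)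
    simp only [hbasis_00, hbasis_10, ne_eq, hba, not_false_eq_true, Function.update_of_ne,
      Function.update_self, h.I_J] at this
    rw [← this, h.J_I, quad_neg3, quad_swap12, neg_neg, quad_swap_pairs]
  have y5 : E ![e a, J (e b), I (e b), J (I (e a))] = E ![e a, J (I (e a)), e b, J (I (e b))] := by
    have := cJ b hb (Or.inr rfl) (a, 0, 0) (a, 1, 1) (b, 0, 0) (b, 1, 1)
    simp only [hbasis_00, hbasis_11, ne_eq, hab, not_false_eq_true, Function.update_of_ne,
      Function.update_self, h.I_J, h.J_K] at this
    rw [← this, quad_swap13, quad_swap23, neg_neg]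
  have y6 : E ![e b, J (e a), I (e a), J (I (e b))] = E ![e a, J (I (e a)), e b, J (I (e b))] := by
    have := cJ a ha (Or.inl rfl) (a, 0, 0) (a, 1, 1) (b, 0, 0) (b, 1, 1)
    simp only [hbasis_00, hbasis_11, ne_eq, hba, not_false_eq_true, Function.update_of_ne,
      Function.update_self, h.I_J, h.J_K] at this
    rw [← this, quad_swap02, quad_swap01, neg_neg]
  have y7 := hV.quad_twist_eq h hn he ha hb hab
  rw [← hE] at y7
  rw [y1, y2, y3, y4, y5, y6, ← y7] at hs
  linarith

end Values

end QuadRelation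

/-! ### The derivative of the form along an endomorphism, in a frame -/

section Expansion

variable {W : Type*} [NormedAddCommGroup W] [NormedSpace ℝ W]

/-- The action of an endomorphism `C` on the form `g (J ·, ·)`. -/
def actForm (J : W →L[ℝ] W) (g : W →L[ℝ] W →L[ℝ] ℝ) (C : W →ₗ[ℝ] W) (u w : W) : ℝ :=
  g (J (C u)) w + g (J u) (C w)

variable {I J K : W →L[ℝ] W} {g : W →L[ℝ] W →L[ℝ] ℝ} {n i : ℕ} {hi : i ≤ n}
  {V : W [⋀^(Fin n ⊕ Fin i) × Fin 2]→ₗ[ℝ] ℝ} {e : Fin n → W} [FiniteDimensional ℝ W]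
  {C : W →ₗ[ℝ] W} {a b : Fin n}

omit [FiniteDimensional ℝ W] in
theorem actForm_swap (h : QHerm I J K g) (C : W →ₗ[ℝ] W) (u w : W) :
    actForm J g C w u = -actForm J g C u w := by
  unfold actForm
  rw [h.symm (J (C u)) w, h.symm (J u), h.g_J (C w), h.g_J w]
  ring

/-- The contribution of the argument number `j` to the derivative of `V` along `C`. -/
def actTerm (V : W [⋀^(Fin n ⊕ Fin i) × Fin 2]→ₗ[ℝ] ℝ) (I J : W →L[ℝ] W)
    (g : W →L[ℝ] W →L[ℝ] ℝ) (e : Fin n → W) (C : W →ₗ[ℝ] W)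
    (f : (Fin n ⊕ Fin i) × Fin 2 → Fin n × Fin 2 × Fin 2) (j : (Fin n ⊕ Fin i) × Fin 2) : ℝ :=
  ∑ β, g (C (hbasis I J e (f j))) (hbasis I J e β) * V (hbasis I J e ∘ Function.update f j β)

theorem sum_actTerm (h : QHerm I J K g) (hn : Module.finrank ℝ W = 4 * n)
    (he : IsHFrame I J K g e) (hC : ∀ w, ∑ j, V (Function.update w j (C (w j))) = 0)
    (f : (Fin n ⊕ Fin i) × Fin 2 → Fin n × Fin 2 × Fin 2) :
    ∑ j, actTerm V I J g e C f j = 0 := by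
  rw [← hC (hbasis I J e ∘ f)]
  refine Finset.sum_congr rfl fun j _ => ?_
  conv_rhs => rw [← he.sum_repr h hn (C _)]
  rw [AlternatingMap.map_update_sum]
  refine Finset.sum_congr rfl fun β _ => ?_
  rw [V.map_update_smul, smul_eq_mul, Function.comp_update]
  rfl

omit [FiniteDimensional ℝ W] in
theorem actTerm_eq {f : (Fin n ⊕ Fin i) × Fin 2 → Fin n × Fin 2 × Fin 2}
    {j : (Fin n ⊕ Fin i) × Fin 2} (γ : Fin n × Fin 2 × Fin 2)
    (h : ∀ β, β ≠ γ → V (hbasis I J e ∘ Function.update f j β) = 0) :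
    actTerm V I J g e C f j = g (C (hbasis I J e (f j))) (hbasis I J e γ) *
      V (hbasis I J e ∘ Function.update f j γ) :=
  Finset.sum_eq_single γ (fun β _ hβ => by rw [h β hβ, mul_zero]) (by simp)

omit [FiniteDimensional ℝ W] in
theorem map_eq_zero_of_dup {f : (Fin n ⊕ Fin i) × Fin 2 → Fin n × Fin 2 × Fin 2}
    {p q : (Fin n ⊕ Fin i) × Fin 2} (hpq : p ≠ q) (hf : f p = f q) :
    V (hbasis I J e ∘ f) = 0 :=
  V.map_eq_zero_of_eq _ (by simp [hf]) hpq

omit [FiniteDimensional ℝ W] in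
theorem IsSign.update {χ : Fin n × Fin 2 × Fin 2 → ℝ} (hχ : IsSign I J V e χ)
    {j : (Fin n ⊕ Fin i) × Fin 2} {β : Fin n × Fin 2 × Fin 2}
    (hV : V (hbasis I J e ∘ Function.update (baseList hi) j β) ≠ 0) :
    χ β = χ (baseList hi j) := by
  have h := prod_update_mul χ (baseList hi) j β
  rw [hχ.prod _ hV, hχ.prod_base, one_mul, one_mul] at h
  exact h.symm

omit [FiniteDimensional ℝ W] in
theorem IsSign.update_update {χ : Fin n × Fin 2 × Fin 2 → ℝ} (hχ : IsSign I J V e χ)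
    {j p : (Fin n ⊕ Fin i) × Fin 2} (hjp : j ≠ p) {β γ : Fin n × Fin 2 × Fin 2}
    (hV : V (hbasis I J e ∘ Function.update (Function.update (baseList hi) p γ) j β) ≠ 0) :
    χ β * χ γ = χ (baseList hi j) * χ (baseList hi p) := by
  have h1 := prod_update_mul χ (baseList hi) p γ
  have h := prod_update_mul χ (Function.update (baseList hi) p γ) j β
  rw [hχ.prod _ hV, one_mul, Function.update_of_ne hjp] at h
  rw [hχ.prod_base, one_mul] at h1
  have h2 := hχ.sq (baseList hi p)
  linear_combination χ (baseList hi p) * (-h) - χ β * h1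

theorem lineSign_eq_iff {a : Fin n} {α β : Fin n × Fin 2 × Fin 2} :
    lineSign a α = lineSign a β ↔ (α.1 = a ↔ β.1 = a) := by
  unfold lineSign
  split_ifs <;> simp_all <;> norm_num

theorem typeSign_eq_iff {α β : Fin n × Fin 2 × Fin 2} :
    typeSign α = typeSign β ↔ α.2.1 = β.2.1 := by
  obtain ⟨_, t, _⟩ := α
  obtain ⟨_, s, _⟩ := β
  unfold typeSign
  fin_cases t <;> fin_cases s <;> norm_num

/-- The line and type signs force the new vector to have the line and type of the old one. Being
different, it is then the other member of the same pair, already in the list. -/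
theorem CalibLike.map_update_eq_zero (hV : CalibLike I J K g hi V) (h : QHerm I J K g)
    (hn : Module.finrank ℝ W = 4 * n) (he : IsHFrame I J K g e)
    {j : (Fin n ⊕ Fin i) × Fin 2} {β : Fin n × Fin 2 × Fin 2} (hβ : β ≠ baseList hi j) :
    V (hbasis I J e ∘ Function.update (baseList hi) j β) = 0 := by
  by_contra hne
  have h1 := lineSign_eq_iff.1 ((hV.isSign_line h hn he β.1).update hne)
  have h2 := typeSign_eq_iff.1 ((hV.isSign_type h hn he).update hne)
  obtain ⟨x, r⟩ := j
  obtain ⟨c, t, s⟩ := β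
  have h3 : baseList hi (x, s) = (c, t, s) := by
    rw [baseList_pair hi x r s, ← h2, h1.1 rfl]
  have hrs : r ≠ s := by rintro rfl; exact hβ h3.symm
  refine hne (map_eq_zero_of_dup (p := (x, r)) (q := (x, s)) (by simp [hrs]) ?_)
  rw [Function.update_self, Function.update_of_ne (by simp [hrs.symm]), h3]

/-- The trace identity coming from a list which spans a coisotropic subspace. -/
theorem CalibLike.trace_eq_zero (hV : CalibLike I J K g hi V) (h : QHerm I J K g)
    (hn : Module.finrank ℝ W = 4 * n) (he : IsHFrame I J K g e)
    (hC : ∀ w, ∑ j, V (Function.update w j (C (w j))) = 0) :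
    ∑ j, g (C (hbasis I J e (baseList hi j))) (hbasis I J e (baseList hi j)) = 0 := by
  have h1 := sum_actTerm h hn he hC (baseList hi)
  have h2 : ∀ j, actTerm V I J g e C (baseList hi) j =
      g (C (hbasis I J e (baseList hi j))) (hbasis I J e (baseList hi j)) *
        V (hbasis I J e ∘ baseList hi) := by
    intro j
    rw [actTerm_eq (baseList hi j) fun β hβ => hV.map_update_eq_zero h hn he hβ,
      Function.update_eq_self]
  simp only [h2] at h1
  rw [← Finset.sum_mul] at h1
  exact (mul_eq_zero.1 h1).resolve_right (hV.ne_zero e he)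

end Expansion

/-! ### Values on modified coisotropic lists -/

section Mixed

variable {W : Type*} [NormedAddCommGroup W] [NormedSpace ℝ W]
variable {I J K : W →L[ℝ] W} {g : W →L[ℝ] W →L[ℝ] ℝ} {n i : ℕ} {hi : i ≤ n}
  {V : W [⋀^(Fin n ⊕ Fin i) × Fin 2]→ₗ[ℝ] ℝ} {e : Fin n → W} [FiniteDimensional ℝ W]
  {C : W →ₗ[ℝ] W} {a b : Fin n}

/-- The pair of $e_b$ has been replaced by the pair of $Ie_a$ in reversed order. Apart from this
reversal, which gives the sign, and the order of the pairs, this is the base list of the frame in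
which lines `a` and `b` are exchanged through `I`. -/
theorem CalibLike.map_swapped_pair (hV : CalibLike I J K g hi V) (h : QHerm I J K g)
    (hn : Module.finrank ℝ W = 4 * n) (he : IsHFrame I J K g e) (ha : i ≤ (a : ℕ))
    (hb : (b : ℕ) < i) :
    V (hbasis I J e ∘ Function.update (Function.update (baseList hi) (Sum.inl b, 1) (a, 1, 0))
        (Sum.inl b, 0) (a, 1, 1)) = -V (hbasis I J e ∘ baseList hi) := by
  have hab : a ≠ b := by rintro rfl; omega
  have hba : b ≠ a := hab.symm
  set u : Fin n → W := fun c => if c = a then I (e b) else if c = b then I (e a) else e c with hu_def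
  have hu : IsHFrame I J K g u :=
    he.of_lines h (σ := Equiv.swap a b) (Equiv.injective _)
      (fun c => if c = a ∨ c = b then 0 else 1) (fun c => if c = a ∨ c = b then 1 else 0)
      (fun _ => 0) (fun _ => 0)
      (fun c => by
        by_cases hca : c = a
        · subst hca; simp [u]
        · by_cases hcb : c = b
          · subst hcb; simp [u, hca]
          · simp [u, hca, hcb, Equiv.swap_apply_of_ne_of_ne])
      (fun c => by split_ifs <;> simp)
  have h1 := hV.inv_frame h hn he hu (fun c => if c = a ∨ c = b then -e c else e c) e
    (fun c => by
        by_cases hca : c = a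
        · subst hca; simp [u, he.lift_I, he.lift_frame, hba, h.I_sq]
        · by_cases hcb : c = b
          · subst hcb; simp [u, hca, he.lift_I, he.lift_frame, h.I_sq]
          · simp [u, hca, hcb, he.lift_frame])
    (fun c => by
        by_cases hca : c = a ∨ c = b
        · simp [hca, he.lift_frame]
        · simp [hca, he.lift_frame])
    (fun c => he.lift_self h hn _) (baseList hi)
  let y : (Fin n ⊕ Fin i) × Fin 2 → Fin n × Fin 2 × Fin 2 := fun j =>
    if j.1 = Sum.inl b then (a, 1, j.2) else baseList hi j
  have h2 : V (hbasis I J e ∘ Function.update (Function.update (baseList hi) (Sum.inl b, 1) (a, 1, 0))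
        (Sum.inl b, 0) (a, 1, 1)) = -V (hbasis I J e ∘ y) := by
    rw [← V.map_swap _ (show ((Sum.inl b, 0) : (Fin n ⊕ Fin i) × Fin 2) ≠ (Sum.inl b, 1) by simp)]
    congr 1
    funext ⟨x, r⟩
    simp only [Function.comp_apply]
    congr 1
    by_cases hx : x = Sum.inl b
    · subst hx
      fin_cases r
      · simp [y]
      · simp [y]
    · rw [Function.update_of_ne (by simp [hx]), Function.update_of_ne (by simp [hx]),
        Equiv.swap_apply_of_ne_of_ne (by simp [hx]) (by simp [hx])]
      simp [y, hx]
  rw [h2, ← h1, neg_inj,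
    ← map_perm_pairs V (hbasis I J e ∘ y) (Equiv.swap (Sum.inl a) (Sum.inr ⟨b, hb⟩))]
  symm
  -- In the exchanged frame $I(Ie_a)=-e_a$, so one pair appears with both signs changed: a rotation
  -- by $\pi$.
  refine map_rot_pairs V _ _ (fun x => if x = Sum.inr ⟨b, hb⟩ then -1 else 1) (fun _ => 0) ?_ ?_ ?_
  · intro x; split_ifs <;> norm_num
  all_goals
    rintro (c | d)
    · by_cases hca : c = a
      · subst hca; simp [y, u, hbasis]
      · by_cases hcb : c = b
        · subst hcb
          simp [y, u, hbasis, hca, Equiv.swap_apply_of_ne_of_ne]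
        · have : (Sum.inl c : Fin n ⊕ Fin i) ≠ Sum.inl a := by simpa using hca
          simp [y, u, hbasis, hca, hcb, Equiv.swap_apply_of_ne_of_ne this]
    · by_cases hd : d = ⟨b, hb⟩
      · subst hd
        simp [y, u, hbasis, hba, hab, h.I_sq]
      · have h3 : (Sum.inr d : Fin n ⊕ Fin i) ≠ Sum.inr ⟨b, hb⟩ := by simpa using hd
        have h4 : Fin.castLE hi d ≠ a := by
          rintro rfl; simp only [Fin.val_castLE] at ha; omega
        have h5 : Fin.castLE hi d ≠ b := by
          rintro rfl; exact hd (by simp)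
        simp [y, u, hbasis, hd, h4, h5, Equiv.swap_apply_of_ne_of_ne _ h3]

theorem eq_or_of_fin_two (t : Fin 2) : t = 0 ∨ t = 1 := by omega

/-- In the list with $Je_b$ replaced by $Ie_a$ only two terms of the derivative survive: restoring
$Je_b$, or replacing $e_b$ by $JIe_a$ to complete the pair of $Ie_a$. Their values are opposite, and
the resulting relation is the claim. -/
theorem CalibLike.actForm_frame_eq_zero (hV : CalibLike I J K g hi V) (h : QHerm I J K g)
    (hn : Module.finrank ℝ W = 4 * n) (he : IsHFrame I J K g e)
    (hC : ∀ w, ∑ j, V (Function.update w j (C (w j))) = 0) (ha : i ≤ (a : ℕ))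
    (hb : (b : ℕ) < i) : actForm J g C (I (e a)) (e b) = 0 := by
  have hab : a ≠ b := by rintro rfl; omega
  have hba : b ≠ a := hab.symm
  set f := Function.update (baseList hi) (Sum.inl b, 1) (a, 1, 0) with hf
  have hsum := sum_actTerm h hn he hC f
  have hp : actTerm V I J g e C f (Sum.inl b, 1) =
      g (C (I (e a))) (J (e b)) * V (hbasis I J e ∘ baseList hi) := by
    rw [actTerm_eq (b, 0, 1)]
    · simp only [hf, Function.update_self, Function.update_idem, hbasis_10, hbasis_01]
      congr 2
      congr 1
      exact Function.update_eq_self (f := baseList hi) _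
    · intro β hβ
      rw [hf, Function.update_idem]
      exact hV.map_update_eq_zero h hn he hβ
  -- The signs of the lines `a` and `b` and of the type leave few candidates for the new vector, and
  -- each of them repeats a vector of the list.
  have hv : ∀ j β, j ≠ (Sum.inl b, 1) → (j ≠ (Sum.inl b, 0) ∨ β ≠ (a, 1, 1)) →
      V (hbasis I J e ∘ Function.update f j β) = 0 := by
    intro j β hj hjb
    by_contra hne
    have s1 := (hV.isSign_line h hn he a).update_update hj hne
    have s2 := (hV.isSign_line h hn he b).update_update hj hne
    have s3 := (hV.isSign_type h hn he).update_update hj hne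
    have hdup : ∀ q, q ≠ j → f q ≠ β := by
      intro q hq hfq
      exact hne (map_eq_zero_of_dup hq.symm (by rw [Function.update_self,
        Function.update_of_ne hq, hfq]))
    have hdup' : ∀ q, q ≠ j → q ≠ (Sum.inl b, 1) → baseList hi q ≠ β := by
      intro q hq hqb
      have := hdup q hq
      rwa [hf, Function.update_of_ne hqb] at this
    obtain ⟨x, r⟩ := j
    obtain ⟨c, t, s⟩ := β
    rcases x with c' | d
    · simp only [lineSign, typeSign, baseList_inl] at s1 s2 s3
      by_cases hc'a : c' = a
      · subst hc'a
        have hc : c = b := by by_contra hc; norm_num [hab, hba, hc] at s2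
        subst hc
        have ht : t = 1 := by
          rcases eq_or_of_fin_two t with rfl | rfl
          · norm_num at s3
          · rfl
        subst ht
        exact hdup' (Sum.inr ⟨c, hb⟩, s) (by simp) (by simp) (by simp)
      · by_cases hc'b : c' = b
        · subst hc'b
          have hc : c = a := by by_contra hc; norm_num [hab, hba, hc] at s1
          subst hc
          have ht : t = 1 := by
            rcases eq_or_of_fin_two t with rfl | rfl
            · norm_num at s3
            · rfl
          subst ht
          have hr : r = 0 := by
            rcases eq_or_of_fin_two r with rfl | rfl
            · rfl
            · exact absurd rfl hj
          subst hr
          rcases eq_or_of_fin_two s with rfl | rfl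
          · exact hdup (Sum.inl c', 1) (by simp) (by simp [hf])
          · simp at hjb
        · have hc : c = a := by by_contra hc; norm_num [hab, hba, hc, hc'a] at s1
          norm_num [hc, hab, hba, hc'b] at s2
    · have hda : Fin.castLE hi d ≠ a := by
        rintro rfl; simp only [Fin.val_castLE] at ha; omega
      simp only [lineSign, typeSign, baseList_inl, baseList_inr] at s1 s2 s3
      have hc : c = a := by by_contra hc; norm_num [hab, hba, hc, hda] at s1
      subst hc
      have ht : t = 0 := by
        rcases eq_or_of_fin_two t with rfl | rfl
        · rfl
        · norm_num at s3
      subst ht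
      exact hdup' (Sum.inl c, s) (by simp) (by simp [hab]) (by simp)
  have h0 : actTerm V I J g e C f (Sum.inl b, 0) =
      -(g (C (e b)) (J (I (e a))) * V (hbasis I J e ∘ baseList hi)) := by
    rw [actTerm_eq (a, 1, 1) fun β hβ => hv _ _ (by simp) (Or.inr hβ), hf,
      hV.map_swapped_pair h hn he ha hb, Function.update_of_ne (by simp)]
    simp
  have hrest : ∀ j, j ≠ (Sum.inl b, 0) ∧ j ≠ (Sum.inl b, 1) → actTerm V I J g e C f j = 0 := by
    rintro j ⟨hj0, hj1⟩
    exact Finset.sum_eq_zero fun β _ => by rw [hv j β hj1 (Or.inl hj0), mul_zero]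
  rw [Fintype.sum_eq_add (Sum.inl b, 0) (Sum.inl b, 1) (by simp) hrest, h0, hp] at hsum
  have hne := hV.ne_zero e he
  have h3 : (g (C (I (e a))) (J (e b)) - g (C (e b)) (J (I (e a)))) *
      V (hbasis I J e ∘ baseList hi) = 0 := by linarith
  have h4 := (mul_eq_zero.1 h3).resolve_right hne
  unfold actForm
  rw [h.g_J (C _), h.symm (J _)]
  linarith

section Values

variable (hV : CalibLike I J K g hi V) (h : QHerm I J K g)
    (hn : Module.finrank ℝ W = 4 * n) (he : IsHFrame I J K g e) (ha : i ≤ (a : ℕ))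
include hV h hn he ha

/-- The list in which `J e_a` is replaced by `I e_a`. -/
theorem CalibLike.update_type_ne {j : (Fin n ⊕ Fin i) × Fin 2} (hj : j ≠ (Sum.inl a, 1))
    {β : Fin n × Fin 2 × Fin 2}
    (hne : V (hbasis I J e ∘ Function.update (Function.update (baseList hi) (Sum.inl a, 1)
      (a, 1, 0)) j β) ≠ 0) : β.1 = (baseList hi j).1 ∧ β.2.1 ≠ (baseList hi j).2.1 := by
  have s1 := (hV.isSign_line h hn he β.1).update_update hj hne
  have s3 := (hV.isSign_type h hn he).update_update hj hne
  constructor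
  · have h2 : lineSign β.1 (a, 1, 0) = lineSign β.1 (baseList hi (Sum.inl a, 1)) := rfl
    rw [h2] at s1
    have h3 := lineSign_eq_iff.1 (mul_right_cancel₀ (fun h0 => by
      have := (hV.isSign_line h hn he β.1).sq (baseList hi (Sum.inl a, 1))
      rw [h0] at this; norm_num at this) s1)
    exact (h3.1 rfl).symm
  · intro h2
    rw [typeSign_eq_iff.2 h2] at s3
    have h4 := mul_left_cancel₀ (fun h0 => by
      have := (hV.isSign_type h hn he).sq (baseList hi j)
      rw [h0] at this; norm_num at this) s3
    norm_num [typeSign] at h4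

/-- The changed list differs from the base list only in the pairs of `a` and `b`. For `r = s` its
value is a mixed one and vanishes; otherwise the constant $-1/2$ comes from
`CalibLike.quad_relation`. -/
theorem CalibLike.map_update_type (hb : i ≤ (b : ℕ)) (hab : a ≠ b) (r s : Fin 2) :
    V (hbasis I J e ∘ Function.update (Function.update (baseList hi) (Sum.inl a, 1) (a, 1, 0))
      (Sum.inl b, r) (b, 1, s)) =
      if r = s then 0 else -(1 / 2) * V (hbasis I J e ∘ baseList hi) := by
  have hba := hab.symm
  have hup : ∀ f : Fin 4 → Fin n × Fin 2 × Fin 2,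
      f = Function.update (Function.update (baseList hi ∘ quadPos i a b) 1 (a, 1, 0))
        (if r = 0 then 2 else 3) (b, 1, s) →
      V (hbasis I J e ∘ Function.update (Function.update (baseList hi) (Sum.inl a, 1) (a, 1, 0))
      (Sum.inl b, r) (b, 1, s)) = quad hi V I J e hab (fun k => hbasis I J e (f k)) := by
    rintro f rfl
    have hq := quadPos_injective i hab
    rw [quad_eq, extend_update hq, extend_update hq, extend_comp_self hq]
    congr 3
    rcases eq_or_of_fin_two r with rfl | rfl <;> rfl
  have hF : V (hbasis I J e ∘ baseList hi) =
      quad hi V I J e hab ![e a, J (e a), e b, J (e b)] := by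
    have h1 := quad_eq (hi := hi) (V := V) (I := I) (J := J) (e := e) hab
      (baseList hi ∘ quadPos i a b)
    rw [extend_comp_self (quadPos_injective i hab)] at h1
    rw [← h1]
    congr 1
    funext k
    fin_cases k <;> simp [quadPos]
  have hrel := hV.quad_relation h hn he ha hb hab
  have hcJ := quad_change (hi := hi) (a := a) (b := b) (u := Function.update e b (J (e b)))
    (fun d hda hdb => by simp [hdb]) ha hb hab
    (hV.map_update_J h hn he b)
  have hY : ∀ z : ℝ, z = quad hi V I J e hab ![e a, I (e a), e b, I (e b)] →
      z = -(1 / 2) * V (hbasis I J e ∘ baseList hi) := by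
    rintro z rfl; rw [hF]; linarith
  rcases eq_or_of_fin_two r with rfl | rfl <;> rcases eq_or_of_fin_two s with rfl | rfl
  · rw [if_pos rfl, hup ![(a, 0, 0), (a, 1, 0), (b, 1, 0), (b, 0, 1)]
      (by funext k; fin_cases k <;> simp [quadPos])]
    have := hcJ (a, 0, 0) (a, 1, 0) (b, 0, 0) (b, 1, 1)
    simp only [hbasis_00, hbasis_10, hbasis_11, ne_eq, hab, not_false_eq_true,
      Function.update_of_ne, Function.update_self, h.I_J, h.J_K,
      hV.quad_mixed_eq_zero h hn he ha hb hab] at this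
    rw [quad_swap23, neg_eq_zero] at this
    rw [← this]
    congr 1
    funext k
    fin_cases k <;> simp
  · rw [if_neg (by simp), hup ![(a, 0, 0), (a, 1, 0), (b, 1, 1), (b, 0, 1)]
      (by funext k; fin_cases k <;> simp [quadPos])]
    refine hY _ ?_
    have := hcJ (a, 0, 0) (a, 1, 0) (b, 0, 0) (b, 1, 0)
    simp only [hbasis_00, hbasis_10, ne_eq, hab, not_false_eq_true,
      Function.update_of_ne, Function.update_self, h.I_J] at this
    rw [← this, quad_swap23, ← quad_neg2, ← h.J_I]
    congr 1
    funext k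
    fin_cases k <;> simp
  · rw [if_neg (by simp), hup ![(a, 0, 0), (a, 1, 0), (b, 0, 0), (b, 1, 0)]
      (by funext k; fin_cases k <;> simp [quadPos])]
    refine hY _ ?_
    congr 1
    funext k
    fin_cases k <;> simp
  · rw [if_pos rfl, hup ![(a, 0, 0), (a, 1, 0), (b, 0, 0), (b, 1, 1)]
      (by funext k; fin_cases k <;> simp [quadPos]),
      ← hV.quad_mixed_eq_zero h hn he ha hb hab]
    congr 1
    funext k
    fin_cases k <;> simp

/-- This is the base list of the frame with $e_a$ replaced by $Ie_a$, two entries being transposed.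
-/
theorem CalibLike.map_update_pair_I :
    V (hbasis I J e ∘ Function.update (Function.update (baseList hi) (Sum.inl a, 1) (a, 1, 0))
      (Sum.inl a, 0) (a, 1, 1)) = -V (hbasis I J e ∘ baseList hi) := by
  rw [← hV.map_update_I h hn he a (baseList hi),
    ← V.map_swap _ (show ((Sum.inl a, 0) : (Fin n ⊕ Fin i) × Fin 2) ≠ (Sum.inl a, 1) by simp)]
  congr 1
  funext ⟨x, r⟩
  by_cases hx : x = Sum.inl a
  · subst hx
    rcases eq_or_of_fin_two r with rfl | rfl
    · simp
    · simp
  · have h1 := baseList_fst_ne (hi := hi) ha (j := (x, r)) hx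
    simp only [Function.comp_apply]
    rw [Equiv.swap_apply_of_ne_of_ne (by simp [hx]) (by simp [hx]),
      Function.update_of_ne (by simp [hx]), Function.update_of_ne (by simp [hx])]
    simp [hbasis, h1]

end Values

end Mixed

/-! ### Annihilators of the calibration form act trivially on $\omega_J$ -/

section Annihilate

variable {W : Type*} [NormedAddCommGroup W] [NormedSpace ℝ W]

/-- Two vectors span orthogonal quaternionic lines. -/
structure HOrth (I J K : W →L[ℝ] W) (g : W →L[ℝ] W →L[ℝ] ℝ) (u w : W) : Prop where
  one : g u w = 0
  I : g u (I w) = 0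
  J : g u (J w) = 0
  K : g u (K w) = 0

variable {I J K : W →L[ℝ] W} {g : W →L[ℝ] W →L[ℝ] ℝ} {n i : ℕ} {hi : i ≤ n}
  {V : W [⋀^(Fin n ⊕ Fin i) × Fin 2]→ₗ[ℝ] ℝ} {e : Fin n → W} [FiniteDimensional ℝ W]
  {C : W →ₗ[ℝ] W} {a b : Fin n}

omit [FiniteDimensional ℝ W] in
theorem HOrth.symm {u w : W} (huw : HOrth I J K g u w) (h : QHerm I J K g) :
    HOrth I J K g w u :=
  ⟨by rw [h.symm, huw.one], by rw [h.symm, h.g_I, huw.I, neg_zero],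
    by rw [h.symm, h.g_J, huw.J, neg_zero], by rw [h.symm, h.g_K, huw.K, neg_zero]⟩

omit [FiniteDimensional ℝ W] in
theorem HOrth.smul {u w : W} (huw : HOrth I J K g u w) (s t : ℝ) :
    HOrth I J K g (s • u) (t • w) := by
  constructor <;> simp [huw.one, huw.I, huw.J, huw.K]

omit [FiniteDimensional ℝ W] in
theorem IsHFrame.hOrth (he : IsHFrame I J K g e) (h : QHerm I J K g)
    {α β : Fin n × Fin 2 × Fin 2} (hαβ : α.1 ≠ β.1) :
    HOrth I J K g (hbasis I J e α) (hbasis I J e β) := by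
  obtain ⟨a, t, r⟩ := α
  obtain ⟨b, s, p⟩ := β
  simp only at hαβ
  rcases eq_or_of_fin_two t with rfl | rfl <;> rcases eq_or_of_fin_two r with rfl | rfl <;>
  rcases eq_or_of_fin_two s with rfl | rfl <;> rcases eq_or_of_fin_two p with rfl | rfl <;>
  constructor <;>
  simp [h.g_I, h.g_J, h.g_K, h.I_sq, h.J_sq, h.K_sq, h.I_J, h.J_I, h.I_K, h.J_K, h.K_I, h.K_J,
        he.one, he.I, he.J, he.K, hαβ]

section Values

variable (hV : CalibLike I J K g hi V) (h : QHerm I J K g)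
    (hn : Module.finrank ℝ W = 4 * n)
    (hC : ∀ w, ∑ j, V (Function.update w j (C (w j))) = 0)
include hV h hn hC

/-- After normalization the two vectors become $Ie_a$ and $e_b$ for a frame with $a=i$ and $b=0$;
these indices exist exactly because $0<i<n$. -/
theorem CalibLike.actForm_eq_zero_of_hOrth (hi0 : 0 < i) (hin : i < n) {u w : W}
    (huw : HOrth I J K g u w) : actForm J g C u w = 0 := by
  by_cases hu0 : u = 0
  · simp [hu0, actForm]
  by_cases hw0 : w = 0
  · simp [hw0, actForm]
  have hu := h.normalize hu0
  have hw := h.normalize hw0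
  set s := (Real.sqrt (g u u))⁻¹ with hs_def
  set t := (Real.sqrt (g w w))⁻¹ with ht_def
  have hs : s ≠ 0 := by intro h0; rw [h0] at hu; simp at hu
  have ht : t ≠ 0 := by intro h0; rw [h0] at hw; simp at hw
  have huw' := huw.smul s t
  -- The choice $e_a=-I(su)$ makes $Ie_a=su$.
  obtain ⟨e, he, hea, heb⟩ := IsHFrame.exists_pair h hn (u := -I (s • u)) (w := t • w)
    (by rw [map_neg, map_neg, neg_apply, neg_neg, h.inv_I, hu]) hw
    (by rw [map_neg, neg_apply, h.g_I, huw'.I]; simp)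
    (by rw [map_neg, neg_apply, h.g_I, h.I_sq, map_neg, huw'.one]; simp)
    (by rw [map_neg, neg_apply, h.g_I, h.I_J, huw'.K]; simp)
    (by rw [map_neg, neg_apply, h.g_I, h.I_K, map_neg, huw'.J]; simp)
    (a := ⟨i, hin⟩) (b := ⟨0, by omega⟩) (by simp [Fin.ext_iff]; omega)
  have := hV.actForm_frame_eq_zero h hn he hC (a := ⟨i, hin⟩) (b := ⟨0, by omega⟩) le_rfl hi0
  rw [hea, heb, map_neg, h.I_sq, neg_neg] at this
  unfold actForm at this ⊢
  simp only [map_smul, smul_apply, smul_eq_mul] at this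
  have h2 : (s * t) * (g (J (C u)) w + g (J u) (C w)) = 0 := by linarith
  exact (mul_eq_zero.1 h2).resolve_left (mul_ne_zero hs ht)

/-- The values of the form on a complex line do not depend on the line. -/
theorem CalibLike.actForm_polarize (hi0 : 0 < i) (hin : i < n) {u v : W} (huv : HOrth I J K g u v)
    (hg : g u u = g v v) :
    actForm J g C u (I u) = actForm J g C v (I v) ∧
    actForm J g C u (J u) = actForm J g C v (J v) ∧
    actForm J g C u (K u) = actForm J g C v (K v) := by
  have hvu := huv.symm h
  -- Equal norms make $u+v$ and $q(u-v)$ span orthogonal quaternionic lines. Expanding the resulting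
  -- zero, the cross terms also vanish and the two diagonal terms must agree.
  have key : ∀ q : W →L[ℝ] W, HOrth I J K g (u + v) (q (u - v)) → HOrth I J K g u (q v) →
      HOrth I J K g v (q u) → actForm J g C u (q u) = actForm J g C v (q v) := by
    intro q h1 h2 h3
    have e1 := hV.actForm_eq_zero_of_hOrth h hn hC hi0 hin h1
    have e2 := hV.actForm_eq_zero_of_hOrth h hn hC hi0 hin h2
    have e3 := hV.actForm_eq_zero_of_hOrth h hn hC hi0 hin h3
    unfold actForm at *
    simp only [map_add, map_sub, add_apply] at e1
    linarith
  refine ⟨key I ?_ ?_ ?_, key J ?_ ?_ ?_, key K ?_ ?_ ?_⟩ <;> constructor <;>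
  simp [h.I_sq, h.J_sq, h.K_sq, h.I_J, h.J_I, h.I_K, h.J_K, h.K_I, h.K_J, huv.one, huv.I, huv.J,
    huv.K, hvu.one, hvu.I, hvu.J, hvu.K, hg, h.g_self_I, h.g_self_J, h.g_self_K]

/-- Polarization compares different lines; two vectors on one line are compared through a third
vector on another line, which exists since $n\ge2$. -/
theorem CalibLike.actForm_line_const (hi0 : 0 < i) (hin : i < n) (he : IsHFrame I J K g e)
    (α β : Fin n × Fin 2 × Fin 2) :
    actForm J g C (hbasis I J e α) (I (hbasis I J e α)) =
      actForm J g C (hbasis I J e β) (I (hbasis I J e β)) ∧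
    actForm J g C (hbasis I J e α) (J (hbasis I J e α)) =
      actForm J g C (hbasis I J e β) (J (hbasis I J e β)) ∧
    actForm J g C (hbasis I J e α) (K (hbasis I J e α)) =
      actForm J g C (hbasis I J e β) (K (hbasis I J e β)) := by
  have key : ∀ α β : Fin n × Fin 2 × Fin 2, α.1 ≠ β.1 → _ := fun α β hαβ =>
    hV.actForm_polarize h hn hC hi0 hin (he.hOrth h hαβ)
      (by rw [he.orthonormal h, he.orthonormal h, if_pos rfl, if_pos rfl])
  by_cases hαβ : α.1 = β.1
  · obtain ⟨c, hc⟩ : ∃ c : Fin n, c ≠ α.1 := by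
      haveI : Nontrivial (Fin n) := Fin.nontrivial_iff_two_le.2 (by omega)
      exact exists_ne _
    have h1 := key α (c, 0, 0) hc.symm
    have h2 := key (c, 0, 0) β (by rw [← hαβ]; exact hc)
    exact ⟨h1.1.trans h2.1, h1.2.1.trans h2.2.1, h1.2.2.trans h2.2.2⟩
  · exact key α β hαβ

/-- The trace of $C$ over one pair $u,Ju$ is the value of the derived form on $(u,Ju)$. This value
is common to all $n+i$ pairs of the list, whose total trace vanishes. -/
theorem CalibLike.actForm_J_eq_zero (hi0 : 0 < i) (hin : i < n) (he : IsHFrame I J K g e)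
    (a : Fin n) : actForm J g C (e a) (J (e a)) = 0 := by
  have h1 := hV.trace_eq_zero h hn he hC
  rw [Fintype.sum_prod_type] at h1
  have h2 : ∀ x, ∑ r, g (C (hbasis I J e (baseList hi (x, r)))) (hbasis I J e (baseList hi (x, r))) =
      actForm J g C (e a) (J (e a)) := by
    intro x
    rw [Fin.sum_univ_two]
    have h3 := (hV.actForm_line_const h hn hC hi0 hin he (a, 0, 0) (baseList hi (x, 0))).2.1
    rw [hbasis_00] at h3
    rw [h3]
    have h4 : hbasis I J e (baseList hi (x, 1)) = J (hbasis I J e (baseList hi (x, 0))) := by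
      rcases x with x | x <;> simp
    rw [h4]
    unfold actForm
    rw [h.inv_J, h.symm (J _), h.symm (C (J _)), h.symm (J _)]
  simp only [h2, Finset.sum_const, Finset.card_univ, nsmul_eq_mul] at h1
  refine (mul_eq_zero.1 h1).resolve_left ?_
  rw [Fintype.card_sum, Fintype.card_fin, Fintype.card_fin]
  exact Nat.cast_ne_zero.2 (by omega)

/-- This is $C\cdot V=0$ on the list with $Je_a$ replaced by $Ie_a$. A surviving term either repairs
the pair of `a` or changes the type of one vector in the pair of some `b` with $b\ge i$; on lines
below `i` such a change repeats a vector. -/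
theorem CalibLike.sum_actTerm_type (he : IsHFrame I J K g e) (ha : i ≤ (a : ℕ)) :
    ∑ b, (if b = a then actForm J g C (e a) (I (e a)) else if (b : ℕ) < i then 0 else
      -(1 / 2) * (g (C (e b)) (J (I (e b))) + g (C (J (e b))) (I (e b)))) = 0 := by
  set f := Function.update (baseList hi) (Sum.inl a, 1) (a, 1, 0) with hf
  have hsum := sum_actTerm h hn he hC f
  have hne := hV.ne_zero e he
  have hfj : ∀ j, j ≠ (Sum.inl a, 1) → f j = baseList hi j := fun j hj => by
    rw [hf, Function.update_of_ne hj]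
  have hdup : ∀ j β q, q ≠ j → f q = β → V (hbasis I J e ∘ Function.update f j β) = 0 := by
    intro j β q hq hfq
    exact map_eq_zero_of_dup hq.symm (by rw [Function.update_self, Function.update_of_ne hq, hfq])
  have hv : ∀ j β, j ≠ (Sum.inl a, 1) → V (hbasis I J e ∘ Function.update f j β) ≠ 0 →
      β.1 = (baseList hi j).1 ∧ β.2.1 ≠ (baseList hi j).2.1 :=
    fun j β hj hne => hV.update_type_ne h hn he ha hj hne
  have hinr : ∀ d r, actTerm V I J g e C f (Sum.inr d, r) = 0 := by
    intro d r
    refine Finset.sum_eq_zero fun β _ => ?_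
    by_cases h0 : V (hbasis I J e ∘ Function.update f (Sum.inr d, r) β) = 0
    · rw [h0, mul_zero]
    obtain ⟨h1, h2⟩ := hv _ _ (by simp) h0
    exfalso
    obtain ⟨c, t, s⟩ := β
    simp only [baseList_inr] at h1 h2
    subst h1
    have ht : t = 0 := (eq_or_of_fin_two t).resolve_right h2
    subst ht
    have hda : Fin.castLE hi d ≠ a := by
      rintro rfl; simp only [Fin.val_castLE] at ha; omega
    exact h0 (hdup _ _ (Sum.inl (Fin.castLE hi d), s) (by simp)
      (by rw [hfj _ (by simp [hda]), baseList_inl]))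
  have hlow : ∀ (b : Fin n) r, (b : ℕ) < i → actTerm V I J g e C f (Sum.inl b, r) = 0 := by
    intro b r hb
    have hba : b ≠ a := by rintro rfl; omega
    refine Finset.sum_eq_zero fun β _ => ?_
    by_cases h0 : V (hbasis I J e ∘ Function.update f (Sum.inl b, r) β) = 0
    · rw [h0, mul_zero]
    obtain ⟨h1, h2⟩ := hv _ _ (by simp [hba]) h0
    exfalso
    obtain ⟨c, t, s⟩ := β
    simp only [baseList_inl] at h1 h2
    subst h1
    have ht : t = 1 := (eq_or_of_fin_two t).resolve_left h2
    subst ht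
    exact h0 (hdup _ _ (Sum.inr ⟨c, hb⟩, s) (by simp) (by rw [hfj _ (by simp)]; simp))
  have hhigh : ∀ (b : Fin n), i ≤ (b : ℕ) → b ≠ a → ∀ r s : Fin 2, r ≠ s →
      actTerm V I J g e C f (Sum.inl b, r) = g (C (hbasis I J e (b, 0, r))) (hbasis I J e (b, 1, s)) *
        (-(1 / 2) * V (hbasis I J e ∘ baseList hi)) := by
    intro b hb hba r s hrs
    rw [actTerm_eq (b, 1, s), hfj _ (by simp [hba]), hf,
      hV.map_update_type h hn he ha hb hba.symm, if_neg hrs, baseList_inl]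
    intro β hβ
    by_contra h0
    obtain ⟨h1, h2⟩ := hv _ _ (by simp [hba]) h0
    obtain ⟨c, t, p⟩ := β
    simp only [baseList_inl] at h1 h2
    subst h1
    have ht : t = 1 := (eq_or_of_fin_two t).resolve_left h2
    subst ht
    have hp : r = p := by
      by_contra hrp
      apply hβ
      simp only [Prod.mk.injEq, true_and]
      omega
    rw [← hp, hf, hV.map_update_type h hn he ha hb hba.symm, if_pos rfl] at h0
    exact h0 rfl
  have ha1 : actTerm V I J g e C f (Sum.inl a, 1) =
      g (C (I (e a))) (J (e a)) * V (hbasis I J e ∘ baseList hi) := by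
    rw [actTerm_eq (a, 0, 1)]
    · simp only [hf, Function.update_self, Function.update_idem, hbasis_10, hbasis_01]
      congr 2
      congr 1
      exact Function.update_eq_self (f := baseList hi) _
    · intro β hβ
      rw [hf, Function.update_idem]
      exact hV.map_update_eq_zero h hn he hβ
  have ha0 : actTerm V I J g e C f (Sum.inl a, 0) =
      -(g (C (e a)) (J (I (e a))) * V (hbasis I J e ∘ baseList hi)) := by
    rw [actTerm_eq (a, 1, 1), hf, hV.map_update_pair_I h hn he ha, Function.update_of_ne (by simp)]
    · simp
    intro β hβ
    by_contra h0
    obtain ⟨h1, h2⟩ := hv _ _ (by simp) h0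
    obtain ⟨c, t, p⟩ := β
    simp only [baseList_inl] at h1 h2
    subst h1
    have ht : t = 1 := (eq_or_of_fin_two t).resolve_left h2
    subst ht
    rcases eq_or_of_fin_two p with rfl | rfl
    · exact h0 (hdup _ _ (Sum.inl c, 1) (by simp) (by simp [hf]))
    · exact hβ rfl
  rw [Fintype.sum_prod_type, Fintype.sum_sum_type] at hsum
  simp only [Fin.sum_univ_two, hinr, add_zero, Finset.sum_const_zero] at hsum
  refine mul_right_cancel₀ hne ?_
  rw [zero_mul, Finset.sum_mul]
  refine Eq.trans ?_ hsum
  refine Finset.sum_congr rfl fun b _ => ?_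
  by_cases hba : b = a
  · subst hba
    rw [if_pos rfl, ha0, ha1]
    unfold actForm
    rw [h.g_J (C _), h.symm (J _)]
    ring
  · rw [if_neg hba]
    by_cases hb : (b : ℕ) < i
    · rw [if_pos hb, hlow b 0 hb, hlow b 1 hb]; ring
    · rw [if_neg hb, hhigh b (not_lt.1 hb) hba 0 1 (by simp),
        hhigh b (not_lt.1 hb) hba 1 0 (by simp)]
      simp only [hbasis_00, hbasis_01, hbasis_10, hbasis_11]
      ring

/-- The relation of `CalibLike.sum_actTerm_type` for one frame contains half of what is needed to
form `actForm` on the lines other than `a`. Averaging over two frames supplies the rest and leaves a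
positive multiple of the common value. -/
theorem CalibLike.actForm_I_eq_zero (hi0 : 0 < i) (hin : i < n) (he : IsHFrame I J K g e)
    (b : Fin n) : actForm J g C (e b) (I (e b)) = 0 := by
  set a : Fin n := ⟨i, hin⟩ with ha
  set l := actForm J g C (e b) (I (e b)) with hl
  have hconst : ∀ β, actForm J g C (hbasis I J e β) (I (hbasis I J e β)) = l := fun β => by
    have := (hV.actForm_line_const h hn hC hi0 hin he β (b, 0, 0)).1
    rwa [hbasis_00] at this
  -- Multiplying every other line by `I` supplies the missing terms; $e_a$ is kept, so its term is
  -- counted twice.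
  set u : Fin n → W := fun c => if c = a then e c else I (e c) with hu_def
  have hu : IsHFrame I J K g u :=
    he.of_lines h (σ := id) Function.injective_id (fun c => if c = a then 1 else 0)
      (fun c => if c = a then 0 else 1) (fun _ => 0) (fun _ => 0)
      (fun c => by by_cases hc : c = a <;> simp [u, hc]) (fun c => by split_ifs <;> simp)
  have h1 := hV.sum_actTerm_type h hn hC he (a := a) le_rfl
  have h2 := hV.sum_actTerm_type h hn hC hu (a := a) le_rfl
  have h3 : ∑ c : Fin n, ((if c = a then 2 else if (c : ℕ) < i then 0 else 1 : ℝ) * l) = 0 := by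
    refine Eq.trans ?_ ((congrArg₂ (· + ·) h1 h2).trans (add_zero (0 : ℝ)))
    rw [← Finset.sum_add_distrib]
    refine Finset.sum_congr rfl fun c _ => ?_
    by_cases hca : c = a
    · have := hconst (a, 0, 0)
      rw [hbasis_00] at this
      simp only [hca, if_true, u, this]
      ring
    · by_cases hci : (c : ℕ) < i
      · simp [hca, hci]
      · have e1 := hconst (c, 0, 0)
        have e2 := hconst (c, 0, 1)
        rw [hbasis_00] at e1
        rw [hbasis_01] at e2
        simp only [hca, hci, if_false, u]
        unfold actForm at e1 e2
        rw [h.g_J (C _), h.symm (J _)] at e1 e2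
        simp only [h.I_sq, h.J_sq, h.I_J, h.J_I, h.J_K, map_neg, neg_apply] at e1 e2 ⊢
        linarith
  rw [← Finset.sum_mul] at h3
  refine (mul_eq_zero.1 h3).resolve_left (ne_of_gt ?_)
  refine Finset.sum_pos' (fun c _ => by split_ifs <;> norm_num) ⟨a, Finset.mem_univ _, by simp⟩

end Values

end Annihilate

/-! ### Symmetry between $I$ and $K$, and the full annihilation statement -/

section Turn

variable {W : Type*} [NormedAddCommGroup W] [NormedSpace ℝ W]
variable {I J K : W →L[ℝ] W} {g : W →L[ℝ] W →L[ℝ] ℝ} {n i : ℕ} {hi : i ≤ n}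
  {V : W [⋀^(Fin n ⊕ Fin i) × Fin 2]→ₗ[ℝ] ℝ} {e : Fin n → W} {C : W →ₗ[ℝ] W}

/-- The quaternionic structure with `I`, `J`, `K` replaced by `K`, `J`, `-I`. -/
theorem QHerm.turn (h : QHerm I J K g) : QHerm K J (-I) g where
  I_sq := h.K_sq
  J_sq := h.J_sq
  K_sq v := by simp [h.I_sq]
  I_J v := by simp [h.K_J]
  J_I v := by simp [h.J_K]
  symm := h.symm
  inv_I := h.inv_K
  inv_J := h.inv_J
  inv_K v w := by simp [h.inv_I]
  pos := h.pos

/-- The properties are symmetric under this change: $Ke_d=-JIe_d$, so the base lists of the two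
structures differ by quarter turns of pairs, and maps commuting with `K` and `J` are those commuting
with `I` and `J`. -/
theorem CalibLike.turn (hV : CalibLike I J K g hi V) (h : QHerm I J K g) :
    CalibLike K J (-I) g hi V where
  ne_zero e he := by
    have he' : IsHFrame I J K g e := ⟨he.one, fun a b => by simpa using he.K a b, he.J, he.I⟩
    have : V (hbasis K J e ∘ baseList hi) = V (hbasis I J e ∘ baseList hi) := by
      refine map_rot_pairs V _ _ (Sum.elim (fun _ => 1) fun _ => 0)
        (Sum.elim (fun _ => 0) fun _ => -1) ?_ ?_ ?_
      · rintro (c | d) <;> simp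
      · rintro (c | d)
        · simp
        · simp [h.J_I]
      · rintro (c | d)
        · simp
        · simp [h.J_K]
    rw [this]
    exact hV.ne_zero e he'
  inv P hK hJ := hV.inv P (fun v => by rw [← h.J_K, hJ, hK, h.J_K]) hJ
  rotate := hV.rotate
  line e he b v hv := by
    have he' : IsHFrame I J K g e := ⟨he.one, fun a b => by simpa using he.K a b, he.J, he.I⟩
    refine hV.line e he' b v fun j t r => ?_
    have h0 := hv j 0
    have h1 := hv j 1
    rcases eq_or_of_fin_two t with rfl | rfl
    · have := h0 r
      rcases eq_or_of_fin_two r with rfl | rfl <;> simpa using this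
    · rcases eq_or_of_fin_two r with rfl | rfl
      · simpa [h.J_K] using h1 1
      · simpa [h.J_I] using h1 0

/-- An endomorphism annihilating `V` annihilates the form `g (J ·, ·)`. -/
theorem CalibLike.actForm_eq_zero [FiniteDimensional ℝ W] (hV : CalibLike I J K g hi V)
    (h : QHerm I J K g) (hn : Module.finrank ℝ W = 4 * n)
    (hC : ∀ w, ∑ j, V (Function.update w j (C (w j))) = 0) (hi0 : 0 < i) (hin : i < n)
    (u w : W) : actForm J g C u w = 0 := by
  by_cases hu0 : u = 0
  · simp [hu0, actForm]
  have hw : IsHFrame I J K g (fun _ : Fin 1 => (Real.sqrt (g u u))⁻¹ • u) :=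
    ⟨fun a b => by rw [h.normalize hu0]; simp [Subsingleton.elim a b], fun _ _ => h.g_self_I _,
      fun _ _ => h.g_self_J _, fun _ _ => h.g_self_K _⟩
  obtain ⟨e, he, hee⟩ := hw.exists_extend h hn (by omega)
  set a : Fin n := Fin.castLE (by omega) (0 : Fin 1)
  have hea : e a = (Real.sqrt (g u u))⁻¹ • u := hee 0
  have hu : u = Real.sqrt (g u u) • e a := by
    rw [hea, smul_smul, mul_inv_cancel₀ (Real.sqrt_ne_zero'.2 (h.pos u hu0)), one_smul]
  have key : ∀ α, actForm J g C (e a) (hbasis I J e α) = 0 := by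
    rintro ⟨b, t, r⟩
    by_cases hab : a = b
    · subst hab
      rcases eq_or_of_fin_two t with rfl | rfl <;> rcases eq_or_of_fin_two r with rfl | rfl
      · rw [hbasis_00]
        have := actForm_swap h C (e a) (e a)
        linarith
      · rw [hbasis_01]
        exact hV.actForm_J_eq_zero h hn hC hi0 hin he a
      · rw [hbasis_10]
        exact hV.actForm_I_eq_zero h hn hC hi0 hin he a
      · rw [hbasis_11, h.J_I]
        -- The value on $(u,Ku)$ is the one on $(u,Iu)$ for the turned structure.
        have he' : IsHFrame K J (-I) g e := ⟨he.one, he.K, he.J, fun a b => by simp [he.I a b]⟩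
        have := (hV.turn h).actForm_I_eq_zero h.turn hn hC hi0 hin he' a
        unfold actForm at this ⊢
        simp only [map_neg]
        linarith
    · have := hV.actForm_eq_zero_of_hOrth h hn hC hi0 hin
        (he.hOrth h (α := (a, 0, 0)) (β := (b, t, r)) hab)
      rwa [hbasis_00] at this
  have h2 : actForm J g C (e a) w = 0 := by
    have h3 : actForm J g C (e a) w =
        ∑ α, g w (hbasis I J e α) * actForm J g C (e a) (hbasis I J e α) := by
      conv_lhs => rw [← he.sum_repr h hn w]
      unfold actForm
      simp only [map_sum, map_smul, smul_eq_mul, mul_add, Finset.sum_add_distrib]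
    rw [h3]
    exact Finset.sum_eq_zero fun α _ => by rw [key, mul_zero]
  rw [hu]
  unfold actForm at h2 ⊢
  simp only [map_smul, smul_apply, smul_eq_mul]
  rw [← mul_add, h2, mul_zero]

end Turn

/-! ### Linear algebra of the HKT condition -/

section TorsionAlgebra

variable {W : Type*} [NormedAddCommGroup W] [NormedSpace ℝ W]

/-- The value of the exterior derivative of `g (L ·, ·)` in terms of the covariant derivatives
`N u v` of the vectors of a unitary frame. -/
def frameD (g : W →L[ℝ] W →L[ℝ] ℝ) (L : W →L[ℝ] W) (N : W →ₗ[ℝ] W →ₗ[ℝ] W) (u v w : W) : ℝ :=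
  -((g (L (N u v)) w + g (L v) (N u w)) + (g (L (N v w)) u + g (L w) (N v u)) +
    (g (L (N w u)) v + g (L u) (N w v)))

variable {I J K : W →L[ℝ] W} {g : W →L[ℝ] W →L[ℝ] ℝ} {n : ℕ} [FiniteDimensional ℝ W]

omit [FiniteDimensional ℝ W] in
/-- The identity `∂Ω = 0`, written in terms of the covariant derivative of the metric. -/
theorem frameD_identity (h : QHerm I J K g) {N : W →ₗ[ℝ] W →ₗ[ℝ] W}
    (hI : ∀ u v, N u (I v) = I (N u v)) (hJ : ∀ u v, N u (J v) = J (N u v))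
    (h30 : ∀ u v w, frameD g J N u v w - (frameD g J N (I u) (I v) w + frameD g J N (I u) v (I w) +
      frameD g J N u (I v) (I w)) + (frameD g K N (I u) v w + frameD g K N u (I v) w +
      frameD g K N u v (I w)) - frameD g K N (I u) (I v) (I w) = 0) :
    ∃ s : W → W → W → ℝ, (∀ u v w, s u v w = -(g (N u (J v)) w + g (J v) (N u w))) ∧
      (∀ u v w, s u w v = -s u v w) ∧ (∀ u v w, s u (I v) w = s u v (I w)) ∧
      (∀ u v w, s u (I v) (I w) = -s u v w) ∧ (∀ u v w, s (I (I u)) v w = -s u v w) ∧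
      (∀ u v w, frameD g J N u v w = s u v w + s v w u + s w u v) ∧
      (∀ u v w, s u v w + s v w u + s w u v =
        s (I u) (I v) w + s (I v) (I w) u + s (I w) (I u) v) := by
  -- This is the covariant derivative of $\omega_J$ along $u$ on $(v,w)$: the form is constant in
  -- the frame, and `N` commutes with `J`.
  set s : W → W → W → ℝ := fun u v w => -(g (N u (J v)) w + g (J v) (N u w)) with hs_def
  have hs : ∀ u v w, s u v w = -(g (N u (J v)) w + g (J v) (N u w)) := fun _ _ _ => rfl
  have hK : ∀ u v, N u (K v) = K (N u v) := fun u v => by rw [← h.I_J, ← h.I_J, hI, hJ]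
  have h1 : ∀ u v w, s u w v = -s u v w := by
    intro u v w
    rw [hs, hs, hJ, hJ, h.g_J, h.symm (J v), h.g_J w, h.symm (J _), h.symm w]
    ring
  have h2 : ∀ u v w, s u (I v) w = s u v (I w) := by
    intro u v w
    have hJI : J (I v) = -I (J v) := by rw [h.J_I, h.I_J]
    simp only [hs, hJI, map_neg, neg_apply, hI, h.g_I, neg_neg]
  have h3 : ∀ u v w, s u (I v) (I w) = -s u v w := by
    intro u v w
    rw [h2, h.I_sq]
    simp only [hs, map_neg]
    ring
  have h4 : ∀ u v w, s (I (I u)) v w = -s u v w := by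
    intro u v w
    rw [h.I_sq]
    simp only [hs, map_neg, LinearMap.neg_apply, neg_apply]
    ring
  have hα : ∀ u v w, frameD g J N u v w = s u v w + s v w u + s w u v := by
    intro u v w
    simp only [hs, frameD, hJ]
    ring
  have hβ : ∀ u v w, frameD g K N u v w = -(s u (I v) w + s v (I w) u + s w (I u) v) := by
    intro u v w
    simp only [hs, frameD, h.J_I, map_neg, hK, neg_apply]
    ring
  refine ⟨s, hs, h1, h2, h3, h4, hα, fun u v w => ?_⟩
  have h5 := h30 u v w
  simp only [hα, hβ, h4, h3, h.I_sq] at h5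
  have h6 : ∀ u v w, s u (-v) w = -s u v w := by
    intro u v w; simp only [hs, map_neg, neg_apply]; ring
  have h7 : ∀ u v w, s u v (-w) = -s u v w := by
    intro u v w; simp only [hs, map_neg]; ring
  simp only [h6, h7, ← h2, h.I_sq] at h5
  linarith

/-- Here `N` stands for the Obata connection and `C` for the connection preserving $V$. Their
difference is symmetric, so both compute $d\omega_J$, and `C` gives $-\kappa\wedge\omega_J$. -/
theorem eq_zero_of_frameD (h : QHerm I J K g) (hn : Module.finrank ℝ W = 4 * n) (hn2 : 2 ≤ n)
    {e : Fin n → W} (he : IsHFrame I J K g e) {N C : W →ₗ[ℝ] W →ₗ[ℝ] W} {κ : W →ₗ[ℝ] ℝ}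
    (hI : ∀ u v, N u (I v) = I (N u v)) (hJ : ∀ u v, N u (J v) = J (N u v))
    (hsymm : ∀ u v, C u v - C v u = N u v - N v u)
    (hκ : ∀ u v w, g (J (C u v)) w + g (J v) (C u w) = κ u * g (J v) w)
    (h30 : ∀ u v w, frameD g J N u v w - (frameD g J N (I u) (I v) w + frameD g J N (I u) v (I w) +
      frameD g J N u (I v) (I w)) + (frameD g K N (I u) v w + frameD g K N u (I v) w +
      frameD g K N u v (I w)) - frameD g K N (I u) (I v) (I w) = 0) (u v w : W) :
    g (N u v) w + g v (N u w) = 0 := by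
  obtain ⟨s, hs, h1, h2, h3, h4, hα, hρ⟩ := frameD_identity h hI hJ h30
  have hκρ : ∀ u v w, s u v w + s v w u + s w u v =
      -(κ u * g (J v) w + κ v * g (J w) u + κ w * g (J u) v) := by
    intro u v w
    have hx : ∀ x y, g (J x) y = -g (J y) x := fun x y => by rw [h.g_J, h.symm]
    have key : ∀ u v w, g (J (C u v)) w - g (J (C v u)) w =
        g (J (N u v)) w - g (J (N v u)) w := by
      intro u v w
      simpa only [map_sub, sub_apply] using congrArg (fun x => g (J x) w) (hsymm u v)
    have k1 := key u v w
    have k2 := key v w u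
    have k3 := key w u v
    rw [← hκ, ← hκ, ← hκ, hs, hs, hs, hJ, hJ, hJ, hx v, hx v, hx w, hx w, hx u, hx u]
    linarith
  -- With $\alpha=-\kappa\wedge\omega_J$, the absence of a $(3,0)+(0,3)$-part says that $\alpha$ is
  -- the sum of its values with `I` applied to two arguments. On $(u,v,Jv)$ one side is $-\kappa(u)$
  -- and the other $\kappa(u)$.
  have hκ0 : ∀ u v, HOrth I J K g u v → g v v = 1 → κ u = 0 := by
    intro u v huv hv
    have hvu := huv.symm h
    have hρ' : s u v (J v) + s v (J v) u + s (J v) u v =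
      (s (I u) (I v) (J v) + s (I v) (J v) (I u) + s (J v) (I u) (I v)) +
      (s (I u) v (I (J v)) + s v (I (J v)) (I u) + s (I (J v)) (I u) v) +
      (s u (I v) (I (J v)) + s (I v) (I (J v)) u + s (I (J v)) u (I v)) := by
      have := hρ u v (J v)
      simp only [h3, ← h2] at this ⊢
      linarith
    simp only [hκρ] at hρ'
    simp [h.g_I, h.g_J, h.g_K, h.I_sq, h.J_sq, h.K_sq, h.I_J, h.J_I, h.I_K, h.J_K, h.K_I, h.K_J,
      huv.one, huv.I, huv.J, huv.K, hvu.one, hvu.I, hvu.J, hvu.K, hv, h.g_self_I, h.g_self_J,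
      h.g_self_K] at hρ'
    linarith
  have hκ00 : ∀ u, κ u = 0 := by
    intro u
    rw [← he.sum_repr h hn u, map_sum]
    refine Finset.sum_eq_zero fun α _ => ?_
    obtain ⟨c, hc⟩ : ∃ c : Fin n, c ≠ α.1 := by
      haveI : Nontrivial (Fin n) := Fin.nontrivial_iff_two_le.2 hn2
      exact exists_ne _
    rw [map_smul, hκ0 _ (hbasis I J e (c, 0, 0)) (he.hOrth h hc.symm) (by simp [he.one]), smul_zero]
  have hcyc : ∀ u v w, s u v w + s v w u + s w u v = 0 := by
    intro u v w
    rw [hκρ]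
    simp [hκ00]
  -- Closedness on $(u,Iv,Iw)$, compared with the HKT identity, isolates this single term.
  have hII : ∀ u v w, s (I u) (I v) w = -s u v w := by
    intro u v w
    have a1 := hρ v w u
    have a2 := hcyc v w u
    have a3 := hcyc u (I v) (I w)
    have a4 := hcyc (I v) (I w) u
    simp only [h3, ← h2] at a3 a4
    linarith
  -- The form is unchanged when `J` acts on its last two arguments, while `I` and `J` anticommute;
  -- moving `J` past `I` in `hII` turns the value into its negative.
  have hzero : ∀ u v w, s u v w = 0 := by
    intro u v w
    have hJJ : ∀ u v w, s u (J v) (J w) = s u v w := by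
      intro u v w
      simp only [hs, h.J_sq, hJ, map_neg, neg_apply, h.g_J, neg_neg]
    have a1 := hII u (J v) (J w)
    have a2 : s (I u) (I (J v)) (J w) = -s (I u) (J (I v)) (J w) := by
      simp only [hs, h.I_J, h.J_I, map_neg, neg_apply]
      ring
    rw [a2, hJJ, hJJ, hII] at a1
    linarith
  have h5 := hzero u (J v) w
  simp only [hs, h.J_sq, map_neg, neg_apply] at h5
  linarith

end TorsionAlgebra

/-! ### The $(3,0)$-part of a three-form -/

section TypeThree

variable {W : Type*} [NormedAddCommGroup W] [NormedSpace ℝ W]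

theorem integral_exp_mul_I (m : ℤ) (hm : m ≠ 0) :
    ∫ t in (0 : ℝ)..(2 * Real.pi), Complex.exp (m * t * Complex.I) = 0 := by
  have hc : (m : ℂ) * Complex.I ≠ 0 := mul_ne_zero (by exact_mod_cast hm) Complex.I_ne_zero
  have h1 : ∀ t : ℝ, Complex.exp (m * t * Complex.I) = Complex.exp ((m * Complex.I) * t) := by
    intro t; congr 1; ring
  simp only [h1]
  rw [integral_exp_mul_complex hc]
  have h2 : (m : ℂ) * Complex.I * ((2 * Real.pi : ℝ) : ℂ) = m * (2 * Real.pi * Complex.I) := by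
    push_cast; ring
  rw [h2, Complex.exp_int_mul_two_pi_mul_I]
  simp

theorem map_rot_three (L : W →L[ℝ] W) (τ : W [⋀^Fin 3]→L[ℝ] ℂ) (u v w : W) (t : ℝ) :
    τ (fun j => rot L t (![u, v, w] j)) =
      (Real.cos t) ^ 3 * τ ![u, v, w] +
      (Real.cos t) ^ 2 * Real.sin t * (τ ![L u, v, w] + τ ![u, L v, w] + τ ![u, v, L w]) +
      Real.cos t * (Real.sin t) ^ 2 * (τ ![L u, L v, w] + τ ![L u, v, L w] + τ ![u, L v, L w]) +
      (Real.sin t) ^ 3 * τ ![L u, L v, L w] := by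
  have h0 : (fun j => rot L t (![u, v, w] j)) = ![rot L t u, rot L t v, rot L t w] := by
    funext j; fin_cases j <;> rfl
  have a0 : ∀ (x y z : W) (c s : ℝ) (x' : W), τ ![c • x + s • x', y, z] =
      c * τ ![x, y, z] + s * τ ![x', y, z] := by
    intro x y z c s x'
    have h1 := τ.toAlternatingMap.map_vecCons_add ![y, z] (c • x) (s • x')
    have h2 := τ.toAlternatingMap.map_vecCons_smul ![y, z] c x
    have h3 := τ.toAlternatingMap.map_vecCons_smul ![y, z] s x'
    rw [h2, h3] at h1
    simpa using h1
  have s01 : ∀ x y z : W, τ ![x, y, z] = -τ ![y, x, z] := by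
    intro x y z
    have := τ.toAlternatingMap.map_swap ![y, x, z] (show (0 : Fin 3) ≠ 1 by decide)
    refine Eq.trans ?_ this
    change τ _ = τ _
    congr 1; funext j; fin_cases j <;> rfl
  have s12 : ∀ x y z : W, τ ![x, y, z] = -τ ![x, z, y] := by
    intro x y z
    have := τ.toAlternatingMap.map_swap ![x, z, y] (show (1 : Fin 3) ≠ 2 by decide)
    refine Eq.trans ?_ this
    change τ _ = τ _
    congr 1; funext j; fin_cases j <;> rfl
  have a1 : ∀ (x y z : W) (c s : ℝ) (y' : W), τ ![x, c • y + s • y', z] =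
      c * τ ![x, y, z] + s * τ ![x, y', z] := by
    intro x y z c s y'
    rw [s01, a0, s01 x y, s01 x y']; ring
  have a2 : ∀ (x y z : W) (c s : ℝ) (z' : W), τ ![x, y, c • z + s • z'] =
      c * τ ![x, y, z] + s * τ ![x, y, z'] := by
    intro x y z c s z'
    rw [s12, a1, s12 x y z, s12 x y z']; ring
  rw [h0, rot_apply, rot_apply, rot_apply]
  simp only [a0, a1, a2]
  ring

/-- The vanishing of the `(3, 0)`-part of a three-form. -/
theorem typePart_three_eq_zero {L : W →L[ℝ] W} {τ : W [⋀^Fin 3]→L[ℝ] ℂ}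
    (h : typePart L 3 0 τ = 0) (u v w : W) :
    τ ![u, v, w] - (τ ![L u, L v, w] + τ ![L u, v, L w] + τ ![u, L v, L w]) -
      Complex.I * (τ ![L u, v, w] + τ ![u, L v, w] + τ ![u, v, L w]) +
      Complex.I * τ ![L u, L v, L w] = 0 := by
  have h1 : typePart L 3 0 τ ![u, v, w] = 0 := by rw [h]; rfl
  rw [typePart_apply] at h1
  simp only [map_rot_three] at h1
  set A := τ ![u, v, w]
  set B := τ ![L u, v, w] + τ ![u, L v, w] + τ ![u, v, L w]
  set C := τ ![L u, L v, w] + τ ![L u, v, L w] + τ ![u, L v, L w]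
  set D := τ ![L u, L v, L w]
  -- A cubic in cosine and sine has frequencies $\pm3,\pm1$. After multiplication by
  -- $e^{-3\sqrt{-1}t}$ these become $0,-2,-4,-6$, and only the constant term survives integration.
  have key : ∀ t : ℝ, Complex.exp (-((((3 : ℕ) : ℂ) - ((0 : ℕ) : ℂ)) * t * Complex.I)) *
      ((Real.cos t) ^ 3 * A + (Real.cos t) ^ 2 * Real.sin t * B + Real.cos t * (Real.sin t) ^ 2 * C +
        (Real.sin t) ^ 3 * D) =
      (A - Complex.I * B - C + Complex.I * D) / 8 +
      (3 * A - Complex.I * B + C - 3 * Complex.I * D) / 8 *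
        Complex.exp (((-2 : ℤ) : ℂ) * t * Complex.I) +
      (3 * A + Complex.I * B + C + 3 * Complex.I * D) / 8 *
        Complex.exp (((-4 : ℤ) : ℂ) * t * Complex.I) +
      (A + Complex.I * B - C - Complex.I * D) / 8 *
        Complex.exp (((-6 : ℤ) : ℂ) * t * Complex.I) := by
    intro t
    set z := Complex.exp (-(t * Complex.I)) with hz
    set y := Complex.exp (t * Complex.I) with hy
    have hyz : y * z = 1 := by rw [hy, hz, ← Complex.exp_add]; simp
    have hp : ∀ k : ℕ, Complex.exp (-(k * (t * Complex.I))) = z ^ k := by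
      intro k; rw [hz, ← Complex.exp_nat_mul]; congr 1; ring
    have e3 : Complex.exp (-((((3 : ℕ) : ℂ) - ((0 : ℕ) : ℂ)) * t * Complex.I)) = z ^ 3 := by
      rw [← hp]; congr 1; push_cast; ring
    have e2 : Complex.exp (((-2 : ℤ) : ℂ) * t * Complex.I) = z ^ 2 := by
      rw [← hp]; congr 1; push_cast; ring
    have e4 : Complex.exp (((-4 : ℤ) : ℂ) * t * Complex.I) = z ^ 4 := by
      rw [← hp]; congr 1; push_cast; ring
    have e6 : Complex.exp (((-6 : ℤ) : ℂ) * t * Complex.I) = z ^ 6 := by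
      rw [← hp]; congr 1; push_cast; ring
    have hc : ((Real.cos t : ℝ) : ℂ) = (y + z) / 2 := by
      rw [Complex.ofReal_cos, Complex.cos, hy, hz, neg_mul]
    have hs : ((Real.sin t : ℝ) : ℂ) = (z - y) * Complex.I / 2 := by
      rw [Complex.ofReal_sin, Complex.sin, hy, hz, neg_mul]
    rw [e3, e2, e4, e6, hc, hs]
    have hI : Complex.I ^ 2 = -1 := Complex.I_sq
    have hI3 : Complex.I ^ 3 = -Complex.I := by rw [pow_succ, hI]; ring
    have m1 : z ^ 3 * (y + z) ^ 3 = 1 + 3 * z ^ 2 + 3 * z ^ 4 + z ^ 6 := by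
      linear_combination (y ^ 2 * z ^ 2 + y * z + 1 + 3 * z ^ 2 * (y * z + 1) + 3 * z ^ 4) * hyz
    have m2 : z ^ 3 * ((y + z) ^ 2 * (z - y)) = -1 - z ^ 2 + z ^ 4 + z ^ 6 := by
      linear_combination (-(y ^ 2 * z ^ 2 + y * z + 1) - z ^ 2 * (y * z + 1) + z ^ 4) * hyz
    have m3 : z ^ 3 * ((y + z) * (z - y) ^ 2) = 1 - z ^ 2 - z ^ 4 + z ^ 6 := by
      linear_combination ((y ^ 2 * z ^ 2 + y * z + 1) - z ^ 2 * (y * z + 1) - z ^ 4) * hyz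
    have m4 : z ^ 3 * (z - y) ^ 3 = -1 + 3 * z ^ 2 - 3 * z ^ 4 + z ^ 6 := by
      linear_combination (-(y ^ 2 * z ^ 2 + y * z + 1) + 3 * z ^ 2 * (y * z + 1) - 3 * z ^ 4) * hyz
    linear_combination (A / 8) * m1 + (Complex.I * B / 8) * m2 - (C / 8) * m3 -
      (Complex.I * D / 8) * m4 + (z ^ 3 * ((y + z) * (z - y) ^ 2) * C / 8) * hI +
      (z ^ 3 * (z - y) ^ 3 * D / 8) * hI3
  simp only [key] at h1
  have hint : ∀ (c : ℂ) (m : ℤ), IntervalIntegrable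
      (fun t : ℝ => c * Complex.exp ((m : ℂ) * t * Complex.I)) MeasureTheory.volume 0
        (2 * Real.pi) := by
    intro c m
    apply Continuous.intervalIntegrable
    fun_prop
  rw [intervalIntegral.integral_add ((intervalIntegrable_const.add (hint _ _)).add (hint _ _))
      (hint _ _),
    intervalIntegral.integral_add (intervalIntegrable_const.add (hint _ _)) (hint _ _),
    intervalIntegral.integral_add intervalIntegrable_const (hint _ _),
    intervalIntegral.integral_const_mul, intervalIntegral.integral_const_mul,
    intervalIntegral.integral_const_mul, integral_exp_mul_I _ (by norm_num),
    integral_exp_mul_I _ (by norm_num), integral_exp_mul_I _ (by norm_num),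
    intervalIntegral.integral_const, sub_zero, mul_zero, mul_zero, mul_zero, add_zero, add_zero,
    add_zero, smul_smul, inv_mul_cancel₀ (by positivity), one_smul] at h1
  linear_combination 8 * h1

end TypeThree

/-! ### Differentiability of fields on the manifold -/

section Calculus

variable {E : Type*} [NormedAddCommGroup E] [NormedSpace ℝ E]
  {M : Type*} [TopologicalSpace M] [ChartedSpace E M] [IsManifold 𝓘(ℝ, E) ∞ M] {x : M}

instance isManifold_one_of_smooth : IsManifold 𝓘(ℝ, E) 1 M := IsManifold.of_le (n := ∞) (by norm_num)

/-- The metric at a point, as a bilinear form on the model space. -/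
def metricAt (g : Metric E M) (y : M) : E →L[ℝ] E →L[ℝ] ℝ := g.inner y

theorem DiffAt.app {L : EndField E M} (hL : L.Smooth) {Y : M → E} (hY : DiffAt Y x) :
    DiffAt (fun y => L y (Y y)) x :=
  MDifferentiableAt.clm_bundle_apply (𝕜 := ℝ) (F₁ := E) (F₂ := E)
    (E₁ := (TangentSpace 𝓘(ℝ, E) : M → Type _)) (E₂ := (TangentSpace 𝓘(ℝ, E) : M → Type _))
    (b := fun y : M => y) (ϕ := fun y => L y)
    ((hL x).mdifferentiableAt (by norm_num)) hY

theorem DiffAt.inner (g : Metric E M) {Y Z : M → E} (hY : DiffAt Y x) (hZ : DiffAt Z x) :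
    MDifferentiableAt 𝓘(ℝ, E) 𝓘(ℝ, ℝ) (fun y => metricAt g y (Y y) (Z y)) x := by
  have h := MDifferentiableAt.clm_bundle_apply₂ (𝕜 := ℝ) (F₁ := E) (F₂ := E) (F₃ := ℝ)
    (E₁ := (TangentSpace 𝓘(ℝ, E) : M → Type _)) (E₂ := (TangentSpace 𝓘(ℝ, E) : M → Type _))
    (E₃ := Bundle.Trivial M ℝ)
    (b := fun y : M => y) (ψ := fun y => g.inner y)
    ((g.contMDiff x).mdifferentiableAt (by norm_num)) hY hZ
  rw [mdifferentiableAt_totalSpace] at h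
  exact h.2

theorem DiffAt.sub {Y Z : M → E} (hY : DiffAt Y x) (hZ : DiffAt Z x) :
    DiffAt (fun y => Y y - Z y) x :=
  mdifferentiableAt_sub_section hY hZ

theorem DiffAt.smul {f : M → ℝ} {Y : M → E} (hf : MDifferentiableAt 𝓘(ℝ, E) 𝓘(ℝ, ℝ) f x)
    (hY : DiffAt Y x) : DiffAt (fun y => f y • Y y) x :=
  MDifferentiableAt.smul_section hf hY

theorem DiffAt.sum {ι : Type*} {s : Finset ι} {Y : ι → M → E} (hY : ∀ i ∈ s, DiffAt (Y i) x) :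
    DiffAt (fun y => ∑ i ∈ s, Y i y) x :=
  MDifferentiableAt.sum_section hY

/-- The field which is constant in the preferred chart at `x`, with value `v` at `x`. -/
def chartField (x : M) (v : E) : M → E :=
  FiberBundle.extend (E := (TangentSpace 𝓘(ℝ, E) : M → Type _)) E (x := x) v

theorem chartField_self (x : M) (v : E) : chartField x v x = v :=
  FiberBundle.extend_apply_self (E := (TangentSpace 𝓘(ℝ, E) : M → Type _)) ..

theorem diffAt_chartField (x : M) (v : E) : DiffAt (chartField x v) x :=
  FiberBundle.mdifferentiableAt_extend (V := (TangentSpace 𝓘(ℝ, E) : M → Type _)) 𝓘(ℝ, E) E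
    (x := x) v

end Calculus

/-! ### Local quaternionic unitary frames -/

section LocalFrame

variable {E : Type*} [NormedAddCommGroup E] [NormedSpace ℝ E]
  {M : Type*} [TopologicalSpace M] [ChartedSpace E M] [IsManifold 𝓘(ℝ, E) ∞ M] {x : M}
  {H : Hypercomplex E M} {g : Metric E M}

theorem Hypercomplex.IsQuaternionicHermitian.qHerm (hg : H.IsQuaternionicHermitian g) (x : M) :
    QHerm (H.I x) (H.J x) (H.K x) (metricAt g x) where
  I_sq := H.I_sq x
  J_sq := H.J_sq x
  K_sq := H.K_sq x
  I_J := H.I_J x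
  J_I := H.J_I x
  symm := g.symm x
  inv_I := hg.inv_I x
  inv_J := hg.inv_J x
  inv_K := hg.inv_K x
  pos := g.pos x

/-- The fields `e_a`, `I e_a`, `J e_a`, `J I e_a`. -/
def frameField (H : Hypercomplex E M) {k : ℕ} (e : Fin k → M → E)
    (α : Fin k × Fin 2 × Fin 2) : M → E :=
  fun y => hbasis (H.I y) (H.J y) (fun a => e a y) α

theorem DiffAt.frameField {k : ℕ} {e : Fin k → M → E} (he : ∀ a, DiffAt (e a) x)
    (α : Fin k × Fin 2 × Fin 2) : DiffAt (frameField H e α) x := by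
  obtain ⟨a, t, r⟩ := α
  have h0 := he a
  have h1 := h0.app H.smooth_I
  rcases eq_or_of_fin_two t with rfl | rfl <;> rcases eq_or_of_fin_two r with rfl | rfl
  · exact h0
  · exact h0.app H.smooth_J
  · exact h1
  · exact h1.app H.smooth_J

/-- The fields `e` form a quaternionic unitary frame near `x`, and are differentiable at `x`. -/
structure IsLocalFrame (H : Hypercomplex E M) (g : Metric E M) (x : M) {k : ℕ}
    (e : Fin k → M → E) : Prop where
  diff : ∀ a, DiffAt (e a) x
  frame : ∀ᶠ y in nhds x, IsHFrame (H.I y) (H.J y) (H.K y) (metricAt g y) (fun a => e a y)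

/-- Quaternionic Gram–Schmidt, adding one vector at a time. Differentiability at `x` alone is
required, which is all that the covariant derivative at `x` uses. -/
theorem exists_isLocalFrame [FiniteDimensional ℝ E] (hg : H.IsQuaternionicHermitian g) (x : M)
    (k : ℕ) (hk : 4 * k ≤ Module.finrank ℝ E) :
    ∃ e : Fin k → M → E, IsLocalFrame H g x e := by
  induction k with
  | zero => exact ⟨Fin.elim0, fun a => a.elim0, Filter.Eventually.of_forall fun y =>
      ⟨fun a => a.elim0, fun a => a.elim0, fun a => a.elim0, fun a => a.elim0⟩⟩
  | succ k ih =>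
    obtain ⟨e, he, hf⟩ := ih (by omega)
    obtain ⟨v, hv0, hv⟩ := IsHFrame.exists_orthogonal (I := H.I x) (J := H.J x)
      (metricAt g x) (fun a => e a x) (by omega)
    have hY := diffAt_chartField x v
    have hYx := chartField_self x v
    set Y := chartField x v
    have hb := fun α => DiffAt.frameField (H := H) he α
    -- At `x` the projection term is zero, so the field still has the value `v` there; its norm is
    -- therefore positive nearby, and the inverse square root is differentiable.
    let u : M → E := fun y => Y y - ∑ α, metricAt g y (Y y) (frameField H e α y) • frameField H e α y
    have hu : DiffAt u x := hY.sub (DiffAt.sum fun α _ => DiffAt.smul (hY.inner g (hb α)) (hb α))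
    have hux : u x = v := by
      simp only [u, hYx]
      rw [Finset.sum_eq_zero, sub_zero]
      intro α _
      have := hv α
      change metricAt g x v (frameField H e α x) = 0 at this
      rw [this, zero_smul]
    have hq := hu.inner g hu
    have hqx : 0 < metricAt g x (u x) (u x) := by rw [hux]; exact g.pos x v hv0
    have hs : MDifferentiableAt 𝓘(ℝ, E) 𝓘(ℝ, ℝ)
        (fun y => (Real.sqrt (metricAt g y (u y) (u y)))⁻¹) x := by
      have h1 : DifferentiableAt ℝ (fun r : ℝ => (Real.sqrt r)⁻¹) (metricAt g x (u x) (u x)) :=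
        (differentiableAt_id.sqrt hqx.ne').inv (Real.sqrt_pos.2 hqx).ne'
      exact MDifferentiableAt.comp (g := fun r : ℝ => (Real.sqrt r)⁻¹) x h1.mdifferentiableAt hq
    refine ⟨Fin.snoc e (fun y => (Real.sqrt (metricAt g y (u y) (u y)))⁻¹ • u y), fun a => ?_, ?_⟩
    · refine Fin.lastCases ?_ (fun a => ?_) a
      · rw [Fin.snoc_last]
        exact DiffAt.smul hs hu
      · rw [Fin.snoc_castSucc]
        exact he a
    · filter_upwards [hf, hq.continuousAt.eventually (lt_mem_nhds hqx)] with y hfy hqy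
      have h := hg.qHerm y
      have hu0 : u y ≠ 0 := by
        intro h0
        rw [h0] at hqy
        simp at hqy
      have horth : ∀ β, metricAt g y (u y) (frameField H e β y) = 0 := by
        intro β
        have ho : ∀ α, metricAt g y (frameField H e α y) (frameField H e β y) =
            if α = β then 1 else 0 := fun α => hfy.orthonormal h α β
        simp only [u, map_sub, sub_apply, map_sum, sum_apply, map_smul, smul_apply, ho]
        simp
      have hs := hfy.snoc h (h.normalize hu0) (fun α => by
        rw [map_smul, smul_apply]
        have := horth α
        change metricAt g y (u y) (hbasis (H.I y) (H.J y) (fun a => e a y) α) = 0 at this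
        rw [this, smul_zero])
      have hfun : (fun a => (Fin.snoc e (fun y => (Real.sqrt (metricAt g y (u y) (u y)))⁻¹ • u y) :
          Fin (k + 1) → M → E) a y) =
          Fin.snoc (fun a => e a y) ((Real.sqrt (metricAt g y (u y) (u y)))⁻¹ • u y) := by
        funext a
        refine Fin.lastCases ?_ (fun a => ?_) a
        · rw [Fin.snoc_last, Fin.snoc_last]
        · rw [Fin.snoc_castSucc, Fin.snoc_castSucc]
      rw [hfun]
      exact hs

end LocalFrame

/-! ### Identifying two quaternionic Hermitian spaces by frames -/

section LiftTo

variable {W : Type*} [NormedAddCommGroup W] [NormedSpace ℝ W] [FiniteDimensional ℝ W]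
  {I J K I' J' K' : W →L[ℝ] W} {g g' : W →L[ℝ] W →L[ℝ] ℝ} {n : ℕ} {e u : Fin n → W}

/-- The map between quaternionic Hermitian spaces given by two frames. -/
def IsHFrame.liftTo (he : IsHFrame I J K g e) (h : QHerm I J K g)
    (hn : Module.finrank ℝ W = 4 * n) (I' J' : W →L[ℝ] W) (u : Fin n → W) : W →ₗ[ℝ] W :=
  (he.basis h hn).constr ℝ (hbasis I' J' u)

variable (he : IsHFrame I J K g e) (h : QHerm I J K g) (hn : Module.finrank ℝ W = 4 * n)
  (hu : IsHFrame I' J' K' g' u) (h' : QHerm I' J' K' g')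

theorem IsHFrame.liftTo_hbasis (α : Fin n × Fin 2 × Fin 2) :
    he.liftTo h hn I' J' u (hbasis I J e α) = hbasis I' J' u α := by
  have := (he.basis h hn).constr_basis ℝ (hbasis I' J' u) α
  rwa [he.basis_apply h hn] at this

include h' in
theorem IsHFrame.liftTo_IJ :
    (∀ v, he.liftTo h hn I' J' u (J v) = J' (he.liftTo h hn I' J' u v)) ∧
    (∀ v, he.liftTo h hn I' J' u (I v) = I' (he.liftTo h hn I' J' u v)) := by
  set P := he.liftTo h hn I' J' u
  have key : ∀ (L L' : W →L[ℝ] W), (∀ α, P (L (hbasis I J e α)) = L' (P (hbasis I J e α))) →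
      ∀ v, P (L v) = L' (P v) := fun L L' hL v =>
    he.ext_linear h hn (P := P ∘ₗ L.toLinearMap) (Q := L'.toLinearMap ∘ₗ P) hL v
  constructor
  all_goals
    refine key _ _ ?_
    rintro ⟨a, t, r⟩
    have h00 : P (e a) = u a := by simpa using he.liftTo_hbasis h hn (a, 0, 0)
    have h01 : P (J (e a)) = J' (u a) := by simpa using he.liftTo_hbasis h hn (a, 0, 1)
    have h10 : P (I (e a)) = I' (u a) := by simpa using he.liftTo_hbasis h hn (a, 1, 0)
    have h11 : P (J (I (e a))) = J' (I' (u a)) := by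
      simpa using he.liftTo_hbasis h hn (a, 1, 1)
    have h12 : P (K (e a)) = K' (u a) := by
      rw [h.J_I, h'.J_I, map_neg] at h11; exact neg_injective h11
    rcases eq_or_of_fin_two t with rfl | rfl <;> rcases eq_or_of_fin_two r with rfl | rfl <;>
    simp [h00, h01, h10, h12, h.J_sq, h'.J_sq, h.I_sq, h'.I_sq, h.J_I, h'.J_I, h.I_J, h'.I_J,
      h.J_K, h'.J_K, h.I_K, h'.I_K]

include hu h' in
theorem IsHFrame.liftTo_g (v w : W) :
    g' (he.liftTo h hn I' J' u v) (he.liftTo h hn I' J' u w) = g v w := by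
  conv_rhs => rw [← he.sum_repr h hn v, ← he.sum_repr h hn w]
  conv_lhs => rw [← he.sum_repr h hn v, ← he.sum_repr h hn w]
  simp [hu.orthonormal h', he.orthonormal h, he.liftTo_hbasis h hn]

end LiftTo

/-! ### Connection coefficients in a frame -/

section Coefficients

variable {E : Type*} [NormedAddCommGroup E] [NormedSpace ℝ E] [FiniteDimensional ℝ E]
  {M : Type*} [TopologicalSpace M] [ChartedSpace E M] [IsManifold 𝓘(ℝ, E) ∞ M] {x : M}
  {H : Hypercomplex E M} {g : Metric E M} {n : ℕ} {e : Fin n → M → E}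

/-- The covariant derivative of a field, with values in the model space. -/
def covAt (D : Connection E M) (Y : M → E) (x : M) : E →L[ℝ] E := D Y x

theorem IsLocalFrame.at (he : IsLocalFrame H g x e) :
    IsHFrame (H.I x) (H.J x) (H.K x) (metricAt g x) (fun a => e a x) := he.frame.self_of_nhds

/-- The coefficients of a connection in a frame: the covariant derivative in the direction `u`
of the field with constant coefficients in the frame and with value `w`. -/
def IsLocalFrame.coef (he : IsLocalFrame H g x e) (hg : H.IsQuaternionicHermitian g)
    (hn : Module.finrank ℝ E = 4 * n) (D : Connection E M) : E →ₗ[ℝ] E →ₗ[ℝ] E :=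
  ((he.at.basis (hg.qHerm x) hn).constr ℝ
    fun α => (covAt D (frameField H e α) x).toLinearMap).flip

variable (he : IsLocalFrame H g x e) (hg : H.IsQuaternionicHermitian g)
  (hn : Module.finrank ℝ E = 4 * n) {D D₀ : Connection E M}

theorem IsLocalFrame.coef_apply (u : E) (α : Fin n × Fin 2 × Fin 2) :
    he.coef hg hn D u (frameField H e α x) = covAt D (frameField H e α) x u := by
  have h1 := (he.at.basis (hg.qHerm x) hn).constr_basis ℝ
    (fun α => (covAt D (frameField H e α) x).toLinearMap) α
  rw [he.at.basis_apply (hg.qHerm x) hn] at h1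
  unfold IsLocalFrame.coef
  rw [LinearMap.flip_apply]
  exact congrArg (fun f => f u) h1

/-- The frame consists of images of the $e_a$ under `I` and `J`, which the Obata connection
preserves, so its coefficients form a quaternion-linear map. -/
theorem IsLocalFrame.coef_IJ (hD : H.IsObata D) (u w : E) :
    he.coef hg hn D u (H.I x w) = H.I x (he.coef hg hn D u w) ∧
      he.coef hg hn D u (H.J x w) = H.J x (he.coef hg hn D u w) := by
  have h := hg.qHerm x
  set N := he.coef hg hn D
  have hN : ∀ w, N u w = he.at.lift h hn (fun a => N u (e a x)) w := by
    refine fun w => he.at.ext_linear h hn (fun α => ?_) w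
    rw [he.at.lift_hbasis]
    obtain ⟨a, t, r⟩ := α
    have k00 : covAt D (frameField H e (a, 0, 0)) x u = N u (e a x) :=
      (he.coef_apply hg hn u (a, 0, 0)).symm
    have k01 : covAt D (frameField H e (a, 0, 1)) x u =
        H.J x (covAt D (frameField H e (a, 0, 0)) x u) :=
      hD.preserves_J x _ (DiffAt.frameField he.diff (a, 0, 0)) u
    have k10 : covAt D (frameField H e (a, 1, 0)) x u =
        H.I x (covAt D (frameField H e (a, 0, 0)) x u) :=
      hD.preserves_I x _ (DiffAt.frameField he.diff (a, 0, 0)) u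
    have k11 : covAt D (frameField H e (a, 1, 1)) x u =
        H.J x (covAt D (frameField H e (a, 1, 0)) x u) :=
      hD.preserves_J x _ (DiffAt.frameField he.diff (a, 1, 0)) u
    refine (he.coef_apply hg hn u (a, t, r)).trans ?_
    rcases eq_or_of_fin_two t with rfl | rfl <;> rcases eq_or_of_fin_two r with rfl | rfl
    · rw [k00, hbasis_00]
    · rw [k01, k00, hbasis_01]
    · rw [k10, k00, hbasis_10]
    · rw [k11, k10, k00, hbasis_11]
  rw [hN, hN w, hN (H.J x w)]
  exact ⟨he.at.lift_I h hn _ w, he.at.lift_J h hn _ w⟩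

theorem covAt_sub_of_torsionFree (hD : D.TorsionFree) {Y Z : M → E} (hY : DiffAt Y x)
    (hZ : DiffAt Z x) :
    covAt D Z x (Y x) - covAt D Y x (Z x) = bracket (E := E) (M := M) Y Z x := by
  haveI : CompleteSpace E := FiniteDimensional.complete ℝ E
  exact (CovariantDerivative.torsion_eq_zero_iff D).1 hD hY hZ

/-- For either connection the antisymmetrized coefficients are the brackets of the frame fields. -/
theorem IsLocalFrame.coef_sub (hD : D.TorsionFree) (hD₀ : D₀.TorsionFree) (u v : E) :
    he.coef hg hn D u v - he.coef hg hn D v u =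
      he.coef hg hn D₀ u v - he.coef hg hn D₀ v u := by
  have h := hg.qHerm x
  set C := he.coef hg hn D
  set N := he.coef hg hn D₀
  have key : ∀ α β, (C - C.flip) (frameField H e α x) (frameField H e β x) =
      (N - N.flip) (frameField H e α x) (frameField H e β x) := by
    intro α β
    simp only [LinearMap.sub_apply, LinearMap.flip_apply, C, N]
    rw [he.coef_apply, he.coef_apply, he.coef_apply, he.coef_apply,
      covAt_sub_of_torsionFree hD (DiffAt.frameField he.diff α) (DiffAt.frameField he.diff β),
      covAt_sub_of_torsionFree hD₀ (DiffAt.frameField he.diff α) (DiffAt.frameField he.diff β)]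
  have h2 : C - C.flip = N - N.flip := by
    refine LinearMap.ext fun u => he.at.ext_linear h hn (fun α => ?_) u
    exact LinearMap.ext fun v => he.at.ext_linear h hn (fun β => key α β) v
  have h3 := congrArg (fun f => f u v) h2
  simpa using h3

end Coefficients

/-! ### From a parallel form to a conformal action on $\omega_J$ -/

section Derivative

variable {E : Type*} [NormedAddCommGroup E] [NormedSpace ℝ E] [FiniteDimensional ℝ E]
  {M : Type*} [TopologicalSpace M] [ChartedSpace E M] [IsManifold 𝓘(ℝ, E) ∞ M] {x : M}
  {H : Hypercomplex E M} {g : Metric E M} {n : ℕ} {e : Fin n → M → E}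

theorem Hypercomplex.IsSLnH.isPosTop {Phi : Form E M (2 * n) ℂ} (hPhi : H.IsSLnH n Phi) (x : M) :
    IsPosTop (H.I x) (H.J x) (Phi x) where
  type_top := hPhi.type_top x
  ne_zero := hPhi.ne_zero x
  real := hPhi.real x
  positive v := by
    refine (hPhi.positive x v).trans_eq ?_
    congr 2
    funext j
    unfold pairList
    have h1 : ((pairEquiv n).symm j).1 = ⟨j.val / 2, by omega⟩ := Fin.ext (pairEquiv_symm_fst j)
    have h2 : ((pairEquiv n).symm j).2 = 0 ↔ j.val % 2 = 0 := by
      rw [Fin.ext_iff, pairEquiv_symm_snd]; rfl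
    simp only [h1, h2]

/-- The differential of a function, as a linear map on the model space. -/
def dAt {F : Type*} [NormedAddCommGroup F] [NormedSpace ℝ F] (f : M → F) (x : M) : E →L[ℝ] F :=
  mfderiv 𝓘(ℝ, E) 𝓘(ℝ, F) f x

/-- No differentiability of `d` is assumed: if it fails and `k ≠ 0`, both derivatives take the
default value zero. The factor relating $V$ at nearby points can thus be used without a regularity
proof. -/
theorem dAt_mul_const (d : M → ℝ) (k : ℝ) (v : E) :
    dAt (fun y => d y * k) x v = dAt (E := E) d x v * k := by
  have e : (fun y => d y * k) = k • d := by funext y; simp [mul_comm]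
  by_cases hd : MDifferentiableAt 𝓘(ℝ, E) 𝓘(ℝ, ℝ) d x
  · have h1 := const_smul_mfderiv hd k
    rw [e, mul_comm]
    exact congrArg (fun f : E →L[ℝ] ℝ => f v) h1
  by_cases hk : k = 0
  · subst hk
    simp only [mul_zero]
    exact congrArg (fun f : E →L[ℝ] ℝ => f v) (mfderiv_const (I := 𝓘(ℝ, E)) (I' := 𝓘(ℝ, ℝ)))
  · have h2 : ¬ MDifferentiableAt 𝓘(ℝ, E) 𝓘(ℝ, ℝ) (fun y => d y * k) x := by
      intro h
      apply hd
      have : d = k⁻¹ • fun y => d y * k := by funext y; simp; field_simp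
      rw [this]
      exact h.const_smul _
    have e1 : dAt (E := E) d x = 0 := mfderiv_zero_of_not_mdifferentiableAt hd
    have e2 : dAt (E := E) (fun y => d y * k) x = 0 := mfderiv_zero_of_not_mdifferentiableAt h2
    rw [e1, e2]
    simp

variable (he : IsLocalFrame H g x e) (hg : H.IsQuaternionicHermitian g)
  (hn : Module.finrank ℝ E = 4 * n) {D : Connection E M}

/-- A connection preserving `V_{n+i,n+i}` acts on the form `ω_J` at a point by scalars. -/
theorem IsLocalFrame.coef_omega {Phi : Form E M (2 * n) ℂ} (hPhi : H.IsSLnH n Phi) {i : ℕ} {c : ℝ}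
    (hi0 : 0 < i) (hin : i < n) (hc : c ≠ 0) (hD : D.PreservesForm (H.calibV g Phi i c)) :
    ∃ κ : E →ₗ[ℝ] ℝ, ∀ u v w, metricAt g x (H.J x (he.coef hg hn D u v)) w +
      metricAt g x (H.J x v) (he.coef hg hn D u w) = κ u * metricAt g x (H.J x v) w := by
  have h := hg.qHerm
  set C := he.coef hg hn D
  set V := listForm (calib (H.J x) (metricAt g x) (Phi x) i c)
  -- the form has constant coefficients in the frame, up to a common factor
  obtain ⟨d, hd⟩ : ∃ d : M → ℝ, ∀ᶠ y in nhds x,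
      ∀ f : (Fin n ⊕ Fin i) × Fin 2 → Fin n × Fin 2 × Fin 2,
        calib (H.J y) (metricAt g y) (Phi y) i c
          (fun j => frameField H e (f ((listEquiv n i).symm j)) y) =
        d y * V (fun j => frameField H e (f j) x) := by
    refine ⟨fun y => (pairForm (Phi y) (pairList (H.J y) (fun a => e a y))).re /
      (pairForm (Phi x) (pairList (H.J x) (fun a => e a x))).re, ?_⟩
    · filter_upwards [he.frame] with y hy f
      have hIJ := he.at.liftTo_IJ (h x) hn (u := fun a => e a y) (h y)
      have := calib_map (L := H.J y) (L' := H.J x) (b := metricAt g y) (b' := metricAt g x)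
        (Phi := Phi y) (Phi' := Phi x) i c
        (P := he.at.liftTo (h x) hn (H.I y) (H.J y) (fun a => e a y)) (fun v => (hIJ.1 v).symm)
        (he.at.liftTo_g (h x) hn hy (h y))
        ((hPhi.isPosTop x).map (h x) hn he.at (hPhi.isPosTop y) (h y).J_sq hIJ.2 hIJ.1)
        (fun j => frameField H e (f ((listEquiv n i).symm j)) x)
      have e1 : ∀ α, he.at.liftTo (h x) hn (H.I y) (H.J y) (fun a => e a y) (frameField H e α x) =
          frameField H e α y := he.at.liftTo_hbasis (h x) hn
      simp only [e1] at this
      refine this.trans ?_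
      have e2 : ∀ a, he.at.liftTo (h x) hn (H.I y) (H.J y) (fun a => e a y) (e a x) = e a y :=
        fun a => by simpa using he.at.liftTo_hbasis (h x) hn (a, 0, 0)
      have e3 : (he.at.liftTo (h x) hn (H.I y) (H.J y) (fun a => e a y) ∘ fun a => e a x) =
        fun a => e a y := funext e2
      rw [e3]
      rfl
  let l : E →L[ℝ] ℝ := dAt d x
  have h1 : ∀ (f : (Fin n ⊕ Fin i) × Fin 2 → Fin n × Fin 2 × Fin 2) (u : E),
      ∑ j, V (Function.update (fun j => frameField H e (f j) x) j (C u (frameField H e (f j) x))) =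
        l u * V (fun j => frameField H e (f j) x) := by
    intro f u
    have h2 : dAt (E := E) (fun y => calib (H.J y) (metricAt g y) (Phi y) i c
        (fun j => frameField H e (f ((listEquiv n i).symm j)) y)) x u =
        ∑ j, calib (H.J x) (metricAt g x) (Phi x) i c (Function.update
          (fun l => frameField H e (f ((listEquiv n i).symm l)) x) j
          (covAt D (frameField H e (f ((listEquiv n i).symm j))) x u)) :=
      hD x (fun j => frameField H e (f ((listEquiv n i).symm j)))
        (fun j => DiffAt.frameField he.diff _) u
    have h3 : dAt (E := E) (fun y => calib (H.J y) (metricAt g y) (Phi y) i c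
        (fun j => frameField H e (f ((listEquiv n i).symm j)) y)) x u =
        l u * V (fun j => frameField H e (f j) x) := by
      rw [← dAt_mul_const]
      have : (fun y => calib (H.J y) (metricAt g y) (Phi y) i c
        (fun j => frameField H e (f ((listEquiv n i).symm j)) y)) =ᶠ[nhds x]
          fun y => d y * V (fun j => frameField H e (f j) x) := by
        filter_upwards [hd] with y hy using hy f
      exact congrArg (fun f : E →L[ℝ] ℝ => f u) this.mfderiv_eq
    rw [← h3]
    refine Eq.trans ?_ h2.symm
    rw [← (listEquiv n i).sum_comp]
    refine Finset.sum_congr rfl fun j _ => ?_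
    rw [listForm_apply]
    refine congrArg (calib (H.J x) (metricAt g x) (Phi x) i c) ?_
    have h4 := he.coef_apply hg hn (D := D) u (f j)
    rw [h4]
    funext k
    by_cases hk : k = listEquiv n i j
    · subst hk
      rw [Function.update_self, Equiv.symm_apply_apply, Function.update_self]
    · have : (listEquiv n i).symm k ≠ j := fun h => hk (by rw [← h, Equiv.apply_symm_apply])
      rw [Function.update_of_ne hk, Function.update_of_ne this]
  have h2 : ∀ (u : E) w, ∑ j, V (Function.update w j (C u (w j))) = l u * V w := by
    intro u w
    have key : (∑ j, V.toMultilinearMap.compLinearMap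
        (fun k => if k = j then C u else LinearMap.id)) = l u • V.toMultilinearMap := by
      refine Module.Basis.ext_multilinear (fun _ => he.at.basis (h x) hn) fun f => ?_
      simp only [he.at.basis_apply (h x) hn]
      have := h1 f u
      rw [sum_apply]
      refine Eq.trans (Finset.sum_congr rfl fun j _ => ?_) this
      refine congrArg V (funext fun k => ?_)
      by_cases hk : k = j
      · subst hk; simp; rfl
      · simp [hk]; rfl
    have := congrArg (fun f => f w) key
    rw [sum_apply] at this
    refine Eq.trans (Finset.sum_congr rfl fun j _ => ?_) this
    refine congrArg V (funext fun k => ?_)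
    by_cases hk : k = j
    · subst hk; simp
    · simp [hk]
  -- The identity acts on a form by its degree: by $2n+2i$ on $V$ and by $2$ on $\omega_J$.
  -- Subtracting $l(u)/(2n+2i)$ times the identity from $C_u$ gives an annihilator of $V$.
  refine ⟨(2 / (2 * n + 2 * i) : ℝ) • l.toLinearMap, fun u v w => ?_⟩
  have hN : (0 : ℝ) < 2 * n + 2 * i := by positivity
  have hcard : (Fintype.card ((Fin n ⊕ Fin i) × Fin 2) : ℝ) = 2 * n + 2 * i := by
    simp; ring
  have h3 := (calibLike_calib hin.le (hPhi.isPosTop x) (h x) hn hc he.at).actForm_eq_zero (h x) hn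
    (C := C u - (l u / (2 * n + 2 * i)) • LinearMap.id) (fun w => by
      have h4 := h2 u w
      simp only [LinearMap.sub_apply, LinearMap.smul_apply, LinearMap.id_apply,
        AlternatingMap.map_update_sub, AlternatingMap.map_update_smul, Function.update_eq_self,
        Finset.sum_sub_distrib, Finset.sum_const, Finset.card_univ]
      rw [h4, nsmul_eq_mul, hcard, smul_eq_mul]
      field_simp
      ring) hi0 hin v w
  unfold actForm at h3
  simp only [LinearMap.sub_apply, LinearMap.smul_apply, LinearMap.id_apply, map_sub, map_smul,
    sub_apply, smul_apply, smul_eq_mul] at h3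
  simp only [LinearMap.smul_apply, smul_eq_mul, ContinuousLinearMap.coe_coe]
  field_simp
  field_simp at h3
  linear_combination h3 / 2

end Derivative

/-! ### The exterior derivative through fields constant in a chart -/

section ChartFields

variable {E : Type*} [NormedAddCommGroup E] [NormedSpace ℝ E]
  {M : Type*} [TopologicalSpace M] [ChartedSpace E M] [IsManifold 𝓘(ℝ, E) ∞ M] {x : M}

theorem chartField_apply {y : M} (hy : y ∈ (chartAt E x).source) (v : E) :
    chartField x v y =
      (mfderiv 𝓘(ℝ, E) 𝓘(ℝ, E) (extChartAt 𝓘(ℝ, E) x).symm (extChartAt 𝓘(ℝ, E) x y) : E →L[ℝ] E)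
        v := by
  have h1 := TangentBundle.symmL_trivializationAt (I := 𝓘(ℝ, E)) hy
  have h2 := TangentBundle.continuousLinearMapAt_trivializationAt (I := 𝓘(ℝ, E))
    (mem_chart_source E x)
  rw [mfderiv_extChartAt_self] at h2
  have h3 : (trivializationAt E (TangentSpace 𝓘(ℝ, E) : M → Type _) x ⟨x, v⟩).2 = v := by
    have h4 := congrArg (fun f : E →L[ℝ] E => f v) h2
    have h5 := congrFun (Bundle.Trivialization.coe_linearMapAt_of_mem (R := ℝ)
      (trivializationAt E (TangentSpace 𝓘(ℝ, E) : M → Type _) x)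
      (FiberBundle.mem_baseSet_trivializationAt' x)) v
    exact h5.symm.trans h4
  rw [ModelWithCorners.range_eq_univ, mfderivWithin_univ] at h1
  unfold chartField FiberBundle.extend
  rw [h3]
  refine (Bundle.Trivialization.symmL_apply (R := ℝ)
    (trivializationAt E (TangentSpace 𝓘(ℝ, E) : M → Type _) x) ?_ v).symm.trans ?_
  · rwa [TangentBundle.trivializationAt_baseSet]
  · exact congrArg (fun f : E →L[ℝ] E => f v) h1

/-- In the chart both fields are constant near the base point. -/
theorem bracket_chartField (u v : E) : bracket (chartField x u) (chartField x v) x = 0 := by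
  have key : ∀ w, (VectorField.mpullbackWithin 𝓘(ℝ, E) 𝓘(ℝ, E) (extChartAt 𝓘(ℝ, E) x).symm
      (chartField x w) (Set.range 𝓘(ℝ, E)) : E → E) =ᶠ[nhds (extChartAt 𝓘(ℝ, E) x x)]
      fun _ => w := by
    intro w
    filter_upwards [extChartAt_target_mem_nhds (I := 𝓘(ℝ, E)) x] with z hz
    have h1 := isInvertible_mfderivWithin_extChartAt_symm hz
    have hz' : (extChartAt 𝓘(ℝ, E) x).symm z ∈ (chartAt E x).source := by
      have := (extChartAt 𝓘(ℝ, E) x).map_target hz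
      rwa [extChartAt_source] at this
    rw [ModelWithCorners.range_eq_univ, mfderivWithin_univ] at h1
    have h2 := chartField_apply hz' w
    rw [(extChartAt 𝓘(ℝ, E) x).right_inv hz] at h2
    unfold VectorField.mpullbackWithin
    rw [ModelWithCorners.range_eq_univ, mfderivWithin_univ]
    exact h1.inverse_apply_eq.2 h2
  have h : ∀ {P Q : E → E} {z : E}, P =ᶠ[nhds z] (fun _ => u) → Q =ᶠ[nhds z] (fun _ => v) →
      VectorField.lieBracketWithin ℝ P Q Set.univ z = 0 := by
    intro P Q z hP hQ
    rw [VectorField.lieBracketWithin_univ]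
    unfold VectorField.lieBracket
    rw [hP.fderiv_eq, hQ.fderiv_eq]
    simp
  unfold bracket VectorField.mlieBracket VectorField.mlieBracketWithin VectorField.mpullback
  have h2 := h (key u) (key v)
  rw [Set.preimage_univ, Set.univ_inter]
  rw [ModelWithCorners.range_eq_univ] at h2 ⊢
  exact (congrArg _ h2).trans (map_zero _)


variable {F : Type*} [NormedAddCommGroup F] [NormedSpace ℝ F]

/-- Values on pairs of basis vectors embed the forms linearly in a finite product; a linear left
inverse recovers the form. -/
theorem differentiableAt_alternating_of_apply [FiniteDimensional ℝ E] [FiniteDimensional ℝ F]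
    {b : E → E [⋀^Fin 2]→L[ℝ] F} {z : E} (hb : ∀ u v, DifferentiableAt ℝ (fun y => b y ![u, v]) z) :
    DifferentiableAt ℝ b z := by
  let B := Module.finBasis ℝ E
  let L : (E [⋀^Fin 2]→L[ℝ] F) →ₗ[ℝ]
      (Fin (Module.finrank ℝ E) × Fin (Module.finrank ℝ E) → F) :=
    { toFun := fun f p => f ![B p.1, B p.2]
      map_add' := fun _ _ => rfl
      map_smul' := fun _ _ => rfl }
  have hL : LinearMap.ker L = ⊥ := by
    refine LinearMap.ker_eq_bot'.2 fun f hf => ContinuousAlternatingMap.toAlternatingMap_injective ?_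
    refine B.ext_alternating fun v _ => ?_
    have h1 := congrFun hf (v 0, v 1)
    have h2 : (fun i => B (v i)) = ![B (v 0), B (v 1)] := by
      funext i; fin_cases i <;> rfl
    rw [h2]
    exact h1
  obtain ⟨L', hL'⟩ := L.exists_leftInverse_of_injective hL
  have h1 : DifferentiableAt ℝ (fun y => L (b y)) z := differentiableAt_pi.2 fun p => hb _ _
  have h2 : b = fun y => L'.toContinuousLinearMap (L (b y)) := by
    funext y
    exact (congrArg (fun f => f (b y)) hL').symm
  rw [h2]
  exact L'.toContinuousLinearMap.differentiableAt.comp z h1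

theorem fderiv_comp_extChartAt_symm {f : M → F} (hf : MDifferentiableAt 𝓘(ℝ, E) 𝓘(ℝ, F) f x) :
    DifferentiableAt ℝ (fun z => f ((extChartAt 𝓘(ℝ, E) x).symm z)) (extChartAt 𝓘(ℝ, E) x x) ∧
    fderiv ℝ (fun z => f ((extChartAt 𝓘(ℝ, E) x).symm z)) (extChartAt 𝓘(ℝ, E) x x) =
      dAt f x := by
  have h1 := hf.differentiableWithinAt_writtenInExtChartAt
  have h2 := hf.mfderiv
  rw [ModelWithCorners.range_eq_univ] at h1 h2
  rw [differentiableWithinAt_univ] at h1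
  rw [fderivWithin_univ] at h2
  exact ⟨h1, h2.symm⟩

/-- The differential of a two-form, in terms of fields that are constant in a chart. -/
theorem d_apply_chartField [FiniteDimensional ℝ E] [FiniteDimensional ℝ F] {a : Form E M 2 F}
    (ha : ∀ u v, MDifferentiableAt 𝓘(ℝ, E) 𝓘(ℝ, F)
      (fun y => a y ![chartField x u y, chartField x v y]) x) (u v w : E) :
    a.d x ![u, v, w] =
      dAt (fun y => a y ![chartField x v y, chartField x w y]) x u -
      dAt (fun y => a y ![chartField x u y, chartField x w y]) x v +
      dAt (fun y => a y ![chartField x u y, chartField x v y]) x w := by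
  set z₀ := extChartAt 𝓘(ℝ, E) x x
  have hE : ∀ u v, (fun z => a.inChart x z ![u, v]) =ᶠ[nhds z₀]
      fun z => (fun y => a y ![chartField x u y, chartField x v y])
        ((extChartAt 𝓘(ℝ, E) x).symm z) := by
    intro u v
    filter_upwards [extChartAt_target_mem_nhds (I := 𝓘(ℝ, E)) x] with z hz
    have hz' : (extChartAt 𝓘(ℝ, E) x).symm z ∈ (chartAt E x).source := by
      have := (extChartAt 𝓘(ℝ, E) x).map_target hz
      rwa [extChartAt_source] at this
    have h2 := fun u => chartField_apply hz' u
    rw [(extChartAt 𝓘(ℝ, E) x).right_inv hz] at h2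
    rw [h2, h2]
    refine congrArg (a ((extChartAt 𝓘(ℝ, E) x).symm z)) (funext fun i => ?_)
    fin_cases i <;> rfl
  have hd : DifferentiableAt ℝ (a.inChart x) z₀ :=
    differentiableAt_alternating_of_apply fun u v =>
      (hE u v).differentiableAt_iff.2 (fderiv_comp_extChartAt_symm (ha u v)).1
  have hf : ∀ u v p, fderiv ℝ (fun z => a.inChart x z ![u, v]) z₀ p =
      dAt (fun y => a y ![chartField x u y, chartField x v y]) x p := by
    intro u v p
    rw [(hE u v).fderiv_eq, (fderiv_comp_extChartAt_symm (ha u v)).2]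
  have h0 : a.d x ![u, v, w] = extDeriv (a.inChart x) z₀ ![u, v, w] := by
    have : (mfderiv 𝓘(ℝ, E) 𝓘(ℝ, E) (extChartAt 𝓘(ℝ, E) x) x : E →L[ℝ] E) =
      ContinuousLinearMap.id ℝ E := mfderiv_extChartAt_self
    exact congrArg (fun P : E →L[ℝ] E =>
      (extDeriv (a.inChart x) z₀).compContinuousLinearMap P ![u, v, w]) this
  rw [h0, extDeriv_apply hd, Fin.sum_univ_three]
  have e0 : (0 : Fin 3).removeNth ![u, v, w] = ![v, w] := by funext i; fin_cases i <;> rfl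
  have e1 : (1 : Fin 3).removeNth ![u, v, w] = ![u, w] := by funext i; fin_cases i <;> rfl
  have e2 : (2 : Fin 3).removeNth ![u, v, w] = ![u, v] := by funext i; fin_cases i <;> rfl
  rw [e0, e1, e2, hf, hf, hf]
  simp [sub_eq_add_neg]

end ChartFields

/-! ### The exterior derivative through connection coefficients -/

section FrameDifferential

variable {E : Type*} [NormedAddCommGroup E] [NormedSpace ℝ E]
  {M : Type*} [TopologicalSpace M] [ChartedSpace E M] [IsManifold 𝓘(ℝ, E) ∞ M] {x : M}
  {F : Type*} [NormedAddCommGroup F] [NormedSpace ℝ F]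

/-- A two-form as a bilinear map. -/
def toBilin (f : E [⋀^Fin 2]→L[ℝ] F) : E →ₗ[ℝ] E →ₗ[ℝ] F :=
  LinearMap.mk₂ ℝ (fun u v => f ![u, v])
    (fun u u' v => f.toAlternatingMap.map_vecCons_add ![v] u u')
    (fun c u v => f.toAlternatingMap.map_vecCons_smul ![v] c u)
    (fun u v v' => by
      have h : ∀ w, ![u, w] = Function.update ![u, 0] 1 w := fun w => by
        funext i; fin_cases i <;> rfl
      rw [h, h v, h v', f.map_update_add])
    (fun c u v => by
      have h : ∀ w, ![u, w] = Function.update ![u, 0] 1 w := fun w => by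
        funext i; fin_cases i <;> rfl
      rw [h, h v, f.map_update_smul])

theorem toBilin_apply (f : E [⋀^Fin 2]→L[ℝ] F) (u v : E) : toBilin f u v = f ![u, v] := rfl

theorem toBilin_swap (f : E [⋀^Fin 2]→L[ℝ] F) (u v : E) : toBilin f v u = -toBilin f u v := by
  have h := f.toAlternatingMap.map_swap ![u, v] (i := 0) (j := 1) (by decide)
  have h2 : ![u, v] ∘ Equiv.swap (0 : Fin 2) 1 = ![v, u] := by
    funext i; fin_cases i <;> rfl
  rw [h2] at h
  exact h

theorem toBilin_sum {A : Type*} [Fintype A] (f : E [⋀^Fin 2]→L[ℝ] F) (s t : A → ℝ) (b : A → E) :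
    toBilin f (∑ α, s α • b α) (∑ β, t β • b β) = ∑ α, ∑ β, (s α * t β) • f ![b α, b β] := by
  simp only [map_sum, LinearMap.sum_apply, map_smul, LinearMap.smul_apply, toBilin_apply, mul_smul,
    ← Finset.smul_sum]
  rw [Finset.sum_congr rfl fun β _ => Finset.smul_sum, Finset.sum_comm]
  refine Finset.sum_congr rfl fun α _ => ?_
  rw [Finset.smul_sum]
  exact Finset.sum_congr rfl fun β _ => smul_comm _ _ _

theorem dAt_sum_mul_smul {A : Type*} [Fintype A] {q r : A → M → ℝ}
    (hq : ∀ α, MDifferentiableAt 𝓘(ℝ, E) 𝓘(ℝ, ℝ) (q α) x)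
    (hr : ∀ α, MDifferentiableAt 𝓘(ℝ, E) 𝓘(ℝ, ℝ) (r α) x) (k : A → A → F) :
    MDifferentiableAt 𝓘(ℝ, E) 𝓘(ℝ, F) (fun y => ∑ α, ∑ β, (q α y * r β y) • k α β) x ∧
    ∀ p : E, dAt (fun y => ∑ α, ∑ β, (q α y * r β y) • k α β) x p =
      ∑ α, ∑ β, (dAt (q α) x p * r β x + q α x * dAt (r β) x p) • k α β := by
  have hd : ∀ {f : M → ℝ}, MDifferentiableAt 𝓘(ℝ, E) 𝓘(ℝ, ℝ) f x →
      HasFDerivAt (fun z => f ((extChartAt 𝓘(ℝ, E) x).symm z)) (dAt f x)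
        (extChartAt 𝓘(ℝ, E) x x) := fun hf => by
    have := fderiv_comp_extChartAt_symm hf
    rw [← this.2]
    exact this.1.hasFDerivAt
  have h1 := HasFDerivAt.fun_sum (u := Finset.univ) fun α _ =>
    HasFDerivAt.fun_sum (u := Finset.univ) fun β _ =>
      (((hd (hq α)).mul (hd (hr β))).smul_const (k α β))
  have hx := extChartAt_to_inv (I := 𝓘(ℝ, E)) x
  simp only [hx] at h1
  have h2 : HasMFDerivAt 𝓘(ℝ, E) 𝓘(ℝ, F) (fun y => ∑ α, ∑ β, (q α y * r β y) • k α β) x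
      (∑ α, ∑ β, (q α x • dAt (r β) x + r β x • dAt (q α) x).smulRight (k α β) : E →L[ℝ] F) := by
    refine ⟨?_, ?_⟩
    · exact tendsto_finsetSum _ fun α _ => tendsto_finsetSum _ fun β _ =>
        ((hq α).continuousAt.mul (hr β).continuousAt).smul_const _
    · rw [ModelWithCorners.range_eq_univ]
      exact h1.hasFDerivWithinAt
  refine ⟨h2.mdifferentiableAt, fun p => ?_⟩
  have h3 : dAt (fun y => ∑ α, ∑ β, (q α y * r β y) • k α β) x =
      (∑ α, ∑ β, (q α x • dAt (r β) x + r β x • dAt (q α) x).smulRight (k α β) : E →L[ℝ] F) :=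
    h2.mfderiv
  rw [h3]
  simp only [sum_apply, ContinuousLinearMap.smulRight_apply, add_apply, smul_apply, smul_eq_mul]
  refine Finset.sum_congr rfl fun α _ => Finset.sum_congr rfl fun β _ => ?_
  congr 1
  ring

variable [FiniteDimensional ℝ E] {H : Hypercomplex E M} {g : Metric E M} {n : ℕ}
  {e : Fin n → M → E}

/-- The derivative of a field with respect to the flat connection given by a frame. -/
def frameDeriv (H : Hypercomplex E M) (g : Metric E M) (e : Fin n → M → E) (x : M) (Q : M → E)
    (p : E) : E :=
  ∑ α, dAt (fun y => metricAt g y (Q y) (frameField H e α y)) x p • frameField H e α x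

/-- A field, expanded in a frame. -/
def frameExpansion (H : Hypercomplex E M) (g : Metric E M) (e : Fin n → M → E) (Q : M → E) :
    M → E :=
  fun y => ∑ α, metricAt g y (Q y) (frameField H e α y) • frameField H e α y

variable (he : IsLocalFrame H g x e) (hg : H.IsQuaternionicHermitian g)
  (hn : Module.finrank ℝ E = 4 * n) {D : Connection E M}

include he in
theorem IsLocalFrame.mdiff_coord {Q : M → E} (hQ : DiffAt Q x) (α : Fin n × Fin 2 × Fin 2) :
    MDifferentiableAt 𝓘(ℝ, E) 𝓘(ℝ, ℝ) (fun y => metricAt g y (Q y) (frameField H e α y)) x :=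
  hQ.inner g (DiffAt.frameField he.diff α)

include he hg hn in
theorem IsLocalFrame.frameExpansion_eventuallyEq (Q : M → E) :
    frameExpansion H g e Q =ᶠ[nhds x] Q := by
  filter_upwards [he.frame] with y hy
  exact hy.sum_repr (hg.qHerm y) hn (Q y)

-- With constant coefficients only the frame coordinates of the two fields are differentiated; this
-- is the Leibniz rule for the flat connection of the frame.
include he hg hn in
theorem IsLocalFrame.dAt_form {a : Form E M 2 F}
    (ha : ∀ α β, ∀ᶠ y in nhds x, a y ![frameField H e α y, frameField H e β y] =
      a x ![frameField H e α x, frameField H e β x])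
    {Q R : M → E} (hQ : DiffAt Q x) (hR : DiffAt R x) :
    MDifferentiableAt 𝓘(ℝ, E) 𝓘(ℝ, F) (fun y => a y ![Q y, R y]) x ∧
    ∀ p : E, dAt (fun y => a y ![Q y, R y]) x p =
      toBilin (a x) (frameDeriv H g e x Q p) (R x) +
      toBilin (a x) (Q x) (frameDeriv H g e x R p) := by
  have h := dAt_sum_mul_smul (fun α => he.mdiff_coord hQ α) (fun β => he.mdiff_coord hR β)
    (fun α β => a x ![frameField H e α x, frameField H e β x])
  have hev : (fun y => a y ![Q y, R y]) =ᶠ[nhds x] fun y =>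
      ∑ α, ∑ β, (metricAt g y (Q y) (frameField H e α y) *
        metricAt g y (R y) (frameField H e β y)) •
          a x ![frameField H e α x, frameField H e β x] := by
    filter_upwards [he.frameExpansion_eventuallyEq hg hn Q,
      he.frameExpansion_eventuallyEq hg hn R,
      Filter.eventually_all.2 fun α => Filter.eventually_all.2 (ha α)] with y h1 h2 h3
    refine (congrArg₂ (fun q r => toBilin (a y) q r) h1.symm h2.symm).trans ?_
    refine (toBilin_sum _ _ _ _).trans ?_
    simp only [h3]
  refine ⟨h.1.congr_of_eventuallyEq hev, fun p => ?_⟩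
  have h2 : dAt (E := E) (fun y => a y ![Q y, R y]) x = dAt (fun y =>
      ∑ α, ∑ β, (metricAt g y (Q y) (frameField H e α y) *
        metricAt g y (R y) (frameField H e β y)) •
          a x ![frameField H e α x, frameField H e β x]) x := hev.mfderiv_eq
  rw [h2, h.2 p]
  have hQ' : Q x = frameExpansion H g e Q x :=
    (he.frameExpansion_eventuallyEq hg hn Q).self_of_nhds.symm
  have hR' : R x = frameExpansion H g e R x :=
    (he.frameExpansion_eventuallyEq hg hn R).self_of_nhds.symm
  simp only [add_smul, Finset.sum_add_distrib]
  congr 1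
  · exact (toBilin_sum (a x) _ _ fun α => frameField H e α x).symm.trans
      (congrArg (toBilin (a x) _) hR'.symm)
  · exact (toBilin_sum (a x) _ _ fun α => frameField H e α x).symm.trans
      (congrArg (fun q => toBilin (a x) q _) hQ'.symm)

theorem covAt_sum {ι : Type*} {s : Finset ι} {q : ι → M → ℝ} {b : ι → M → E}
    (hq : ∀ i ∈ s, MDifferentiableAt 𝓘(ℝ, E) 𝓘(ℝ, ℝ) (q i) x) (hb : ∀ i ∈ s, DiffAt (b i) x)
    (p : E) :
    covAt D (fun y => ∑ i ∈ s, q i y • b i y) x p =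
      ∑ i ∈ s, (dAt (q i) x p • b i x + q i x • covAt D (b i) x p) := by
  classical
  induction s using Finset.induction_on with
  | empty =>
    simp only [Finset.sum_empty]
    have := D.zero
    exact congrArg (fun f : E →L[ℝ] E => f p) (congrFun this x)
  | insert i s hi ih =>
    have h1 := fun j hj => hq j (Finset.mem_insert_of_mem hj)
    have h2 := fun j hj => hb j (Finset.mem_insert_of_mem hj)
    simp only [Finset.sum_insert hi]
    rw [← ih h1 h2]
    have hqi := hq i (Finset.mem_insert_self _ _)
    have hbi := hb i (Finset.mem_insert_self _ _)
    have h3 := D.isCovariantDerivativeOnUniv.add (x := x) (DiffAt.smul hqi hbi)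
      (DiffAt.sum fun j hj => DiffAt.smul (h1 j hj) (h2 j hj))
    have h4 := D.isCovariantDerivativeOnUniv.leibniz (x := x) hbi hqi
    have h3' := congrArg (fun f : E →L[ℝ] E => f p) h3
    have h4' := congrArg (fun f : E →L[ℝ] E => f p) h4
    refine h3'.trans ?_
    refine congrArg₂ (· + ·) (h4'.trans ?_) rfl
    exact add_comm _ _

/-- A connection is the flat connection of the frame plus its coefficients. -/
theorem IsLocalFrame.covAt_eq {Q : M → E} (hQ : DiffAt Q x) (p : E) :
    covAt D Q x p = frameDeriv H g e x Q p + he.coef hg hn D p (Q x) := by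
  have h1 : covAt D Q x = covAt D (frameExpansion H g e Q) x :=
    D.isCovariantDerivativeOnUniv.congr_of_eventuallyEq hQ
      (DiffAt.sum fun α _ => DiffAt.smul (he.mdiff_coord hQ α) (DiffAt.frameField he.diff α))
      Filter.univ_mem (he.frameExpansion_eventuallyEq hg hn Q).symm
  rw [h1]
  have h2 := covAt_sum (D := D) (s := Finset.univ) (b := frameField H e)
    (fun α _ => he.mdiff_coord hQ α)
    (fun α _ => DiffAt.frameField he.diff α) p
  refine h2.trans ?_
  rw [Finset.sum_add_distrib]
  refine congrArg₂ (· + ·) rfl ?_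
  have h3 : Q x = frameExpansion H g e Q x :=
    (he.frameExpansion_eventuallyEq hg hn Q).self_of_nhds.symm
  conv_rhs => rw [h3]
  unfold frameExpansion
  simp only [map_sum, map_smul, he.coef_apply hg hn]

/-- The differential of a two-form with constant coefficients in a frame, by the coefficients of
a torsion-free connection. -/
theorem IsLocalFrame.d_apply [FiniteDimensional ℝ F] (hD : D.TorsionFree) {a : Form E M 2 F}
    (ha : ∀ α β, ∀ᶠ y in nhds x, a y ![frameField H e α y, frameField H e β y] =
      a x ![frameField H e α x, frameField H e β x]) (u v w : E) :
    a.d x ![u, v, w] =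
      -((a x ![he.coef hg hn D u v, w] + a x ![v, he.coef hg hn D u w]) +
        (a x ![he.coef hg hn D v w, u] + a x ![w, he.coef hg hn D v u]) +
        (a x ![he.coef hg hn D w u, v] + a x ![u, he.coef hg hn D w v])) := by
  have hf := fun u v => he.dAt_form hg hn ha (diffAt_chartField x u) (diffAt_chartField x v)
  rw [d_apply_chartField fun u v => (hf u v).1]
  simp only [(hf _ _).2, chartField_self]
  set N := he.coef hg hn D with hN
  -- Chart fields commute, so vanishing torsion expresses the antisymmetric part of the flat
  -- derivatives through `N`; all remaining derivatives then cancel.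
  have ht : ∀ p q, frameDeriv H g e x (chartField x q) p =
      frameDeriv H g e x (chartField x p) q + N q p - N p q := by
    intro p q
    have h1 := covAt_sub_of_torsionFree hD (diffAt_chartField x p) (diffAt_chartField x q)
    rw [bracket_chartField, chartField_self, chartField_self,
      he.covAt_eq hg hn (diffAt_chartField x q), he.covAt_eq hg hn (diffAt_chartField x p),
      chartField_self, chartField_self, ← hN] at h1
    rw [sub_eq_zero] at h1
    rw [← h1]
    abel
  simp only [← toBilin_apply]
  rw [ht v u, ht w u, ht w v, toBilin_swap (a x) u (N v w), toBilin_swap (a x) (N v u) w,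
    toBilin_swap (a x) v (N w u)]
  have h3 := toBilin_swap (a x) v (frameDeriv H g e x (chartField x w) u)
  have h4 := toBilin_swap (a x) v (N u w)
  simp only [map_add, map_sub, LinearMap.add_apply, LinearMap.sub_apply, h3, h4,
    toBilin_swap (a x) v (N w u)]
  abel

end FrameDifferential

/-! ### Closing the argument -/

section Metric

variable {E : Type*} [NormedAddCommGroup E] [NormedSpace ℝ E] [FiniteDimensional ℝ E]
  {M : Type*} [TopologicalSpace M] [ChartedSpace E M] [IsManifold 𝓘(ℝ, E) ∞ M] {x : M}
  {H : Hypercomplex E M} {g : Metric E M} {n : ℕ} {e : Fin n → M → E}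
  (he : IsLocalFrame H g x e) (hg : H.IsQuaternionicHermitian g)
  (hn : Module.finrank ℝ E = 4 * n) {D : Connection E M}

include hg in
theorem omega_apply (y : M) (u v : E) :
    omega g H.I y ![u, v] = metricAt g y (H.I y u) v ∧
    omega g H.J y ![u, v] = metricAt g y (H.J y u) v ∧
    omega g H.K y ![u, v] = metricAt g y (H.K y u) v := by
  have h := hg.qHerm y
  exact ⟨fundamentalForm_apply (metricAt g y) (H.I y) h.symm h.I_sq h.inv_I ![u, v],
    fundamentalForm_apply (metricAt g y) (H.J y) h.symm h.J_sq h.inv_J ![u, v],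
    fundamentalForm_apply (metricAt g y) (H.K y) h.symm h.K_sq h.inv_K ![u, v]⟩

include hg in
theorem Omega_apply (y : M) (u v : E) :
    H.Omega g y ![u, v] =
      (metricAt g y (H.J y u) v : ℂ) + Complex.I * (metricAt g y (H.K y u) v : ℂ) := by
  rw [← (omega_apply hg y u v).2.1, ← (omega_apply hg y u v).2.2]
  rfl

include he hg hn in
theorem IsLocalFrame.eventually_metricAt :
    ∀ᶠ y in nhds x, ∀ α β,
      metricAt g y (H.I y (frameField H e α y)) (frameField H e β y) =
        metricAt g x (H.I x (frameField H e α x)) (frameField H e β x) ∧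
      metricAt g y (H.J y (frameField H e α y)) (frameField H e β y) =
        metricAt g x (H.J x (frameField H e α x)) (frameField H e β x) ∧
      metricAt g y (H.K y (frameField H e α y)) (frameField H e β y) =
        metricAt g x (H.K x (frameField H e α x)) (frameField H e β x) := by
  filter_upwards [he.frame] with y hy α β
  have h := hg.qHerm
  have hIJ := he.at.liftTo_IJ (h x) hn (u := fun a => e a y) (h y)
  have hm := he.at.liftTo_g (h x) hn hy (h y)
  have hb : ∀ α, he.at.liftTo (h x) hn (H.I y) (H.J y) (fun a => e a y) (frameField H e α x) =
      frameField H e α y := he.at.liftTo_hbasis (h x) hn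
  rw [← hb α, ← hb β]
  refine ⟨?_, ?_, ?_⟩
  · rw [← hIJ.2, hm]
  · rw [← hIJ.1, hm]
  · rw [← H.I_J, ← H.I_J, ← hIJ.1, ← hIJ.2, hm]

include hg hn in
theorem IsLocalFrame.d_omega (hD : D.TorsionFree) (u v w : E) :
    (omega g H.I).d x ![u, v, w] = frameD (metricAt g x) (H.I x) (he.coef hg hn D) u v w ∧
    (omega g H.J).d x ![u, v, w] = frameD (metricAt g x) (H.J x) (he.coef hg hn D) u v w ∧
    (omega g H.K).d x ![u, v, w] = frameD (metricAt g x) (H.K x) (he.coef hg hn D) u v w := by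
  have hev := he.eventually_metricAt hg hn
  refine ⟨?_, ?_, ?_⟩
  · rw [he.d_apply hg hn hD fun α β => by
      filter_upwards [hev] with y hy
      rw [(omega_apply hg y _ _).1, (omega_apply hg x _ _).1, (hy α β).1]]
    simp only [(omega_apply hg x _ _).1]
    rfl
  · rw [he.d_apply hg hn hD fun α β => by
      filter_upwards [hev] with y hy
      rw [(omega_apply hg y _ _).2.1, (omega_apply hg x _ _).2.1, (hy α β).2.1]]
    simp only [(omega_apply hg x _ _).2.1]
    rfl
  · rw [he.d_apply hg hn hD fun α β => by
      filter_upwards [hev] with y hy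
      rw [(omega_apply hg y _ _).2.2, (omega_apply hg x _ _).2.2, (hy α β).2.2]]
    simp only [(omega_apply hg x _ _).2.2]
    rfl

include hg hn in
theorem IsLocalFrame.d_Omega (hD : D.TorsionFree) (u v w : E) :
    (H.Omega g).d x ![u, v, w] =
      (frameD (metricAt g x) (H.J x) (he.coef hg hn D) u v w : ℂ) +
        Complex.I * (frameD (metricAt g x) (H.K x) (he.coef hg hn D) u v w : ℂ) := by
  rw [he.d_apply hg hn hD fun α β => by
      filter_upwards [he.eventually_metricAt hg hn] with y hy
      rw [Omega_apply hg, Omega_apply hg, (hy α β).2.1, (hy α β).2.2]]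
  simp only [Omega_apply hg]
  unfold frameD
  push_cast
  ring

/-- An HKT metric whose form `V_{n+i,n+i}` is preserved by a torsion-free connection is
hyperkähler. -/
theorem Hypercomplex.IsHKT.isHyperkahler_of_preservesForm (hg : H.IsHKT g)
    (hn : Module.finrank ℝ E = 4 * n) {Phi : Form E M (2 * n) ℂ} (hPhi : H.IsSLnH n Phi)
    {i : ℕ} {c : ℝ} (hi : 0 < i) (hin : i < n) (hc : c ≠ 0) (hD : D.TorsionFree)
    (hV : D.PreservesForm (H.calibV g Phi i c)) : H.IsHyperkahler g := by
  have hh := hg.hermitian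
  obtain ⟨D₀, hD₀, -⟩ := hPhi.parallel
  have main : ∀ x u v w, (omega g H.I).d x ![u, v, w] = 0 ∧ (omega g H.J).d x ![u, v, w] = 0 ∧
      (omega g H.K).d x ![u, v, w] = 0 := by
    intro x u v w
    obtain ⟨e, he⟩ := exists_isLocalFrame hh x n hn.ge
    obtain ⟨κ, hκ⟩ := he.coef_omega hh hn hPhi hi hin hc hV
    have h := hh.qHerm x
    have hI := fun u v => (he.coef_IJ hh hn hD₀ u v).1
    have hJ := fun u v => (he.coef_IJ hh hn hD₀ u v).2
    have hdel : typePart (H.I x) 3 0 ((H.Omega g).d x) = 0 := congrFun hg.del_Omega x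
    have hpar := eq_zero_of_frameD h hn (by omega) he.at hI hJ (he.coef_sub hh hn hD hD₀.torsionFree)
      -- Only the real part of the vanishing $(3,0)$-part of $d\Omega$ is needed.
      hκ (fun u v w => by
        have h1 := typePart_three_eq_zero hdel u v w
        simp only [he.d_Omega hh hn hD₀.torsionFree] at h1
        have h2 := congrArg Complex.re h1
        simp at h2
        linear_combination h2)
    -- The Obata connection preserves `g` and commutes with `L`, so the form $g(L\cdot,\cdot)$ is
    -- parallel for a torsion-free connection, hence closed.
    have hzero : ∀ L : E →L[ℝ] E, (∀ u v, he.coef hh hn D₀ u (L v) = L (he.coef hh hn D₀ u v)) →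
        frameD (metricAt g x) L (he.coef hh hn D₀) u v w = 0 := by
      intro L hL
      unfold frameD
      rw [← hL, ← hL, ← hL, hpar, hpar, hpar]
      simp
    rw [(he.d_omega hh hn hD₀.torsionFree u v w).1, (he.d_omega hh hn hD₀.torsionFree u v w).2.1,
      (he.d_omega hh hn hD₀.torsionFree u v w).2.2]
    refine ⟨hzero _ hI, hzero _ hJ, hzero _ fun u v => ?_⟩
    rw [← H.I_J, hI, hJ, H.I_J]
  have hvec : ∀ v : Fin 3 → E, v = ![v 0, v 1, v 2] := fun v => by
    funext i; fin_cases i <;> rfl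
  refine ⟨hh, ?_, ?_, ?_⟩
  · funext x
    ext v
    rw [hvec v]
    exact (main x _ _ _).1
  · funext x
    ext v
    rw [hvec v]
    exact (main x _ _ _).2.1
  · funext x
    ext v
    rw [hvec v]
    exact (main x _ _ _).2.2

end Metric

end HKT

end

theorem mainTheorem9
    {E : Type*} [NormedAddCommGroup E] [NormedSpace ℝ E] [FiniteDimensional ℝ E]
    {M : Type*} [TopologicalSpace M] [T2Space M] [SecondCountableTopology M]
    [ChartedSpace E M] [IsManifold 𝓘(ℝ, E) ∞ M]
    (n : ℕ) (hdim : Module.finrank ℝ E = 4 * n)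
    (H : HKT.Hypercomplex E M)
    (Phi : HKT.Form E M (2 * n) ℂ) (hPhi : H.IsSLnH n Phi)
    (g : HKT.Metric E M) (hg : H.IsHKT g) (hnot : ¬ H.IsHyperkahler g)
    (i : ℕ) (hi : 0 < i) (hin : i < n) (c : ℝ) (hc : c ≠ 0) :
    ¬ ∃ D : HKT.Connection E M, D.TorsionFree ∧ D.PreservesForm (H.calibV g Phi i c) := by
  rintro ⟨D, hD, hV⟩
  exact hnot (hg.isHyperkahler_of_preservesForm hdim hPhi hi hin hc hD hV)
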